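/- Let $n,N\ge 1$, $p\in[1,2]$ and $\frac1{p'}=1-\frac1p$. For $q\in[1,\infty)$ let $T^{q,2}=T^{q,2}(\mathbb{R}^{n+1}_+;\mathbb{C}^N)$ be the tent space, i.e. the completion of $C_c^\infty((0,\infty)\times\mathbb{R}^n;\mathbb{C}^N)$, realised as a space of measurable functions, for the norm $$\|F\|_{T^{q,2}}=\Big(\int_{\mathbb{R}^n}\Big(\int_0^\infty\!\!\int_{B(x,t)}|F(t,y)|^2\,\frac{dy\,dt}{t^{n+1}}\Big)^{q/2}dx\Big)^{1/q}.$$ Let $\{K(t,s)\,;\,t,s>0\}$ be a strongly measurable, uniformly bounded family of bounded linear operators on $L^2(\mathbb{R}^n;\mathbb{C}^N)$ which satisfies $L^p$-$L^2$ off-diagonal bounds of some order $N'>\frac n2$ at scale $\max\{t,s\}$: there is $C>0$ such that for all Borel sets $E,F\subseteq\mathbb{R}^n$ and all $s,t>0$ $$\|\mathbf 1_E K(t,s)\mathbf 1_F\|_{L^p\to L^2}\le C\,\max\{t,s\}^{-n(\frac1p-\frac12)}\Big(1+\frac{\mathrm{dist}(E,F)}{\max\{t,s\}}\Big)^{-N'}.$$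 For $z\in\mathbb{C}$ put $$K^+_z(t,s)=\mathbf 1_{\{s<t\}}\Big(\frac st\Big)^zK(t,s),\qquad K^-_z(t,s)=\mathbf 1_{\{t<s\}}\Big(\frac ts\Big)^zK(t,s),$$ and for a kernel $\kappa$ let $T_\kappa F(t,\cdot)=\int_0^\infty \kappa(t,s)F(s,\cdot)\,\frac{ds}{s}$. Then: 1. For every $\alpha>0$, $T_{K^-_\alpha}$ is a bounded operator on $T^{1,2}$. 2. For every $\beta>\frac n{p'}$ and $\gamma\in\mathbb{R}$, $T_{K^+_{\beta+i\gamma}}$ is a bounded operator on $T^{1,2}$, and $\sup_{\gamma\in\mathbb{R}}\|T_{K^+_{\beta+i\gamma}}\|_{\mathcal L(T^{1,2})}<\infty$. 3. Let $q\in[1,p]$, $\alpha>0$ and $\beta>n(\frac1q-\frac1p)$. If the operators $T_{K^+_{i\gamma}}$, $\gamma\in\mathbb{R}$, defined on $C_c^\infty((0,\infty)\times\mathbb{R}^n;\mathbb{C}^N)$, extend to bounded operators on $T^{p,2}$ with $\sup_{\gamma\in\mathbb{R}}\|T_{K^+_{i\gamma}}\|_{\mathcal L(T^{p,2})}<\infty$,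 then $T_{K^-_\alpha+K^+_\beta}$ is a bounded operator on $T^{q,2}$. In each conclusion, for every $F$ in the tent space, the slices $F(s,\cdot)$ lie in $L^2$ for almost every $s>0$, and the $L^2$-valued integral that defines $T_\kappa F(t,\cdot)$ converges absolutely for almost every $t>0$. -/

import Mathlib

open MeasureTheory Set
open scoped ENNReal NNReal ContDiff

noncomputable section

namespace TentSIO

/-- The space variable ranges over `ℝⁿ`. -/
abbrev Space (n : ℕ) := EuclideanSpace ℝ (Fin n)

/-- Functions take their values in `ℂᴺ`. -/
abbrev Val (N : ℕ) := EuclideanSpace ℂ (Fin N)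

/-- `L²(ℝⁿ; ℂᴺ)`. -/
abbrev L2 (n N : ℕ) := Lp (Val N) 2 (volume : Measure (Space n))

/-- A family `K(t,s)` of bounded operators on `L²(ℝⁿ; ℂᴺ)`; only `t, s > 0` matter. -/
abbrev OpKernel (n N : ℕ) := ℝ → ℝ → (L2 n N →L[ℂ] L2 n N)

/-- The open upper half space `(0,∞) × ℝⁿ`. -/
def halfSpace (n : ℕ) : Set (ℝ × Space n) := Ioi 0 ×ˢ univ

/-- The cone `{(t,y) : t > 0, y ∈ B(x,t)}` with vertex `x`. -/
def cone {n : ℕ} (x : Space n) : Set (ℝ × Space n) :=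
  {z | 0 < z.1 ∧ z.2 ∈ Metric.ball x z.1}

/-- The tent space norm
`(∫ (∫∫_{t > 0, |y - x| < t} |F(t,y)|² dy dt / t^{n+1})^{p/2} dx)^{1/p}`, for `1 ≤ p < ∞`. -/
def tentNorm {n N : ℕ} (p : ℝ) (F : ℝ × Space n → Val N) : ℝ≥0∞ :=
  (∫⁻ x : Space n,
    (∫⁻ z in cone x, ‖F z‖ₑ ^ 2 / ENNReal.ofReal (z.1 ^ (n + 1))) ^ (p / 2)) ^ (1 / p)

/-- `C_c^∞` functions on the open upper half space, extended by zero. -/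
def IsTest {n N : ℕ} (F : ℝ × Space n → Val N) : Prop :=
  ContDiff ℝ ∞ F ∧ HasCompactSupport F ∧ tsupport F ⊆ halfSpace n

/-- Membership in the tent space `T^{p,2}`, the completion of `C_c^∞` of the half space for the tent
norm, realised as a space of measurable functions: those that are limits of test functions in the
tent norm. Functions that agree almost everywhere on the half space are the same element. -/
def MemTent {n N : ℕ} (p : ℝ) (F : ℝ × Space n → Val N) : Prop :=
  AEStronglyMeasurable F (volume.restrict (halfSpace n)) ∧
    ∀ ε : ℝ≥0∞, 0 < ε → ∃ φ : ℝ × Space n → Val N, IsTest φ ∧ tentNorm p (F - φ) < ε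

open scoped Classical in
/-- `F(s, ·)` as an element of `L²`. The value `0` for a slice outside `L²` is never used: `IsImage`
below asks that almost every slice be in `L²`. -/
def slice {n N : ℕ} (F : ℝ × Space n → Val N) (s : ℝ) : L2 n N :=
  if h : MemLp (fun y => F (s, y)) 2 volume then h.toLp _ else 0

/-- `G = T_K F`, that is `G(t, ·) = ∫₀^∞ K(t,s) F(s, ·) ds/s` for almost every `t > 0`, the slices
`F(s, ·)` being in `L²` for almost every `s > 0` and the `L²`-valued integral being absolutely
convergent. -/
def IsImage {n N : ℕ} (K : OpKernel n N) (F G : ℝ × Space n → Val N) : Prop :=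
  (∀ᵐ s ∂(volume.restrict (Ioi (0 : ℝ))), MemLp (fun y => F (s, y)) 2 volume) ∧
  ∀ᵐ t ∂(volume.restrict (Ioi (0 : ℝ))),
    IntegrableOn (fun s : ℝ => s⁻¹ • K t s (slice F s)) (Ioi 0) ∧
    (fun y => G (t, y)) =ᵐ[volume] (∫ s in Ioi (0 : ℝ), s⁻¹ • K t s (slice F s) : L2 n N)

/-- `T_K` is defined on all of `T^{q,2}` by its integral, and is a bounded operator on `T^{q,2}` of
norm at most `C`. -/
def BoundedOnTent {n N : ℕ} (q : ℝ) (K : OpKernel n N) (C : ℝ≥0) : Prop :=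
  ∀ F : ℝ × Space n → Val N, MemTent q F →
    ∃ G, MemTent q G ∧ IsImage K F G ∧ tentNorm q G ≤ C * tentNorm q F

/-- `T_K`, given by its integral on the dense subspace of test functions, extends to a bounded
operator on `T^{q,2}` of norm at most `C`. -/
def ExtendsBoundedOnTent {n N : ℕ} (q : ℝ) (K : OpKernel n N) (C : ℝ≥0) : Prop :=
  ∀ F : ℝ × Space n → Val N, IsTest F →
    ∃ G, MemTent q G ∧ IsImage K F G ∧ tentNorm q G ≤ C * tentNorm q F

/-- The kernel is uniformly bounded on `L²`. -/
def UniformlyBounded {n N : ℕ} (K : OpKernel n N) : Prop :=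
  ∃ M : ℝ, ∀ t s : ℝ, 0 < t → 0 < s → ‖K t s‖ ≤ M

/-- Strong measurability of `(t,s) ↦ K(t,s)`, which gives a meaning to the integral `T_K F`. -/
def StronglyMeas {n N : ℕ} (K : OpKernel n N) : Prop :=
  ∀ u : L2 n N, AEStronglyMeasurable (fun z : ℝ × ℝ => K z.1 z.2 u)
    (volume.restrict (Ioi 0 ×ˢ Ioi 0))

/-- `dist(A,B) = inf {|x - y| : x ∈ A, y ∈ B}` (it is `0` when one of the sets is empty). -/
def setDist {n : ℕ} (A B : Set (Space n)) : ℝ := ⨅ z : A × B, dist (z.1 : Space n) (z.2 : Space n)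

/-- `L^p`-`L²` off-diagonal bounds of order `M` at scale `max {t,s}`:
`‖1_A K(t,s) 1_B‖_{L^p → L²} ≤ C max{t,s}^{-n(1/p - 1/2)} (1 + dist(A,B)/max{t,s})^{-M}`,
the operator norm being tested on the dense subspace `L² ∩ L^p` of `L^p`; `v` stands for `1_B u`. -/
def OffDiagonal {n N : ℕ} (p M : ℝ) (K : OpKernel n N) : Prop :=
  ∃ C : ℝ, 0 < C ∧ ∀ A B : Set (Space n), MeasurableSet A → MeasurableSet B →
    ∀ t s : ℝ, 0 < t → 0 < s → ∀ u v : L2 n N, MemLp u (ENNReal.ofReal p) volume →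
      v =ᵐ[volume] B.indicator u →
      eLpNorm (A.indicator (K t s v)) 2 volume ≤
        ENNReal.ofReal (C * max t s ^ (-((n : ℝ) * (1 / p - 1 / 2))) *
          (1 + setDist A B / max t s) ^ (-M)) * eLpNorm u (ENNReal.ofReal p) volume

/-- `K⁺_z(t,s) = 1_{s < t} (s/t)^z K(t,s)`. -/
def kPlus {n N : ℕ} (K : OpKernel n N) (z : ℂ) : OpKernel n N :=
  fun t s => if s < t then ((s / t : ℝ) : ℂ) ^ z • K t s else 0

/-- `K⁻_z(t,s) = 1_{t < s} (t/s)^z K(t,s)`. -/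
def kMinus {n N : ℕ} (K : OpKernel n N) (z : ℂ) : OpKernel n N :=
  fun t s => if t < s then ((t / s : ℝ) : ℂ) ^ z • K t s else 0

end TentSIO

end

/-!
The proof replaces complex interpolation and atoms on balls by real arguments on dyadic cubes.

The half space is cut into Whitney boxes, one above each dyadic cube, and `F` is remembered only
through its energies `∫ |F|² dy dt / t` on the boxes. For `1 ≤ q ≤ 2` the tent norm of `F` is
comparable with the `L^q` norm of the dyadic square function of these energies. Such a sequence of
energies decomposes along the level sets of its square function. This gives an atomic principle
(`le_lintegral_dsf_of_atoms`): a sublinear quantity that is at most `|P|^{1/2}` times the `L²`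
norm on functions living above a cube `P` is at most a constant times the `T^{1,2}` norm. It also
gives a Marcinkiewicz interpolation between `T^{1,2}` and `T^{r,2}`, with a free parameter `δ`
(`exists_lintegral_coneSq_image_interpolation`).

On a function above a cube `P`, Schur's lemma controls the energy of the image near `P`, and the
off-diagonal bounds control it on dyadic annuli around `P`; the annuli can be summed because the
order of decay exceeds `n/2`. For `K⁻_α` nothing is lost, since `s` is the larger scale. For `K⁺_β`
the decay is at scale `t` while `s` is comparable with the side of `P` or smaller, and the factor
`(s/t)^β` pays for the difference as soon as `β > n(1 - 1/p)`
(`KernelBound.localBound`, `exists_lintegral_coneSq_image_rpow_half_le`). This proves the bounds on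
`T^{1,2}`; for `K⁻_α` on `T^{q,2}`, interpolate with `T^{2,2}`.

For `K⁺_β` on `T^{q,2}`, `1 < q ≤ p`, split the kernel into the shells `⌊log t⌋ - ⌊log s⌋ = j`,
`j ≥ 0`. By finite Fourier analysis on `ℤ/L`, `L → ∞`, a shell is a limit of averages of
`T_{K⁺_0}` conjugated by unimodular functions of the height, and on the shell `(s/t)^β` is `e^{-βj}`
times bounded functions of `t` and of `s`; so its norm on `T^{p,2}` decays like `e^{-βj}`
(`tentBound_multShell`). On `T^{1,2}` its norm is at
most a multiple of `e^{(β₀ - β)j}` for any `β₀ > n(1 - 1/p)`. Interpolation gives geometric decay on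
`T^{q,2}` as soon as `β > n(1/q - 1/p)` (`exists_tentBound_multShell`), and the shells can be
summed.

The integrals converge on the whole tent space because on a dyadic layer of heights `s ≈ 2^k` the
norms `‖F(s,·)‖_{L^r}`, `q ≤ r ≤ 2`, have an integral in `ds/s` that is `O(2^{kn(1/r - 1/q)})`; this
is used with `r = p` below the height `t` and with `r = 2` above it. The tent space consists of all
measurable functions of finite tent norm, and bounds on bounded functions of compact support pass
to it by Fatou's lemma.
-/

noncomputable section

namespace TentSIO

variable {n N : ℕ}

/-! ### Dyadic cubes -/

/-- A tile: the pair of a scale `k`, standing for the side length `2 ^ k`, and of the integer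
coordinates of a dyadic cube of that side length. It also labels the Whitney box above that cube. -/
abbrev Tile (n : ℕ) := ℤ × (Fin n → ℤ)

/-- Integer coordinates of the dyadic cube of side length `2 ^ k` that contains `y`. -/
def cubeIdx {n : ℕ} (k : ℤ) (y : Space n) : Fin n → ℤ := fun j => ⌊y j / 2 ^ k⌋

/-- The half-open dyadic cube with label `τ`. -/
def cube {n : ℕ} (τ : Tile n) : Set (Space n) := {y | cubeIdx τ.1 y = τ.2}

lemma measurable_cubeIdx (k : ℤ) : Measurable (cubeIdx (n := n) k) := by
  unfold cubeIdx
  fun_prop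

lemma measurableSet_cube (τ : Tile n) : MeasurableSet (cube τ) :=
  measurable_cubeIdx τ.1 (measurableSet_singleton τ.2)

lemma mem_cube_cubeIdx (k : ℤ) (x : Space n) : x ∈ cube (k, cubeIdx k x) := rfl

lemma mem_cube_iff {τ : Tile n} {x : Space n} : x ∈ cube τ ↔ τ = (τ.1, cubeIdx τ.1 x) := by
  constructor
  · intro h; exact Prod.ext rfl h.symm
  · intro h; rw [h]; rfl

lemma cubeIdx_eq_of_le {k k' : ℤ} (h : k ≤ k') {x y : Space n} (hxy : cubeIdx k x = cubeIdx k y) :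
    cubeIdx k' x = cubeIdx k' y := by
  obtain ⟨d, rfl⟩ := Int.le.dest h
  funext j
  have key : ∀ z : Space n, cubeIdx (k + d) z j = cubeIdx k z j / ((2 ^ d : ℕ) : ℤ) := by
    intro z
    have : z j / (2 : ℝ) ^ (k + (d : ℤ)) = z j / 2 ^ k / ((2 ^ d : ℕ) : ℝ) := by
      rw [zpow_add₀ (by norm_num), zpow_natCast]
      push_cast
      field_simp
    simp only [cubeIdx]
    rw [this, Int.floor_div_natCast]
  rw [key, key, hxy]

lemma cube_eq_preimage (τ : Tile n) : cube τ =
    (fun y : Space n => WithLp.ofLp y) ⁻¹'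
      (univ.pi fun j => Ico ((τ.2 j : ℝ) * 2 ^ τ.1) ((τ.2 j : ℝ) * 2 ^ τ.1 + 2 ^ τ.1)) := by
  have h2 : (0 : ℝ) < 2 ^ τ.1 := by positivity
  ext y
  simp only [cube, mem_ofPred_eq, mem_preimage, mem_univ_pi, mem_Ico]
  rw [funext_iff]
  refine forall_congr' fun j => ?_
  rw [cubeIdx, Int.floor_eq_iff, le_div_iff₀ h2, div_lt_iff₀ h2, add_mul, one_mul]

lemma volume_cube (τ : Tile n) : volume (cube τ) = ENNReal.ofReal ((2 ^ τ.1) ^ n) := by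
  rw [cube_eq_preimage, (PiLp.volume_preserving_ofLp (Fin n)).measure_preimage
    (MeasurableSet.univ_pi fun _ => measurableSet_Ico).nullMeasurableSet, Real.volume_pi_Ico]
  have h2 : (0 : ℝ) ≤ 2 ^ τ.1 := by positivity
  simp [ENNReal.ofReal_pow h2]

lemma volume_cube_ne_zero (τ : Tile n) : volume (cube τ) ≠ 0 := by
  rw [volume_cube]
  simp only [ne_eq, ENNReal.ofReal_eq_zero, not_le]
  positivity

lemma volume_cube_ne_top (τ : Tile n) : volume (cube τ) ≠ ⊤ := by
  rw [volume_cube]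
  exact ENNReal.ofReal_ne_top

lemma dist_le_of_mem_cube {τ : Tile n} {x y : Space n} (hx : x ∈ cube τ) (hy : y ∈ cube τ) :
    dist x y ≤ n * 2 ^ τ.1 := by
  rw [cube_eq_preimage] at hx hy
  simp only [mem_preimage, mem_univ_pi, mem_Ico] at hx hy
  have h2 : (0 : ℝ) < 2 ^ τ.1 := by positivity
  rw [EuclideanSpace.dist_eq]
  refine Real.sqrt_le_iff.mpr ⟨by positivity, ?_⟩
  have h1 : ∑ i, dist (x i) (y i) ^ 2 ≤ ∑ _i : Fin n, ((2 : ℝ) ^ τ.1) ^ 2 := by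
    refine Finset.sum_le_sum fun i _ => ?_
    have : dist (x i) (y i) ≤ 2 ^ τ.1 := by
      rw [Real.dist_eq, abs_le]
      have := hx i; have := hy i
      constructor <;> linarith
    exact pow_le_pow_left₀ dist_nonneg this 2
  refine h1.trans ?_
  rw [Finset.sum_const, Finset.card_univ, Fintype.card_fin, nsmul_eq_mul, mul_pow]
  rcases Nat.eq_zero_or_pos n with h | h
  · subst h; simp
  · have : (1 : ℝ) ≤ n := by exact_mod_cast h
    have h3 : (n : ℝ) ≤ (n : ℝ) ^ 2 := by nlinarith
    exact mul_le_mul_of_nonneg_right h3 (by positivity)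

/-! ### The dyadic square function -/

/-- The square of the dyadic square function of the energies `e τ` carried by the tiles:
the sum of the densities `e τ / |τ|` over the cubes that contain `x`. -/
def sq (e : Tile n → ℝ≥0∞) (x : Space n) : ℝ≥0∞ :=
  ∑' τ, (cube τ).indicator (fun _ => e τ / volume (cube τ)) x

lemma measurable_sq (e : Tile n → ℝ≥0∞) : Measurable (sq e) :=
  Measurable.tsum fun τ => measurable_const.indicator (measurableSet_cube τ)

lemma sq_eq (e : Tile n → ℝ≥0∞) (x : Space n) :
    sq e x = ∑' k : ℤ, e (k, cubeIdx k x) / volume (cube (k, cubeIdx k x)) := by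
  unfold sq
  rw [ENNReal.tsum_prod']
  congr 1; funext k
  rw [tsum_eq_single (cubeIdx k x)]
  · rw [indicator_of_mem (mem_cube_cubeIdx k x)]
  · intro κ hκ
    apply indicator_of_notMem
    intro h; exact hκ h.symm

lemma sq_mono {e e' : Tile n → ℝ≥0∞} (h : e ≤ e') : sq e ≤ sq e' := by
  intro x
  refine ENNReal.tsum_le_tsum fun τ => ?_
  apply indicator_le_indicator
  exact ENNReal.div_le_div_right (h τ) _

lemma setLIntegral_sq (e : Tile n → ℝ≥0∞) (A : Set (Space n)) :
    ∫⁻ x in A, sq e x = ∑' τ, e τ / volume (cube τ) * volume (cube τ ∩ A) := by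
  unfold sq
  rw [lintegral_tsum fun τ => (measurable_const.indicator (measurableSet_cube τ)).aemeasurable]
  congr 1; funext τ
  rw [lintegral_indicator_const (measurableSet_cube τ), Measure.restrict_apply
    (measurableSet_cube τ)]

lemma lintegral_sq (e : Tile n → ℝ≥0∞) : ∫⁻ x, sq e x = ∑' τ, e τ := by
  have := setLIntegral_sq e univ
  rw [Measure.restrict_univ] at this
  rw [this]
  congr 1; funext τ
  rw [inter_univ, ENNReal.div_mul_cancel (volume_cube_ne_zero τ) (volume_cube_ne_top τ)]

/-- The tiles whose cube is filled by `O` to more than one half. -/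
def heavy (O : Set (Space n)) : Set (Tile n) :=
  {τ | volume (cube τ) < 2 * volume (cube τ ∩ O)}

lemma exists_notMem_of_not_heavy {O : Set (Space n)} {τ : Tile n} (h : τ ∉ heavy O) :
    ∃ x ∈ cube τ, x ∉ O := by
  by_contra! hc
  apply h
  have : cube τ ∩ O = cube τ := inter_eq_left.mpr hc
  rw [heavy, mem_ofPred_eq, this, two_mul]
  exact ENNReal.lt_add_right (volume_cube_ne_top τ) (volume_cube_ne_zero τ)

/-- Removing the tiles that are heavy for the exceptional set where the square function is large
leaves a square function that is small everywhere: the smallest remaining cube above a point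
contains a point outside the exceptional set, which lies in the same larger cubes. -/
lemma sq_indicator_compl_heavy_le {e : Tile n → ℝ≥0∞} {O : Set (Space n)} {Λ : ℝ≥0∞}
    (h : ∀ x, x ∉ O → sq e x ≤ Λ) (x : Space n) : sq ((heavy O)ᶜ.indicator e) x ≤ Λ := by
  classical
  rw [sq_eq, ENNReal.tsum_eq_iSup_sum]
  refine iSup_le fun s => ?_
  set s' := s.filter fun k => (k, cubeIdx k x) ∉ heavy O with hs'
  have hsum : ∑ k ∈ s, (heavy O)ᶜ.indicator e (k, cubeIdx k x) / volume (cube (k, cubeIdx k x))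
      = ∑ k ∈ s', e (k, cubeIdx k x) / volume (cube (k, cubeIdx k x)) := by
    rw [hs', Finset.sum_filter]
    refine Finset.sum_congr rfl fun k _ => ?_
    by_cases hk : (k, cubeIdx k x) ∈ heavy O
    · simp [hk]
    · simp [hk]
  rw [hsum]
  rcases s'.eq_empty_or_nonempty with he | hne
  · simp [he]
  set k₀ := s'.min' hne
  have hk₀ : (k₀, cubeIdx k₀ x) ∉ heavy O := (Finset.mem_filter.mp (s'.min'_mem hne)).2
  obtain ⟨x', hx', hx'O⟩ := exists_notMem_of_not_heavy hk₀
  refine le_trans ?_ (h x' hx'O)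
  rw [sq_eq e x']
  refine le_trans (Finset.sum_le_sum fun k hk => ?_) (ENNReal.sum_le_tsum s')
  have : cubeIdx k x' = cubeIdx k x := cubeIdx_eq_of_le (s'.min'_le k hk) hx'
  rw [this]

/-- The heavy tiles that are not contained in a larger heavy tile. -/
def maxHeavy (O : Set (Space n)) : Set (Tile n) :=
  {P | P ∈ heavy O ∧ ∀ k > P.1, ∀ x ∈ cube P, (k, cubeIdx k x) ∉ heavy O}

lemma exists_maxHeavy (hn : 0 < n) {O : Set (Space n)} (hO : volume O ≠ ⊤) {τ : Tile n}
    (hτ : τ ∈ heavy O) : ∃ P ∈ maxHeavy O, cube τ ⊆ cube P := by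
  obtain ⟨x, hx⟩ : (cube τ).Nonempty := nonempty_of_measure_ne_zero (volume_cube_ne_zero τ)
  obtain ⟨L, hL⟩ : ∃ L : ℕ, 2 * volume O < L :=
    ENNReal.exists_nat_gt (ENNReal.mul_ne_top (by simp) hO)
  have hbdd : ∀ k : ℤ, (τ.1 ≤ k ∧ (k, cubeIdx k x) ∈ heavy O) → k ≤ L := by
    intro k ⟨_, hk⟩
    by_contra! hlt
    have h1 : volume (cube (k, cubeIdx k x)) < L :=
      lt_of_lt_of_le hk ((mul_le_mul_right (measure_mono inter_subset_right) 2).trans hL.le)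
    rw [volume_cube] at h1
    have hk0 : (0 : ℤ) ≤ k := by omega
    obtain ⟨m, rfl⟩ := Int.eq_ofNat_of_zero_le hk0
    have h2 : (L : ℝ) ≤ ((2 : ℝ) ^ (m : ℤ)) ^ n := by
      rw [zpow_natCast]
      have h3 : (L : ℝ) ≤ 2 ^ m := by
        have : L < 2 ^ L := Nat.lt_two_pow_self
        have h4 : (2 : ℕ) ^ L ≤ 2 ^ m := Nat.pow_le_pow_right (by norm_num) (by omega)
        exact_mod_cast (this.le.trans h4)
      refine h3.trans (le_self_pow₀ (one_le_pow₀ (by norm_num)) hn.ne')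
    have := ENNReal.ofReal_le_ofReal h2
    rw [ENNReal.ofReal_natCast] at this
    exact absurd (lt_of_lt_of_le h1 this) (lt_irrefl _)
  have hτ' : τ = (τ.1, cubeIdx τ.1 x) := mem_cube_iff.mp hx
  obtain ⟨k, ⟨hk1, hk2⟩, hk3⟩ := Int.exists_greatest_of_bdd ⟨L, hbdd⟩
    ⟨τ.1, le_rfl, hτ' ▸ hτ⟩
  have hsub : cube τ ⊆ cube (k, cubeIdx k x) := by
    intro y hy
    have : cubeIdx τ.1 y = cubeIdx τ.1 x := by rw [hy, hx]
    exact cubeIdx_eq_of_le hk1 this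
  refine ⟨(k, cubeIdx k x), ⟨hk2, fun k' hk' y hy hmem => ?_⟩, hsub⟩
  have : cubeIdx k' y = cubeIdx k' x := cubeIdx_eq_of_le (le_of_lt hk') hy
  rw [this] at hmem
  exact absurd (hk3 k' ⟨hk1.trans (le_of_lt hk'), hmem⟩) (not_le.mpr hk')

lemma pairwise_disjoint_maxHeavy (O : Set (Space n)) :
    (maxHeavy O).Pairwise (Function.onFun Disjoint cube) := by
  intro P hP P' hP' hne
  rw [Function.onFun, Set.disjoint_left]
  intro x hx hx'
  have h1 := mem_cube_iff.mp hx
  have h2 := mem_cube_iff.mp hx'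
  rcases lt_trichotomy P.1 P'.1 with h | h | h
  · exact hP.2 _ h x hx (h2 ▸ hP'.1)
  · apply hne; rw [h1, h2, h]
  · exact hP'.2 _ h x hx' (h1 ▸ hP.1)

lemma tsum_volume_maxHeavy_le {O : Set (Space n)} (hO : MeasurableSet O) :
    ∑' P : maxHeavy O, volume (cube (P : Tile n)) ≤ 2 * volume O := by
  calc ∑' P : maxHeavy O, volume (cube (P : Tile n))
      ≤ ∑' P : maxHeavy O, 2 * volume (cube (P : Tile n) ∩ O) :=
        ENNReal.tsum_le_tsum fun P => (le_of_lt P.2.1)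
    _ = 2 * ∑' P : maxHeavy O, volume (cube (P : Tile n) ∩ O) := ENNReal.tsum_mul_left
    _ = 2 * volume (⋃ P : maxHeavy O, cube (P : Tile n) ∩ O) := by
        rw [measure_iUnion _ fun P => (measurableSet_cube _).inter hO]
        intro P P' hne
        exact ((pairwise_disjoint_maxHeavy O) P.2 P'.2 (fun h => hne (Subtype.ext h))).mono
          inter_subset_left inter_subset_left
    _ ≤ 2 * volume O :=
        mul_le_mul_right (measure_mono (iUnion_subset fun P => inter_subset_right)) 2

lemma volume_iUnion_heavy_le (hn : 0 < n) {O : Set (Space n)} (hO : MeasurableSet O)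
    (hO' : volume O ≠ ⊤) : volume (⋃ τ ∈ heavy O, cube τ) ≤ 2 * volume O := by
  refine le_trans ?_ (tsum_volume_maxHeavy_le hO)
  refine le_trans (measure_mono ?_) (measure_iUnion_le _)
  refine iUnion₂_subset fun τ hτ => ?_
  obtain ⟨P, hP, hsub⟩ := exists_maxHeavy hn hO' hτ
  exact hsub.trans (subset_iUnion (fun P : maxHeavy O => cube (P : Tile n)) ⟨P, hP⟩)

/-! ### Atomic decomposition -/

/-- The dyadic square function of the energies `e τ`. -/
def dsf (e : Tile n → ℝ≥0∞) (x : Space n) : ℝ≥0∞ := sq e x ^ (1 / 2 : ℝ)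

lemma measurable_dsf (e : Tile n → ℝ≥0∞) : Measurable (dsf e) :=
  (measurable_sq e).pow_const _

lemma dsf_rpow (e : Tile n → ℝ≥0∞) (r : ℝ) (x : Space n) :
    dsf e x ^ r = sq e x ^ (r / 2) := by
  rw [dsf, ← ENNReal.rpow_mul]; congr 1; ring

lemma rpow_half_sq (a : ℝ≥0∞) : (a ^ 2) ^ (1 / 2 : ℝ) = a := by
  rw [← ENNReal.rpow_natCast, ← ENNReal.rpow_mul]; simp

lemma sq_rpow_half (a : ℝ≥0∞) : (a ^ (1 / 2 : ℝ)) ^ 2 = a := by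
  rw [← ENNReal.rpow_natCast, ← ENNReal.rpow_mul]; simp

lemma exists_lt_two_zpow {D : ℝ≥0∞} (hD : D ≠ ⊤) : ∃ L : ℤ, D < 2 ^ L := by
  obtain ⟨m, hm⟩ := ENNReal.exists_nat_gt hD
  refine ⟨m, hm.trans ?_⟩
  rw [zpow_natCast]
  exact_mod_cast Nat.lt_two_pow_self

lemma exists_two_zpow_lt {b : ℝ≥0∞} (hb : b ≠ 0) : ∃ l : ℤ, (2 : ℝ≥0∞) ^ l < b := by
  rcases eq_or_ne b ⊤ with rfl | hb'
  · exact ⟨0, by simp⟩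
  · obtain ⟨l, hl⟩ := ENNReal.exists_mem_Ioc_zpow hb hb' (y := 2) (by norm_num) (by simp)
    exact ⟨l, hl.1⟩

lemma tsum_two_zpow_le (b : ℝ≥0∞) :
    ∑' l : ℤ, {l : ℤ | (2 : ℝ≥0∞) ^ l < b}.indicator (fun l => (2 : ℝ≥0∞) ^ l) l ≤ 2 * b := by
  rcases eq_or_ne b ⊤ with rfl | hb
  · simp
  rcases eq_or_ne b 0 with rfl | hb0
  · simp
  obtain ⟨L, hL⟩ := exists_lt_two_zpow hb
  obtain ⟨l₀, hl₀⟩ := exists_two_zpow_lt hb0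
  have hmono := ENNReal.monotone_zpow (x := 2) (by norm_num)
  obtain ⟨K, hK, hmax⟩ := Int.exists_greatest_of_bdd (P := fun l : ℤ => (2 : ℝ≥0∞) ^ l < b)
    ⟨L, fun z hz => by
      by_contra! h
      exact absurd (hz.trans hL) (not_lt.mpr (hmono h.le))⟩ ⟨l₀, hl₀⟩
  have hinj : Function.Injective fun j : ℕ => K - (j : ℤ) := by
    intro a b h; simpa using h
  rw [← hinj.tsum_eq]
  · calc ∑' j : ℕ, {l : ℤ | (2 : ℝ≥0∞) ^ l < b}.indicator (fun l => (2 : ℝ≥0∞) ^ l) (K - (j : ℤ))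
        ≤ ∑' j : ℕ, (2 : ℝ≥0∞) ^ K * 2⁻¹ ^ j := by
          refine ENNReal.tsum_le_tsum fun j => ?_
          refine (indicator_le_self' (fun _ _ => zero_le) _).trans (le_of_eq ?_)
          rw [ENNReal.zpow_sub (by simp) (by simp), zpow_natCast, ENNReal.inv_pow]
      _ = 2 ^ K * 2 := by rw [ENNReal.tsum_mul_left, ENNReal.tsum_geometric]; simp
      _ ≤ 2 * b := by rw [mul_comm]; exact mul_le_mul_right hK.le 2
  · intro l hl
    have hl' : (2 : ℝ≥0∞) ^ l < b := by
      by_contra h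
      exact hl (indicator_of_notMem (s := {l : ℤ | (2 : ℝ≥0∞) ^ l < b}) h _)
    have := hmax l hl'
    refine ⟨(K - l).toNat, ?_⟩
    simp only
    omega

/-- A quantity that is countably subadditive over partitions of the tiles, and that on tiles inside
one cube `P` is at most `C |P|^{1/2}` times the square root of the energy, is at most `12 C` times
the `L¹` norm of the dyadic square function. The atoms are the tiles that are heavy for the level
set `{S > 2^l}` but not for `{S > 2^(l+1)}`, grouped by the maximal heavy cubes. -/
theorem le_lintegral_dsf_of_atoms (hn : 0 < n) (e : Tile n → ℝ≥0∞) (N : Set (Tile n) → ℝ≥0∞)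
    (C : ℝ≥0∞)
    (hsub : ∀ f : Tile n → ℤ × Tile n, N univ ≤ ∑' i, N (f ⁻¹' {i}))
    (hatom : ∀ (P : Tile n) (T : Set (Tile n)), (∀ τ ∈ T, cube τ ⊆ cube P) →
      N T ≤ C * volume (cube P) ^ (1 / 2 : ℝ) * (∑' τ, T.indicator e τ) ^ (1 / 2 : ℝ))
    (hfin : ∫⁻ x, dsf e x ≠ ⊤) :
    N univ ≤ 12 * C * ∫⁻ x, dsf e x := by
  classical
  set J := ∫⁻ x, dsf e x with hJ
  set O : ℤ → Set (Space n) := fun l => {x | (2 : ℝ≥0∞) ^ l < dsf e x} with hOdef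
  have h20 : ∀ l : ℤ, (2 : ℝ≥0∞) ^ l ≠ 0 := fun l => (ENNReal.zpow_pos (by simp) (by simp) l).ne'
  have h2t : ∀ l : ℤ, (2 : ℝ≥0∞) ^ l ≠ ⊤ := fun l => ENNReal.zpow_ne_top (by simp) (by simp) l
  have hOm : ∀ l, MeasurableSet (O l) := fun l => measurableSet_lt measurable_const (measurable_dsf e)
  have hOvol : ∀ l, 2 ^ l * volume (O l) ≤ J := fun l =>
    (mul_le_mul_right (measure_mono (t := {x | (2 : ℝ≥0∞) ^ l ≤ dsf e x})
      fun x hx => le_of_lt (show (2 : ℝ≥0∞) ^ l < dsf e x from hx)) _).trans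
      (mul_meas_ge_le_lintegral (measurable_dsf e) (2 ^ l))
  have hOtop : ∀ l, volume (O l) ≠ ⊤ := fun l h => by
    have := hOvol l
    rw [h, ENNReal.mul_top (h20 l), top_le_iff] at this
    exact hfin this
  -- the level of a tile is the largest `l` for which it is heavy
  have hlev : ∀ τ, e τ ≠ 0 → ∃ l, τ ∈ heavy (O l) ∧ τ ∉ heavy (O (l + 1)) := by
    intro τ hτ
    have hv0 := volume_cube_ne_zero τ
    have hvt := volume_cube_ne_top τ
    have hne : ∃ l, τ ∈ heavy (O l) := by
      have hb : (e τ / volume (cube τ)) ^ (1 / 2 : ℝ) ≠ 0 := by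
        rw [Ne, ENNReal.rpow_eq_zero_iff_of_pos (by norm_num), ENNReal.div_eq_zero_iff]
        push Not
        exact ⟨hτ, hvt⟩
      obtain ⟨l, hl⟩ := exists_two_zpow_lt hb
      refine ⟨l, ?_⟩
      have : cube τ ∩ O l = cube τ := by
        refine inter_eq_left.mpr fun x hx => hl.trans_le ?_
        refine ENNReal.rpow_le_rpow ?_ (by norm_num)
        refine le_trans (le_of_eq ?_) (ENNReal.le_tsum τ)
        rw [indicator_of_mem hx]
      rw [heavy, mem_ofPred_eq, this, two_mul]
      exact ENNReal.lt_add_right hvt hv0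
    obtain ⟨L, hL⟩ : ∃ L : ℤ, 2 * J / volume (cube τ) < 2 ^ L :=
      exists_lt_two_zpow (ENNReal.div_ne_top (ENNReal.mul_ne_top (by simp) hfin) hv0)
    have hbdd : ∀ l : ℤ, τ ∈ heavy (O l) → l ≤ L := by
      intro l hl
      by_contra! hlt
      have h1 : (2 : ℝ≥0∞) ^ L ≤ 2 ^ l := ENNReal.monotone_zpow (by norm_num) hlt.le
      have h2 : 2 ^ l * volume (cube τ) ≤ 2 * J := by
        calc 2 ^ l * volume (cube τ) ≤ 2 ^ l * (2 * volume (cube τ ∩ O l)) :=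
              mul_le_mul_right (le_of_lt hl) _
          _ ≤ 2 ^ l * (2 * volume (O l)) := by gcongr; exact inter_subset_right
          _ = 2 * (2 ^ l * volume (O l)) := by ring
          _ ≤ 2 * J := by gcongr; exact hOvol l
      have h3 := (ENNReal.le_div_iff_mul_le (Or.inl hv0) (Or.inl hvt)).mpr h2
      exact absurd (h1.trans h3) (not_le.mpr hL)
    obtain ⟨l, hl1, hl2⟩ := Int.exists_greatest_of_bdd ⟨L, hbdd⟩ hne
    exact ⟨l, hl1, fun h => by have := hl2 _ h; omega⟩
  -- the atom of a tile: its level, and the maximal heavy cube of that level above it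
  have hchoice : ∀ τ, ∃ i : ℤ × Tile n, cube τ ⊆ cube i.2 ∧ (e τ ≠ 0 →
      τ ∉ heavy (O (i.1 + 1)) ∧ i.2 ∈ maxHeavy (O i.1)) := by
    intro τ
    by_cases hτ : e τ = 0
    · exact ⟨(0, τ), subset_rfl, fun h => absurd hτ h⟩
    · obtain ⟨l, h1, h2⟩ := hlev τ hτ
      obtain ⟨P, hP, hsubP⟩ := exists_maxHeavy hn (hOtop l) h1
      exact ⟨(l, P), hsubP, fun _ => ⟨h2, hP⟩⟩
  choose f hf1 hf2 using hchoice
  -- half of each cube of the atom lies where `S ≤ 2^(l+1)`, so the energy is at most a multiple of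
  -- the integral of `S²` over that part of `P`
  have henergy : ∀ i : ℤ × Tile n, ∑' τ, (f ⁻¹' {i}).indicator e τ ≤
      (maxHeavy (O i.1)).indicator (fun P => (3 * 2 ^ i.1) ^ 2 * volume (cube P)) i.2 := by
    rintro ⟨l, P⟩
    by_cases hP : P ∈ maxHeavy (O l)
    swap
    · rw [indicator_of_notMem hP, nonpos_iff_eq_zero, ENNReal.tsum_eq_zero]
      intro τ
      by_cases hτ : f τ = (l, P)
      · rw [indicator_of_mem (show τ ∈ f ⁻¹' {(l, P)} from hτ)]
        by_contra h
        have := (hf2 τ h).2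
        rw [hτ] at this
        exact hP this
      · rw [indicator_of_notMem (show τ ∉ f ⁻¹' {(l, P)} from hτ)]
    rw [indicator_of_mem hP]
    set A := cube P \ O (l + 1)
    calc ∑' τ, (f ⁻¹' {(l, P)}).indicator e τ
        ≤ ∑' τ, 2 * (e τ / volume (cube τ) * volume (cube τ ∩ A)) := by
          refine ENNReal.tsum_le_tsum fun τ => ?_
          by_cases hτ : f τ = (l, P)
          swap
          · rw [indicator_of_notMem (show τ ∉ f ⁻¹' {(l, P)} from hτ)]; exact zero_le
          rw [indicator_of_mem (show τ ∈ f ⁻¹' {(l, P)} from hτ)]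
          by_cases he : e τ = 0
          · rw [he]; exact zero_le
          have hnot := (hf2 τ he).1
          have hsubP := hf1 τ
          rw [hτ] at hnot hsubP
          have hA : cube τ ∩ A = cube τ \ O (l + 1) := by
            ext x; constructor
            · rintro ⟨h1, h2⟩; exact ⟨h1, h2.2⟩
            · rintro ⟨h1, h2⟩; exact ⟨h1, hsubP h1, h2⟩
          have hhalf : volume (cube τ) ≤ 2 * volume (cube τ ∩ A) := by
            rw [hA]
            have h1 : volume (cube τ ∩ O (l + 1)) + volume (cube τ \ O (l + 1))
              = volume (cube τ) := measure_inter_add_sdiff _ (hOm _)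
            have h2 : 2 * volume (cube τ ∩ O (l + 1)) ≤ volume (cube τ) := not_lt.mp hnot
            have ht : volume (cube τ) ≠ ⊤ := volume_cube_ne_top τ
            have h3 : volume (cube τ) + volume (cube τ) ≤
                volume (cube τ) + 2 * volume (cube τ \ O (l + 1)) := by
              calc volume (cube τ) + volume (cube τ)
                  = 2 * volume (cube τ ∩ O (l + 1)) + 2 * volume (cube τ \ O (l + 1)) := by
                    rw [← mul_add, h1, two_mul]
                _ ≤ _ := by gcongr
            exact (ENNReal.add_le_add_iff_left ht).mp h3
          calc e τ = e τ / volume (cube τ) * volume (cube τ) :=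
                (ENNReal.div_mul_cancel (volume_cube_ne_zero τ) (volume_cube_ne_top τ)).symm
            _ ≤ e τ / volume (cube τ) * (2 * volume (cube τ ∩ A)) := by gcongr
            _ = _ := by ring
      _ = 2 * ∫⁻ x in A, sq e x := by rw [ENNReal.tsum_mul_left, setLIntegral_sq]
      _ ≤ 2 * ∫⁻ _x in A, (2 ^ (l + 1)) ^ 2 := by
          gcongr 2 * ?_
          refine setLIntegral_mono measurable_const fun x hx => ?_
          have : dsf e x ≤ 2 ^ (l + 1) := not_lt.mp hx.2
          calc sq e x = dsf e x ^ 2 := by rw [dsf, sq_rpow_half]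
            _ ≤ _ := by gcongr
      _ ≤ 2 * ((2 ^ (l + 1)) ^ 2 * volume (cube P)) := by
          rw [setLIntegral_const]; gcongr; exact sdiff_subset
      _ ≤ (3 * 2 ^ l) ^ 2 * volume (cube P) := by
          rw [ENNReal.zpow_add (by simp) (by simp), zpow_one]
          calc 2 * ((2 ^ l * 2) ^ 2 * volume (cube P))
              = 8 * ((2 ^ l) ^ 2 * volume (cube P)) := by ring
            _ ≤ 9 * ((2 ^ l) ^ 2 * volume (cube P)) := by gcongr; norm_num
            _ = _ := by ring
  have hterm : ∀ i : ℤ × Tile n, N (f ⁻¹' {i}) ≤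
      (maxHeavy (O i.1)).indicator (fun P => 3 * C * 2 ^ i.1 * volume (cube P)) i.2 := by
    intro i
    refine (hatom i.2 (f ⁻¹' {i}) fun τ hτ => ?_).trans ?_
    · have := hf1 τ; rwa [show f τ = i from hτ] at this
    refine (mul_le_mul_right (ENNReal.rpow_le_rpow (henergy i) (by norm_num)) _).trans ?_
    by_cases hP : i.2 ∈ maxHeavy (O i.1)
    · rw [indicator_of_mem hP, indicator_of_mem hP, ENNReal.mul_rpow_of_nonneg _ _ (by norm_num),
        rpow_half_sq]
      apply le_of_eq
      calc C * volume (cube i.2) ^ (1 / 2 : ℝ) * (3 * 2 ^ i.1 * volume (cube i.2) ^ (1 / 2 : ℝ))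
          = 3 * C * 2 ^ i.1 * (volume (cube i.2) ^ (1 / 2 : ℝ)) ^ 2 := by ring
        _ = _ := by rw [sq_rpow_half]
    · rw [indicator_of_notMem hP, indicator_of_notMem hP, ENNReal.zero_rpow_of_pos (by norm_num),
        mul_zero]
  calc N univ ≤ ∑' i, N (f ⁻¹' {i}) := hsub f
    _ ≤ ∑' i : ℤ × Tile n,
        (maxHeavy (O i.1)).indicator (fun P => 3 * C * 2 ^ i.1 * volume (cube P)) i.2 :=
        ENNReal.tsum_le_tsum hterm
    _ = ∑' l : ℤ, ∑' P : Tile n,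
        (maxHeavy (O l)).indicator (fun P => 3 * C * 2 ^ l * volume (cube P)) P :=
        ENNReal.tsum_prod' ..
    _ ≤ ∑' l : ℤ, 6 * C * (2 ^ l * volume (O l)) := by
        refine ENNReal.tsum_le_tsum fun l => ?_
        rw [← tsum_subtype, ENNReal.tsum_mul_left]
        calc 3 * C * 2 ^ l * ∑' P : maxHeavy (O l), volume (cube (P : Tile n))
            ≤ 3 * C * 2 ^ l * (2 * volume (O l)) := by
              gcongr; exact tsum_volume_maxHeavy_le (hOm l)
          _ = _ := by ring
    _ = 6 * C * ∑' l : ℤ, 2 ^ l * volume (O l) := ENNReal.tsum_mul_left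
    _ = 6 * C * ∫⁻ x, ∑' l : ℤ,
          {l : ℤ | (2 : ℝ≥0∞) ^ l < dsf e x}.indicator (fun l => (2 : ℝ≥0∞) ^ l) l := by
        congr 1
        have hm : ∀ l : ℤ, Measurable fun x : Space n =>
            {l : ℤ | (2 : ℝ≥0∞) ^ l < dsf e x}.indicator (fun l => (2 : ℝ≥0∞) ^ l) l := fun l =>
          (measurable_const (a := (2 : ℝ≥0∞) ^ l)).indicator (hOm l)
        rw [lintegral_tsum fun l => (hm l).aemeasurable]
        congr 1; funext l
        have : (fun x : Space n => {l : ℤ | (2 : ℝ≥0∞) ^ l < dsf e x}.indicator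
            (fun l => (2 : ℝ≥0∞) ^ l) l) = (O l).indicator fun _ => (2 : ℝ≥0∞) ^ l := rfl
        rw [this, lintegral_indicator_const (hOm l)]
    _ ≤ 6 * C * ∫⁻ x, 2 * dsf e x := by
        gcongr with x
        exact tsum_two_zpow_le _
    _ = 12 * C * J := by
        rw [lintegral_const_mul _ (measurable_dsf e)]; ring

/-! ### Real interpolation -/

lemma lintegral_Ioo_rpow {r c : ℝ} (hr : 0 < r) (hc : 0 ≤ c) :
    ∫⁻ s in Ioo 0 c, ENNReal.ofReal (s ^ (r - 1)) = ENNReal.ofReal (c ^ r / r) := by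
  have hint : IntegrableOn (fun s : ℝ => s ^ (r - 1)) (Ioo 0 c) := by
    have := intervalIntegral.intervalIntegrable_rpow' (a := 0) (b := c) (r := r - 1) (by linarith)
    rw [intervalIntegrable_iff_integrableOn_Ioo_of_le hc] at this
    exact this
  rw [← ofReal_integral_eq_lintegral_ofReal hint]
  · rw [← integral_Ioc_eq_integral_Ioo, ← intervalIntegral.integral_of_le hc,
      integral_rpow (Or.inl (by linarith))]
    rw [sub_add_cancel, Real.zero_rpow hr.ne', sub_zero]
  · filter_upwards [self_mem_ae_restrict measurableSet_Ioo] with s hs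
    exact Real.rpow_nonneg hs.1.le _

lemma lintegral_Ioi_rpow {r c : ℝ} (hr : 0 < r) (hc : 0 < c) :
    ∫⁻ s in Ioi c, ENNReal.ofReal (s ^ (-r - 1)) = ENNReal.ofReal (c ^ (-r) / r) := by
  have hint : IntegrableOn (fun s : ℝ => s ^ (-r - 1)) (Ioi c) :=
    integrableOn_Ioi_rpow_of_lt (by linarith) hc
  rw [← ofReal_integral_eq_lintegral_ofReal hint]
  · rw [integral_Ioi_rpow_of_lt (by linarith) hc, sub_add_cancel, neg_div_neg_eq]
  · filter_upwards [self_mem_ae_restrict measurableSet_Ioi] with s hs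
    exact Real.rpow_nonneg (hc.trans hs).le _

/-- The layer cake formula `b ^ r = r ∫_{0 < s < b} s ^ (r - 1) ds`, also for `b = ∞`. -/
lemma lintegral_indicator_lt_rpow {r : ℝ} (hr : 0 < r) (b : ℝ≥0∞) :
    ∫⁻ s in Ioi (0 : ℝ), {s : ℝ | ENNReal.ofReal s < b}.indicator
      (fun s => ENNReal.ofReal (s ^ (r - 1))) s = b ^ r / ENNReal.ofReal r := by
  have hmeas : MeasurableSet {s : ℝ | ENNReal.ofReal s < b} :=
    measurableSet_lt ENNReal.measurable_ofReal measurable_const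
  rw [lintegral_indicator hmeas, Measure.restrict_restrict hmeas]
  rcases eq_or_ne b ⊤ with rfl | hb
  · rw [ENNReal.top_rpow_of_pos hr, ENNReal.top_div_of_ne_top ENNReal.ofReal_ne_top]
    refine ENNReal.eq_top_of_forall_nnreal_le fun X => ?_

    set c : ℝ := (r * X) ^ (1 / r)
    have hc : 0 ≤ c := by positivity
    have hcr : c ^ r / r = X := by
      rw [← Real.rpow_mul (by positivity), one_div, inv_mul_cancel₀ hr.ne', Real.rpow_one]
      field_simp
    calc (X : ℝ≥0∞) = ENNReal.ofReal (c ^ r / r) := by rw [hcr, ENNReal.ofReal_coe_nnreal]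
      _ = ∫⁻ s in Ioo 0 c, ENNReal.ofReal (s ^ (r - 1)) := (lintegral_Ioo_rpow hr hc).symm
      _ ≤ _ := by
        refine lintegral_mono_set (?_ : Ioo 0 c ⊆ {s : ℝ | ENNReal.ofReal s < ⊤} ∩ Ioi 0)
        exact fun s hs => ⟨ENNReal.ofReal_lt_top, hs.1⟩
  · obtain ⟨c, hc, rfl⟩ : ∃ c : ℝ, 0 ≤ c ∧ b = ENNReal.ofReal c :=
      ⟨b.toReal, ENNReal.toReal_nonneg, (ENNReal.ofReal_toReal hb).symm⟩
    have : {s : ℝ | ENNReal.ofReal s < ENNReal.ofReal c} ∩ Ioi 0 = Ioo 0 c := by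
      ext s
      constructor
      · rintro ⟨h1, h2⟩; exact ⟨h2, (ENNReal.ofReal_lt_ofReal_iff_of_nonneg (le_of_lt h2)).mp h1⟩
      · rintro ⟨h1, h2⟩; exact ⟨(ENNReal.ofReal_lt_ofReal_iff_of_nonneg h1.le).mpr h2, h1⟩
    rw [this, lintegral_Ioo_rpow hr hc, ENNReal.ofReal_rpow_of_nonneg hc hr.le,
      ENNReal.ofReal_div_of_pos hr]

lemma lintegral_min_rpow_le {p q : ℝ} (hq : 0 < q) (hqp : q < p) (b : ℝ≥0∞) :
    ∫⁻ s in Ioi (0 : ℝ), ENNReal.ofReal (s ^ (q - 1 - p)) * (min b (ENNReal.ofReal s)) ^ p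
      ≤ ENNReal.ofReal (1 / q + 1 / (p - q)) * b ^ q := by
  have hp : 0 < p := hq.trans hqp
  have hpq : 0 < p - q := by linarith
  rcases eq_or_ne b ⊤ with rfl | hb
  · rw [ENNReal.top_rpow_of_pos hq, ENNReal.mul_top]
    · exact le_top
    · simp only [ne_eq, ENNReal.ofReal_eq_zero, not_le]; positivity
  obtain ⟨c, hc, rfl⟩ : ∃ c : ℝ, 0 ≤ c ∧ b = ENNReal.ofReal c :=
    ⟨b.toReal, ENNReal.toReal_nonneg, (ENNReal.ofReal_toReal hb).symm⟩
  rcases hc.eq_or_lt with rfl | hc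
  · simp [hp, ENNReal.zero_rpow_of_pos]
  have hsplit : Ioi (0 : ℝ) = Ioo 0 c ∪ Ici c := by
    ext s; simp only [mem_Ioi, mem_union, mem_Ioo, mem_Ici]
    constructor
    · intro h; rcases lt_or_ge s c with h' | h'
      · exact Or.inl ⟨h, h'⟩
      · exact Or.inr h'
    · rintro (h | h)
      · exact h.1
      · exact hc.trans_le h
  rw [hsplit]
  refine (lintegral_union_le _ _ _).trans ?_
  have h1 : ∫⁻ s in Ioo 0 c, ENNReal.ofReal (s ^ (q - 1 - p)) *
      (min (ENNReal.ofReal c) (ENNReal.ofReal s)) ^ p ≤ ENNReal.ofReal (c ^ q / q) := by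
    rw [← lintegral_Ioo_rpow hq hc.le]
    refine setLIntegral_mono (by fun_prop) fun s hs => ?_
    calc ENNReal.ofReal (s ^ (q - 1 - p)) * (min (ENNReal.ofReal c) (ENNReal.ofReal s)) ^ p
        ≤ ENNReal.ofReal (s ^ (q - 1 - p)) * ENNReal.ofReal s ^ p := by
          gcongr; exact min_le_right _ _
      _ = ENNReal.ofReal (s ^ (q - 1)) := by
          rw [ENNReal.ofReal_rpow_of_pos hs.1, ← ENNReal.ofReal_mul (Real.rpow_nonneg hs.1.le _),
            ← Real.rpow_add hs.1]
          congr 2; ring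
  have h2 : ∫⁻ s in Ici c, ENNReal.ofReal (s ^ (q - 1 - p)) *
      (min (ENNReal.ofReal c) (ENNReal.ofReal s)) ^ p ≤ ENNReal.ofReal (c ^ q / (p - q)) := by
    have : c ^ q / (p - q) = c ^ p * (c ^ (-(p - q)) / (p - q)) := by
      rw [← mul_div_assoc, ← Real.rpow_add hc]; congr 2; ring
    rw [this, ENNReal.ofReal_mul (by positivity), ← lintegral_Ioi_rpow hpq hc,
      ← lintegral_const_mul _ (by fun_prop), setLIntegral_congr Ioi_ae_eq_Ici.symm]
    refine setLIntegral_mono (by fun_prop) fun s hs => ?_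
    rw [mul_comm, ← ENNReal.ofReal_rpow_of_pos hc, show q - 1 - p = -(p - q) - 1 by ring]
    gcongr
    exact min_le_left _ _
  refine (add_le_add h1 h2).trans (le_of_eq ?_)
  rw [ENNReal.ofReal_rpow_of_pos hc, ← ENNReal.ofReal_mul (by positivity),
    ← ENNReal.ofReal_add (by positivity) (by positivity)]
  congr 1; ring

/-- The part of the energy on the heavy tiles of a level set has an `L¹` square function. -/
lemma lintegral_dsf_heavy_le (hn : 0 < n) (e : Tile n → ℝ≥0∞) {b : ℝ≥0∞}
    (hO : volume {x | b < dsf e x} ≠ ⊤) :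
    ∫⁻ x, dsf ((heavy {x | b < dsf e x}).indicator e) x ≤
      3 * ∫⁻ x in {x | b < dsf e x}, dsf e x := by
  set O := {x | b < dsf e x} with hOdef
  have hOm : MeasurableSet O := measurableSet_lt measurable_const (measurable_dsf e)
  set A := ⋃ τ ∈ heavy O, cube τ with hA
  have hAm : MeasurableSet A :=
    MeasurableSet.biUnion (to_countable _) fun τ _ => measurableSet_cube τ
  have hle : ∀ x, dsf ((heavy O).indicator e) x ≤ O.indicator (dsf e) x + A.indicator (fun _ => b) x := by
    intro x
    have hmono : dsf ((heavy O).indicator e) x ≤ dsf e x :=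
      ENNReal.rpow_le_rpow (sq_mono (indicator_le_self' fun _ _ => zero_le) x) (by norm_num)
    by_cases hx : x ∈ O
    · rw [indicator_of_mem hx]; exact hmono.trans le_self_add
    by_cases hxA : x ∈ A
    · rw [indicator_of_mem hxA]
      exact hmono.trans ((not_lt.mp hx).trans le_add_self)
    · have : sq ((heavy O).indicator e) x = 0 := by
        rw [sq, ENNReal.tsum_eq_zero]
        intro τ
        by_cases hτ : τ ∈ heavy O
        · apply indicator_of_notMem
          intro h; exact hxA (mem_biUnion hτ h)
        · simp [hτ]
      rw [dsf, this, ENNReal.zero_rpow_of_pos (by norm_num)]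
      exact zero_le
  calc ∫⁻ x, dsf ((heavy O).indicator e) x
      ≤ ∫⁻ x, O.indicator (dsf e) x + A.indicator (fun _ => b) x := lintegral_mono hle
    _ = (∫⁻ x in O, dsf e x) + b * volume A := by
        rw [lintegral_add_right _ (measurable_const.indicator hAm), lintegral_indicator hOm,
          lintegral_indicator_const hAm]
    _ ≤ (∫⁻ x in O, dsf e x) + b * (2 * volume O) := by
        gcongr; exact volume_iUnion_heavy_le hn hOm hO
    _ = (∫⁻ x in O, dsf e x) + 2 * ∫⁻ _x in O, b := by rw [setLIntegral_const]; ring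
    _ ≤ (∫⁻ x in O, dsf e x) + 2 * (∫⁻ x in O, dsf e x) := by
        refine add_le_add le_rfl (mul_le_mul_right
          (setLIntegral_mono (measurable_dsf e) fun x hx => ?_) 2)
        exact le_of_lt (show b < dsf e x from hx)
    _ = _ := by ring

lemma lintegral_rpow_mul_setLIntegral_lt {S : Space n → ℝ≥0∞} (hSm : Measurable S) {q : ℝ}
    (hq1 : 0 < q - 1) :
    ∫⁻ s in Ioi (0 : ℝ), ENNReal.ofReal (s ^ (q - 1 - 1)) *
    ∫⁻ x in {x | ENNReal.ofReal s < S x}, S x = (∫⁻ x, S x ^ q) / ENNReal.ofReal (q - 1) := by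
  have hms : MeasurableSet {z : ℝ × Space n | ENNReal.ofReal z.1 < S z.2} :=
      measurableSet_lt (ENNReal.measurable_ofReal.comp measurable_fst)
        (hSm.comp measurable_snd)
  calc ∫⁻ s in Ioi (0 : ℝ), ENNReal.ofReal (s ^ (q - 1 - 1)) *
        ∫⁻ x in {x | ENNReal.ofReal s < S x}, S x
      = ∫⁻ s in Ioi (0 : ℝ), ∫⁻ x, S x * {s : ℝ | ENNReal.ofReal s < S x}.indicator
          (fun s => ENNReal.ofReal (s ^ (q - 1 - 1))) s := by
        refine lintegral_congr fun s => ?_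
        have hms : MeasurableSet {x | ENNReal.ofReal s < S x} :=
          measurableSet_lt measurable_const hSm
        rw [← lintegral_const_mul _ hSm, ← lintegral_indicator hms]
        refine lintegral_congr fun x => ?_
        by_cases h : ENNReal.ofReal s < S x
        · rw [indicator_of_mem (show x ∈ {x | ENNReal.ofReal s < S x} from h),
            indicator_of_mem (show s ∈ {s : ℝ | ENNReal.ofReal s < S x} from h), mul_comm]
        · rw [indicator_of_notMem (show x ∉ {x | ENNReal.ofReal s < S x} from h),
            indicator_of_notMem (show s ∉ {s : ℝ | ENNReal.ofReal s < S x} from h), mul_zero]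
    _ = ∫⁻ x, S x * ∫⁻ s in Ioi (0 : ℝ), {s : ℝ | ENNReal.ofReal s < S x}.indicator
          (fun s => ENNReal.ofReal (s ^ (q - 1 - 1))) s := by
        rw [lintegral_lintegral_swap]
        · refine lintegral_congr fun x => ?_
          rw [lintegral_const_mul]
          exact Measurable.indicator (by fun_prop)
            (measurableSet_lt ENNReal.measurable_ofReal measurable_const)
        · refine Measurable.aemeasurable ?_
          have : Measurable fun z : ℝ × Space n => ENNReal.ofReal (z.1 ^ (q - 1 - 1)) := by
            fun_prop
          exact (hSm.comp measurable_snd).mul (this.indicator hms)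
    _ = ∫⁻ x, S x ^ q / ENNReal.ofReal (q - 1) := by
        refine lintegral_congr fun x => ?_
        rw [lintegral_indicator_lt_rpow hq1, ← mul_div_assoc]
        congr 1
        conv_lhs => rw [← ENNReal.rpow_one (S x)]
        rw [ENNReal.rpow_one, mul_comm]
        have := ENNReal.rpow_add_of_nonneg (x := S x) (q - 1) 1 hq1.le zero_le_one
        rw [sub_add_cancel, ENNReal.rpow_one] at this
        exact this.symm
    _ = (∫⁻ x, S x ^ q) / ENNReal.ofReal (q - 1) := by
        simp_rw [div_eq_mul_inv]
        rw [lintegral_mul_const _ (hSm.pow_const q)]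

lemma lintegral_rpow_mul_lintegral_min_le {S : Space n → ℝ≥0∞} (hSm : Measurable S) {p q : ℝ}
    (hq0 : 0 < q) (hqp : q < p) :
    ∫⁻ s in Ioi (0 : ℝ), ENNReal.ofReal (s ^ (q - 1 - p)) *
    ∫⁻ x, (min (S x) (ENNReal.ofReal s)) ^ p ≤
  ENNReal.ofReal (1 / q + 1 / (p - q)) * ∫⁻ x, S x ^ q := by
  have hmm : Measurable fun z : ℝ × Space n => (min (S z.2) (ENNReal.ofReal z.1)) ^ p :=
    ((hSm.comp measurable_snd).min (ENNReal.measurable_ofReal.comp measurable_fst)).pow_const p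
  calc ∫⁻ s in Ioi (0 : ℝ), ENNReal.ofReal (s ^ (q - 1 - p)) *
        ∫⁻ x, (min (S x) (ENNReal.ofReal s)) ^ p
      = ∫⁻ s in Ioi (0 : ℝ), ∫⁻ x, ENNReal.ofReal (s ^ (q - 1 - p)) *
          (min (S x) (ENNReal.ofReal s)) ^ p := by
        refine lintegral_congr fun s => ?_
        rw [lintegral_const_mul]
        exact hmm.comp measurable_prodMk_left
    _ = ∫⁻ x, ∫⁻ s in Ioi (0 : ℝ), ENNReal.ofReal (s ^ (q - 1 - p)) *
          (min (S x) (ENNReal.ofReal s)) ^ p := by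
        rw [lintegral_lintegral_swap]
        refine Measurable.aemeasurable (Measurable.mul (by fun_prop) hmm)
    _ ≤ ∫⁻ x, ENNReal.ofReal (1 / q + 1 / (p - q)) * S x ^ q :=
        lintegral_mono fun x => lintegral_min_rpow_le hq0 hqp (S x)
    _ = _ := lintegral_const_mul _ (hSm.pow_const q)

/-- Marcinkiewicz interpolation between `1` and `p`, where the data are truncated by discarding
tiles. -/
theorem exists_interpolation_const (hn : 0 < n) {p q : ℝ} (hq : 1 < q) (hqp : q < p) :
    ∃ c : ℝ≥0, ∀ (e : Tile n → ℝ≥0∞) (C₁ C₂ : ℝ≥0∞) (a : Space n → ℝ≥0∞)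
      (Φ : Set (Tile n) → Space n → ℝ≥0∞), Measurable a → (∀ T, Measurable (Φ T)) →
      (∀ T, ∀ᵐ x, a x ≤ Φ T x + Φ Tᶜ x) →
      (∀ T, ∫⁻ x, Φ T x ≤ C₁ * ∫⁻ x, dsf (T.indicator e) x) →
      (∀ T, ∫⁻ x, Φ T x ^ p ≤ C₂ * ∫⁻ x, dsf (T.indicator e) x ^ p) →
      ∫⁻ x, dsf e x ^ q ≠ ⊤ →
      ∫⁻ x, a x ^ q ≤ c * (C₁ + C₂) * ∫⁻ x, dsf e x ^ q := by
  have hq0 : 0 < q := by linarith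
  have hp0 : 0 < p := by linarith
  set K₁ : ℝ := 3 / (q - 1) with hK₁
  set K₂ : ℝ := 1 / q + 1 / (p - q) with hK₂
  have hq1 : 0 < q - 1 := by linarith
  have hpq : 0 < p - q := by linarith
  have hK₁0 : 0 ≤ K₁ := by positivity
  have hK₂0 : 0 ≤ K₂ := by positivity
  refine ⟨Real.toNNReal (2 ^ q * q * (K₁ + K₂)), ?_⟩
  intro e C₁ C₂ a Φ ha hΦ hadd h1 h2 hfin
  set S := dsf e with hS
  have hSm : Measurable S := measurable_dsf e
  set J := ∫⁻ x, S x ^ q with hJ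
  have hvol : ∀ s : ℝ, 0 < s → volume {x | ENNReal.ofReal s < S x} ≠ ⊤ := by
    intro s hs h
    have h3 := mul_meas_ge_le_lintegral (μ := volume) (hSm.pow_const q) (ENNReal.ofReal s ^ q)
    have h4 : volume {x | ENNReal.ofReal s < S x} ≤
        volume {x | ENNReal.ofReal s ^ q ≤ S x ^ q} :=
      measure_mono fun x hx => ENNReal.rpow_le_rpow (le_of_lt hx) hq0.le
    rw [h, top_le_iff] at h4
    rw [h4, ENNReal.mul_top, top_le_iff] at h3
    · exact hfin h3
    · rw [Ne, ENNReal.rpow_eq_zero_iff_of_pos hq0, ENNReal.ofReal_eq_zero]; linarith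
  -- the weak type estimate at height `s`
  have hweak : ∀ s : ℝ, 0 < s → volume {x | ENNReal.ofReal s < a x / 2} ≤
      ENNReal.ofReal (s ^ (-1 : ℝ)) * (C₁ * (3 * ∫⁻ x in {x | ENNReal.ofReal s < S x}, S x)) +
      ENNReal.ofReal (s ^ (-p)) * (C₂ * ∫⁻ x, (min (S x) (ENNReal.ofReal s)) ^ p) := by
    intro s hs
    set O := {x | ENNReal.ofReal s < S x} with hO
    set T := heavy O with hT
    have hs0 : ENNReal.ofReal s ≠ 0 := by simpa using hs
    have hsub : ({x | ENNReal.ofReal s < a x / 2} : Set (Space n)) ≤ᵐ[volume]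
        ({x | ENNReal.ofReal s ≤ Φ T x} ∪ {x | ENNReal.ofReal s ^ p ≤ Φ Tᶜ x ^ p} :
          Set (Space n)) := by
      filter_upwards [hadd T] with x hx hlt
      have hlt' : ENNReal.ofReal s < a x / 2 := hlt
      by_contra hcon
      have hcon' : ¬ (ENNReal.ofReal s ≤ Φ T x ∨ ENNReal.ofReal s ^ p ≤ Φ Tᶜ x ^ p) := hcon
      push Not at hcon'
      have h3 := hcon'.1
      have h4 : Φ Tᶜ x < ENNReal.ofReal s := (ENNReal.rpow_lt_rpow_iff hp0).mp hcon'.2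
      have h5 : a x ≤ ENNReal.ofReal s * 2 := by
        rw [mul_two]; exact hx.trans (add_le_add h3.le h4.le)
      exact absurd hlt' (not_lt.mpr (ENNReal.div_le_of_le_mul h5))
    refine (measure_mono_ae hsub).trans ((measure_union_le _ _).trans (add_le_add ?_ ?_))
    · rw [Real.rpow_neg_one, ENNReal.ofReal_inv_of_pos hs]
      refine (meas_ge_le_lintegral_div (hΦ T).aemeasurable hs0 ENNReal.ofReal_ne_top).trans ?_
      rw [div_eq_mul_inv, mul_comm]
      gcongr
      refine (h1 T).trans ?_
      gcongr
      exact lintegral_dsf_heavy_le hn e (hvol s hs)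
    · rw [Real.rpow_neg hs.le, ENNReal.ofReal_inv_of_pos (by positivity),
        ← ENNReal.ofReal_rpow_of_pos hs]
      refine (meas_ge_le_lintegral_div ((hΦ Tᶜ).pow_const p).aemeasurable ?_
        (ENNReal.rpow_ne_top_of_nonneg hp0.le ENNReal.ofReal_ne_top)).trans ?_
      · rw [Ne, ENNReal.rpow_eq_zero_iff_of_pos hp0]; exact hs0
      rw [div_eq_mul_inv, mul_comm]
      gcongr
      refine (h2 Tᶜ).trans ?_
      gcongr with x
      refine le_min ?_ ?_
      · exact ENNReal.rpow_le_rpow (sq_mono (indicator_le_self' fun _ _ => zero_le) x)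
          (by norm_num)
      · have := sq_indicator_compl_heavy_le (e := e) (O := O) (Λ := ENNReal.ofReal s ^ 2)
          (fun y hy => by
            have h3 : S y ≤ ENNReal.ofReal s := not_lt.mp hy
            calc sq e y = S y ^ 2 := by rw [hS, dsf, sq_rpow_half]
              _ ≤ _ := by gcongr) x
        calc dsf (Tᶜ.indicator e) x ≤ (ENNReal.ofReal s ^ 2) ^ (1 / 2 : ℝ) :=
              ENNReal.rpow_le_rpow this (by norm_num)
          _ = _ := rpow_half_sq _
  -- integration over all heights
  have hcake : ∫⁻ x, (a x / 2) ^ q / ENNReal.ofReal q =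
      ∫⁻ s in Ioi (0 : ℝ), ENNReal.ofReal (s ^ (q - 1)) *
        volume {x | ENNReal.ofReal s < a x / 2} := by
    simp_rw [← lintegral_indicator_lt_rpow hq0]
    rw [lintegral_lintegral_swap]
    · refine lintegral_congr fun s => ?_
      have hms : MeasurableSet {x | ENNReal.ofReal s < a x / 2} :=
        measurableSet_lt measurable_const (ha.div_const 2)
      rw [← lintegral_indicator_const hms]
      rfl
    · refine Measurable.aemeasurable ?_
      have hms : MeasurableSet {z : Space n × ℝ | ENNReal.ofReal z.2 < a z.1 / 2} :=
        measurableSet_lt (ENNReal.measurable_ofReal.comp measurable_snd)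
          ((ha.comp measurable_fst).div_const 2)
      have : Measurable fun z : Space n × ℝ => ENNReal.ofReal (z.2 ^ (q - 1)) := by fun_prop
      exact this.indicator hms
  have hfirst := lintegral_rpow_mul_setLIntegral_lt hSm hq1
  have hsecond := lintegral_rpow_mul_lintegral_min_le hSm hq0 hqp
  have hmain : ∫⁻ x, (a x / 2) ^ q / ENNReal.ofReal q ≤
      C₁ * (3 * (J / ENNReal.ofReal (q - 1))) + C₂ * (ENNReal.ofReal K₂ * J) := by
    rw [hcake]
    calc _ ≤ ∫⁻ s in Ioi (0 : ℝ),
          ((C₁ * 3) * (ENNReal.ofReal (s ^ (q - 1 - 1)) *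
            ∫⁻ x in {x | ENNReal.ofReal s < S x}, S x) +
          C₂ * (ENNReal.ofReal (s ^ (q - 1 - p)) *
            ∫⁻ x, (min (S x) (ENNReal.ofReal s)) ^ p)) := by
          refine setLIntegral_mono' measurableSet_Ioi fun s hs => ?_
          have hs : 0 < s := hs
          refine (mul_le_mul_right (hweak s hs) _).trans (le_of_eq ?_)
          have e1 : s ^ (q - 1 - 1) = s ^ (q - 1) * s ^ (-1 : ℝ) := by
            rw [← Real.rpow_add hs]; congr 1
          have e2 : s ^ (q - 1 - p) = s ^ (q - 1) * s ^ (-p) := by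
            rw [← Real.rpow_add hs]; congr 1
          rw [e1, e2, ENNReal.ofReal_mul (by positivity), ENNReal.ofReal_mul (by positivity)]
          ring
      _ = (C₁ * 3) * (J / ENNReal.ofReal (q - 1)) +
          C₂ * ∫⁻ s in Ioi (0 : ℝ), (ENNReal.ofReal (s ^ (q - 1 - p)) *
            ∫⁻ x, (min (S x) (ENNReal.ofReal s)) ^ p) := by
          have hm2 : Measurable fun s : ℝ => (ENNReal.ofReal (s ^ (q - 1 - p)) *
            ∫⁻ x, (min (S x) (ENNReal.ofReal s)) ^ p) := by
            refine Measurable.mul (by fun_prop) ?_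
            have hmm : Measurable fun z : ℝ × Space n => (min (S z.2) (ENNReal.ofReal z.1)) ^ p :=
              ((hSm.comp measurable_snd).min
                (ENNReal.measurable_ofReal.comp measurable_fst)).pow_const p
            exact hmm.lintegral_prod_right'
          have hm1 : Measurable fun s : ℝ => (ENNReal.ofReal (s ^ (q - 1 - 1)) *
            ∫⁻ x in {x | ENNReal.ofReal s < S x}, S x) := by
            refine Measurable.mul (by fun_prop) ?_
            have hms : MeasurableSet {z : ℝ × Space n | ENNReal.ofReal z.1 < S z.2} :=
              measurableSet_lt (ENNReal.measurable_ofReal.comp measurable_fst)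
                (hSm.comp measurable_snd)
            have key : (fun s : ℝ => ∫⁻ x in {x | ENNReal.ofReal s < S x}, S x) = fun s : ℝ =>
                ∫⁻ x, {z : ℝ × Space n | ENNReal.ofReal z.1 < S z.2}.indicator
                  (S ∘ Prod.snd) (s, x) := by
              funext s
              rw [← lintegral_indicator (measurableSet_lt measurable_const hSm)]
              rfl
            rw [key]
            exact ((hSm.comp measurable_snd).indicator hms).lintegral_prod_right'
          rw [lintegral_add_right _ (hm2.const_mul _), lintegral_const_mul _ hm1,
            lintegral_const_mul _ hm2, hfirst]
      _ ≤ _ := by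
          rw [mul_assoc]
          gcongr
  have hq0' : ENNReal.ofReal q ≠ 0 := by simpa using hq0
  have hfac : ∀ x, a x ^ q = ENNReal.ofReal (2 ^ q * q) * ((a x / 2) ^ q / ENNReal.ofReal q) := by
    intro x
    rw [ENNReal.ofReal_mul (by positivity), mul_assoc,
      ENNReal.mul_div_cancel hq0' ENNReal.ofReal_ne_top, ← ENNReal.ofReal_rpow_of_pos (by norm_num),
      ← ENNReal.mul_rpow_of_nonneg _ _ hq0.le]
    congr 1
    rw [ENNReal.ofReal_ofNat]
    exact (ENNReal.mul_div_cancel (by norm_num) (by norm_num)).symm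
  calc ∫⁻ x, a x ^ q = ENNReal.ofReal (2 ^ q * q) * ∫⁻ x, (a x / 2) ^ q / ENNReal.ofReal q := by
        rw [← lintegral_const_mul]
        · exact lintegral_congr hfac
        · exact ((ha.div_const 2).pow_const q).div_const _
    _ ≤ ENNReal.ofReal (2 ^ q * q) *
        (C₁ * (3 * (J / ENNReal.ofReal (q - 1))) + C₂ * (ENNReal.ofReal K₂ * J)) := by gcongr
    _ = ENNReal.ofReal (2 ^ q * q) * ((C₁ * ENNReal.ofReal K₁ + C₂ * ENNReal.ofReal K₂) * J) := by
        have : ENNReal.ofReal K₁ = 3 / ENNReal.ofReal (q - 1) := by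
          rw [hK₁, ENNReal.ofReal_div_of_pos hq1]; norm_num
        rw [this, div_eq_mul_inv, div_eq_mul_inv]; ring
    _ ≤ ENNReal.ofReal (2 ^ q * q) *
        ((C₁ * ENNReal.ofReal (K₁ + K₂) + C₂ * ENNReal.ofReal (K₁ + K₂)) * J) := by
        gcongr <;> linarith
    _ = _ := by
        have : ((Real.toNNReal (2 ^ q * q * (K₁ + K₂)) : ℝ≥0) : ℝ≥0∞) =
            ENNReal.ofReal (2 ^ q * q) * ENNReal.ofReal (K₁ + K₂) := by
          rw [← ENNReal.ofReal_mul (by positivity)]; rfl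
        rw [this]
        ring

/-! ### The conical square function -/

/-- The square of the conical square function, whose `L^{p/2}` norm defines the tent norm. -/
def coneSq (F : ℝ × Space n → Val N) (x : Space n) : ℝ≥0∞ :=
  ∫⁻ z in cone x, ‖F z‖ₑ ^ 2 / ENNReal.ofReal (z.1 ^ (n + 1))

/-- The squared norm in `L²((0,∞) × ℝⁿ; dy dt / t)`. -/
def energy (F : ℝ × Space n → Val N) : ℝ≥0∞ :=
  ∫⁻ z in halfSpace n, ‖F z‖ₑ ^ 2 / ENNReal.ofReal z.1

lemma tentNorm_eq (p : ℝ) (F : ℝ × Space n → Val N) :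
    tentNorm p F = (∫⁻ x, coneSq F x ^ (p / 2)) ^ (1 / p) := rfl

lemma measurableSet_halfSpace : MeasurableSet (halfSpace n) :=
  measurableSet_Ioi.prod MeasurableSet.univ

lemma cone_subset_halfSpace (x : Space n) : cone x ⊆ halfSpace n := fun _ hz => ⟨hz.1, mem_univ _⟩

lemma measurableSet_coneRel :
    MeasurableSet {w : Space n × (ℝ × Space n) | w.2 ∈ cone w.1} := by
  have h1 : MeasurableSet {w : Space n × (ℝ × Space n) | 0 < w.2.1} :=
    measurableSet_lt measurable_const (by fun_prop)
  have h2 : MeasurableSet {w : Space n × (ℝ × Space n) | dist w.2.2 w.1 < w.2.1} :=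
    measurableSet_lt (by fun_prop) (by fun_prop)
  exact h1.inter h2

lemma measurableSet_cone (x : Space n) : MeasurableSet (cone x) :=
  measurable_prodMk_left measurableSet_coneRel

lemma volume_restrict_halfSpace : (volume : Measure (ℝ × Space n)).restrict (halfSpace n) =
    (volume.restrict (Ioi (0 : ℝ))).prod volume := by
  rw [halfSpace, Measure.volume_eq_prod, ← Measure.prod_restrict, Measure.restrict_univ]

lemma coneSq_congr_ae {F G : ℝ × Space n → Val N}
    (h : F =ᵐ[volume.restrict (halfSpace n)] G) : coneSq F = coneSq G := by
  funext x
  refine lintegral_congr_ae ?_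
  filter_upwards [ae_restrict_of_ae_restrict_of_subset (cone_subset_halfSpace x) h] with z hz
  rw [hz]

lemma coneSq_mono {F G : ℝ × Space n → Val N} (h : ∀ z, ‖F z‖ₑ ≤ ‖G z‖ₑ) (x : Space n) :
    coneSq F x ≤ coneSq G x := by
  refine lintegral_mono fun z => ?_
  gcongr
  exact h z

lemma measurable_density {F : ℝ × Space n → Val N} (hF : StronglyMeasurable F) :
    Measurable fun z : ℝ × Space n => ‖F z‖ₑ ^ 2 / ENNReal.ofReal (z.1 ^ (n + 1)) :=
  (hF.enorm.pow_const 2).div (by fun_prop)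

lemma measurable_coneSq {F : ℝ × Space n → Val N} (hF : StronglyMeasurable F) :
    Measurable (coneSq F) := by
  have : coneSq F = fun x => ∫⁻ z, {w : Space n × (ℝ × Space n) | w.2 ∈ cone w.1}.indicator
      (fun w => ‖F w.2‖ₑ ^ 2 / ENNReal.ofReal (w.2.1 ^ (n + 1))) (x, z) := by
    funext x
    rw [coneSq, ← lintegral_indicator (measurableSet_cone x)]
    rfl
  rw [this]
  exact (((measurable_density hF).comp measurable_snd).indicator
    measurableSet_coneRel).lintegral_prod_right'

lemma lintegral_halfSpace {f : ℝ × Space n → ℝ≥0∞} (hf : Measurable f) :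
    ∫⁻ z in halfSpace n, f z = ∫⁻ t in Ioi (0 : ℝ), ∫⁻ y, f (t, y) := by
  rw [volume_restrict_halfSpace, lintegral_prod _ hf.aemeasurable]

lemma ae_halfSpace_of_ae_ae {P : ℝ × Space n → Prop} (hP : MeasurableSet {z | P z})
    (h : ∀ᵐ t ∂volume.restrict (Ioi (0 : ℝ)), ∀ᵐ y, P (t, y)) :
    ∀ᵐ z ∂volume.restrict (halfSpace n), P z := by
  rw [volume_restrict_halfSpace]
  exact (Measure.ae_prod_iff_ae_ae hP).mpr h

lemma ae_ae_of_ae_halfSpace {P : ℝ × Space n → Prop}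
    (h : ∀ᵐ z ∂volume.restrict (halfSpace n), P z) :
    ∀ᵐ t ∂volume.restrict (Ioi (0 : ℝ)), ∀ᵐ y, P (t, y) := by
  rw [volume_restrict_halfSpace] at h
  exact Measure.ae_ae_of_ae_prod h

lemma coneSq_eq_iterated {F : ℝ × Space n → Val N} (hF : StronglyMeasurable F) (x : Space n) :
    coneSq F x = ∫⁻ t in Ioi (0 : ℝ),
      (∫⁻ y in Metric.ball x t, ‖F (t, y)‖ₑ ^ 2) / ENNReal.ofReal (t ^ (n + 1)) := by
  have h1 : coneSq F x = ∫⁻ z in halfSpace n, (cone x).indicator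
      (fun z => ‖F z‖ₑ ^ 2 / ENNReal.ofReal (z.1 ^ (n + 1))) z := by
    rw [lintegral_indicator (measurableSet_cone x), Measure.restrict_restrict (measurableSet_cone x),
      inter_eq_left.mpr (cone_subset_halfSpace x)]
    rfl
  rw [h1, lintegral_halfSpace ((measurable_density hF).indicator (measurableSet_cone x))]
  refine setLIntegral_congr_fun measurableSet_Ioi fun t ht => ?_
  have h2 : ∀ y, (cone x).indicator
      (fun z : ℝ × Space n => ‖F z‖ₑ ^ 2 / ENNReal.ofReal (z.1 ^ (n + 1))) (t, y) =
      (Metric.ball x t).indicator (fun y => ‖F (t, y)‖ₑ ^ 2 * (ENNReal.ofReal (t ^ (n + 1)))⁻¹) y := by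
    intro y
    by_cases hy : y ∈ Metric.ball x t
    · rw [indicator_of_mem hy, indicator_of_mem (show (t, y) ∈ cone x from ⟨ht, hy⟩),
        div_eq_mul_inv]
    · rw [indicator_of_notMem hy, indicator_of_notMem (fun h => hy h.2)]
  simp only [h2]
  rw [lintegral_indicator Metric.isOpen_ball.measurableSet, lintegral_mul_const, div_eq_mul_inv]
  exact (hF.enorm.pow_const 2).comp measurable_prodMk_left

lemma coneSq_add_rpow_half_le {F G : ℝ × Space n → Val N} (hF : StronglyMeasurable F)
    (hG : StronglyMeasurable G) (x : Space n) :
    coneSq (F + G) x ^ (1 / 2 : ℝ) ≤ coneSq F x ^ (1 / 2 : ℝ) + coneSq G x ^ (1 / 2 : ℝ) := by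
  have hw : ∀ H : ℝ × Space n → Val N, coneSq H x =
      ∫⁻ z in cone x, (‖H z‖ₑ * (ENNReal.ofReal (z.1 ^ (n + 1)))⁻¹ ^ (1 / 2 : ℝ)) ^ (2 : ℝ) := by
    intro H
    refine lintegral_congr fun z => ?_
    rw [ENNReal.mul_rpow_of_nonneg _ _ (by norm_num), ← ENNReal.rpow_mul]
    norm_num [div_eq_mul_inv]
  have hmw : Measurable fun z : ℝ × Space n =>
      (ENNReal.ofReal (z.1 ^ (n + 1)))⁻¹ ^ (1 / 2 : ℝ) := by fun_prop
  have hm : ∀ H : ℝ × Space n → Val N, StronglyMeasurable H → Measurable fun z =>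
      ‖H z‖ₑ * (ENNReal.ofReal (z.1 ^ (n + 1)))⁻¹ ^ (1 / 2 : ℝ) := fun H hH => hH.enorm.mul hmw
  rw [hw, hw, hw]
  refine le_trans ?_ (ENNReal.lintegral_Lp_add_le (hm F hF).aemeasurable (hm G hG).aemeasurable
    one_le_two)
  refine ENNReal.rpow_le_rpow (lintegral_mono fun z => ENNReal.rpow_le_rpow ?_ (by norm_num))
    (by norm_num)
  simp only [Pi.add_apply]
  rw [← add_mul]
  gcongr
  exact enorm_add_le _ _

lemma rpow_half_rpow (a : ℝ≥0∞) (q : ℝ) : (a ^ (1 / 2 : ℝ)) ^ q = a ^ (q / 2) := by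
  rw [← ENNReal.rpow_mul]; congr 1; ring

lemma tentNorm_add_le {q : ℝ} (hq : 1 ≤ q) {F G : ℝ × Space n → Val N} (hF : StronglyMeasurable F)
    (hG : StronglyMeasurable G) : tentNorm q (F + G) ≤ tentNorm q F + tentNorm q G := by
  have e : ∀ H : ℝ × Space n → Val N,
      tentNorm q H = (∫⁻ x, (coneSq H x ^ (1 / 2 : ℝ)) ^ q) ^ (1 / q) := fun H => by
    rw [tentNorm_eq]; simp only [rpow_half_rpow]
  rw [e, e, e]
  refine le_trans ?_ (ENNReal.lintegral_Lp_add_le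
    ((measurable_coneSq hF).pow_const (1 / 2 : ℝ)).aemeasurable
    ((measurable_coneSq hG).pow_const (1 / 2 : ℝ)).aemeasurable hq)
  refine ENNReal.rpow_le_rpow (lintegral_mono fun x => ENNReal.rpow_le_rpow ?_ (by linarith))
    (by positivity)
  exact coneSq_add_rpow_half_le hF hG x

lemma tentNorm_congr_ae (q : ℝ) {F G : ℝ × Space n → Val N}
    (h : F =ᵐ[volume.restrict (halfSpace n)] G) : tentNorm q F = tentNorm q G := by
  rw [tentNorm_eq, coneSq_congr_ae h, tentNorm_eq]

/-- Averaging the conical square function: `∫ A(F)² = |B(0,1)| ∬ |F|² dy dt / t`. -/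
lemma lintegral_coneSq {F : ℝ × Space n → Val N} (hF : StronglyMeasurable F) :
    ∫⁻ x, coneSq F x = volume (Metric.ball (0 : Space n) 1) * energy F := by
  have h1 : ∀ x, coneSq F x = ∫⁻ z in halfSpace n,
      {w : Space n × (ℝ × Space n) | w.2 ∈ cone w.1}.indicator
      (fun w => ‖F w.2‖ₑ ^ 2 / ENNReal.ofReal (w.2.1 ^ (n + 1))) (x, z) := by
    intro x
    have : (fun z => {w : Space n × (ℝ × Space n) | w.2 ∈ cone w.1}.indicator
      (fun w => ‖F w.2‖ₑ ^ 2 / ENNReal.ofReal (w.2.1 ^ (n + 1))) (x, z)) =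
      (cone x).indicator (fun z => ‖F z‖ₑ ^ 2 / ENNReal.ofReal (z.1 ^ (n + 1))) := rfl
    rw [this, lintegral_indicator (measurableSet_cone x),
      Measure.restrict_restrict (measurableSet_cone x),
      inter_eq_left.mpr (cone_subset_halfSpace x)]
    rfl
  simp only [h1]
  rw [lintegral_lintegral_swap, energy, ← lintegral_const_mul]
  · refine setLIntegral_congr_fun measurableSet_halfSpace fun z hz => ?_
    have hz0 : 0 < z.1 := hz.1
    have h2 : (fun x => {w : Space n × (ℝ × Space n) | w.2 ∈ cone w.1}.indicator
      (fun w => ‖F w.2‖ₑ ^ 2 / ENNReal.ofReal (w.2.1 ^ (n + 1))) (x, z)) =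
      (Metric.ball z.2 z.1).indicator fun _ => ‖F z‖ₑ ^ 2 / ENNReal.ofReal (z.1 ^ (n + 1)) := by
      funext x
      by_cases hx : x ∈ Metric.ball z.2 z.1
      · rw [indicator_of_mem hx, indicator_of_mem]
        exact ⟨hz0, Metric.mem_ball_comm.mp hx⟩
      · rw [indicator_of_notMem hx, indicator_of_notMem]
        exact fun h => hx (Metric.mem_ball_comm.mp h.2)
    rw [h2, lintegral_indicator_const Metric.isOpen_ball.measurableSet,
      Measure.addHaar_ball_of_pos _ _ hz0, finrank_euclideanSpace_fin, pow_succ z.1,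
      ENNReal.ofReal_mul (by positivity), ENNReal.div_eq_inv_mul, ENNReal.div_eq_inv_mul,
      ENNReal.mul_inv (by simp) (by simp)]
    have h3 : (ENNReal.ofReal (z.1 ^ n))⁻¹ * ENNReal.ofReal (z.1 ^ n) = 1 :=
      ENNReal.inv_mul_cancel (by simp [hz0]) ENNReal.ofReal_ne_top
    calc _ = ((ENNReal.ofReal (z.1 ^ n))⁻¹ * ENNReal.ofReal (z.1 ^ n)) *
          (volume (Metric.ball (0 : Space n) 1) * ((ENNReal.ofReal z.1)⁻¹ * ‖F z‖ₑ ^ 2)) := by ring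
      _ = _ := by rw [h3, one_mul]
  · exact (hF.enorm.pow_const 2).div (by fun_prop)
  · exact (((measurable_density hF).comp measurable_snd).indicator
      measurableSet_coneRel).aemeasurable

lemma setLIntegral_rpow_le {A : Set (Space n)} {f : Space n → ℝ≥0∞} (hf : Measurable f) {r : ℝ}
    (hr : 0 ≤ r) (hr1 : r ≤ 1) :
    ∫⁻ x in A, f x ^ r ≤ volume A ^ (1 - r) * (∫⁻ x, f x) ^ r := by
  have := ENNReal.lintegral_mul_norm_pow_le (μ := volume.restrict A) (f := f) (g := fun _ => 1)
    hf.aemeasurable aemeasurable_const hr (sub_nonneg.mpr hr1) (by ring)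
  simp only [ENNReal.one_rpow, mul_one, lintegral_const, one_mul, Measure.restrict_apply
    MeasurableSet.univ, univ_inter] at this
  refine this.trans ?_
  rw [mul_comm]
  gcongr
  exact Measure.restrict_le_self

/-- A function supported over a ball has its conical square function supported in the double of
that ball, so the Cauchy-Schwarz inequality controls its tent norm by its energy. -/
lemma lintegral_coneSq_rpow_le_of_support {F : ℝ × Space n → Val N} (hF : StronglyMeasurable F)
    {x₀ : Space n} {ρ : ℝ} (hsupp : ∀ z, F z ≠ 0 → z.1 < ρ ∧ dist z.2 x₀ < ρ) {r : ℝ}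
    (hr : 0 < r) (hr1 : r ≤ 1) :
    ∫⁻ x, coneSq F x ^ r ≤ volume (Metric.ball x₀ (2 * ρ)) ^ (1 - r) *
      (volume (Metric.ball (0 : Space n) 1) * energy F) ^ r := by
  rw [← lintegral_coneSq hF]
  refine le_trans (le_of_eq ?_) (setLIntegral_rpow_le (measurable_coneSq hF) hr.le hr1)
  rw [← lintegral_indicator Metric.isOpen_ball.measurableSet]
  refine lintegral_congr fun x => ?_
  by_cases hx : x ∈ Metric.ball x₀ (2 * ρ)
  · rw [indicator_of_mem hx]
  rw [indicator_of_notMem hx]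
  have : coneSq F x = 0 := by
    rw [coneSq, ← lintegral_indicator (measurableSet_cone x)]
    refine (lintegral_congr fun z => ?_).trans lintegral_zero
    by_cases hz : z ∈ cone x
    · rw [indicator_of_mem hz]
      have : F z = 0 := by
        by_contra h
        obtain ⟨h1, h2⟩ := hsupp z h
        apply hx
        have h3 : dist z.2 x < z.1 := hz.2
        rw [Metric.mem_ball]
        have := dist_triangle x z.2 x₀
        rw [dist_comm x z.2] at this
        linarith
      simp [this]
    · rw [indicator_of_notMem hz]
  rw [this, ENNReal.zero_rpow_of_pos hr]

lemma tsum_rpow_half_le {ι : Type*} (f : ι → ℝ≥0∞) :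
    (∑' i, f i) ^ (1 / 2 : ℝ) ≤ ∑' i, f i ^ (1 / 2 : ℝ) := by
  classical
  have hfin : ∀ s : Finset ι, (∑ i ∈ s, f i) ^ (1 / 2 : ℝ) ≤ ∑ i ∈ s, f i ^ (1 / 2 : ℝ) := by
    intro s
    induction s using Finset.induction_on with
    | empty => simp
    | insert i s hi ih =>
      rw [Finset.sum_insert hi, Finset.sum_insert hi]
      exact (ENNReal.rpow_add_le_add_rpow _ _ (by norm_num) (by norm_num)).trans
        (by gcongr)
  have h : ∑' i, f i ≤ (∑' i, f i ^ (1 / 2 : ℝ)) ^ 2 := by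
    rw [ENNReal.tsum_eq_iSup_sum]
    refine iSup_le fun s => ?_
    calc ∑ i ∈ s, f i = ((∑ i ∈ s, f i) ^ (1 / 2 : ℝ)) ^ 2 := (sq_rpow_half _).symm
      _ ≤ _ := by gcongr; exact (hfin s).trans (ENNReal.sum_le_tsum s)
  calc (∑' i, f i) ^ (1 / 2 : ℝ) ≤ ((∑' i, f i ^ (1 / 2 : ℝ)) ^ 2) ^ (1 / 2 : ℝ) :=
        ENNReal.rpow_le_rpow h (by norm_num)
    _ = _ := rpow_half_sq _

/-- Triangle inequality for a decomposition of the half space into countably many regions. -/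
lemma lintegral_coneSq_rpow_half_le_tsum {ι : Type*} [Countable ι] {F : ℝ × Space n → Val N}
    (hF : StronglyMeasurable F) {U : ι → Set (ℝ × Space n)} (hU : ∀ i, MeasurableSet (U i))
    (hcov : ∀ z ∈ halfSpace n, F z ≠ 0 → ∃ i, z ∈ U i) :
    ∫⁻ x, coneSq F x ^ (1 / 2 : ℝ) ≤ ∑' i, ∫⁻ x, coneSq ((U i).indicator F) x ^ (1 / 2 : ℝ) := by
  rw [← lintegral_tsum fun i =>
    ((measurable_coneSq (hF.indicator (hU i))).pow_const _).aemeasurable]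
  refine lintegral_mono fun x => le_trans (ENNReal.rpow_le_rpow ?_ (by norm_num))
    (tsum_rpow_half_le _)
  simp only [coneSq]
  rw [← lintegral_tsum fun i => (measurable_density (hF.indicator (hU i))).aemeasurable]
  refine setLIntegral_mono' (measurableSet_cone x) fun z hz => ?_
  by_cases h : F z = 0
  · simp [h]
  obtain ⟨i, hi⟩ := hcov z (cone_subset_halfSpace x hz) h
  refine le_trans (le_of_eq ?_) (ENNReal.le_tsum i)
  rw [indicator_of_mem hi]

lemma lintegral_enorm_sq_eq {α : Type*} [MeasurableSpace α] {μ : Measure α} (f : α → Val N) :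
    ∫⁻ y, ‖f y‖ₑ ^ 2 ∂μ = eLpNorm f 2 μ ^ 2 := by
  have := eLpNorm_nnreal_pow_eq_lintegral (f := f) (μ := μ) (p := 2) (by norm_num)
  simp only [NNReal.coe_ofNat, ENNReal.coe_ofNat, ENNReal.rpow_ofNat] at this
  exact this.symm

open Filter Topology in
/-- Fatou's lemma for tent norms under `L²` convergence of almost every slice. -/
lemma lintegral_coneSq_rpow_le_of_tendsto {G : ℝ × Space n → Val N}
    {Gs : ℕ → ℝ × Space n → Val N} (hG : StronglyMeasurable G)
    (hGs : ∀ k, StronglyMeasurable (Gs k))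
    (hlim : ∀ᵐ t ∂volume.restrict (Ioi (0 : ℝ)), Tendsto (fun k =>
      eLpNorm (fun y => G (t, y) - Gs k (t, y)) 2 volume) atTop (𝓝 0))
    {r : ℝ} (hr : 0 < r) {B : ℝ≥0∞} (hB : ∀ k, ∫⁻ x, coneSq (Gs k) x ^ r ≤ B) :
    ∫⁻ x, coneSq G x ^ r ≤ B := by
  have hinner : ∀ᵐ t ∂volume.restrict (Ioi (0 : ℝ)), ∀ x : Space n,
      (∫⁻ y in Metric.ball x t, ‖G (t, y)‖ₑ ^ 2) / ENNReal.ofReal (t ^ (n + 1)) ≤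
      liminf (fun k => (∫⁻ y in Metric.ball x t, ‖Gs k (t, y)‖ₑ ^ 2) /
        ENNReal.ofReal (t ^ (n + 1))) atTop := by
    filter_upwards [hlim, self_mem_ae_restrict measurableSet_Ioi] with t ht ht0 x
    have ht0' : (0 : ℝ) < t := ht0
    set μ := (volume : Measure (Space n)).restrict (Metric.ball x t)
    set a := eLpNorm (fun y => G (t, y)) 2 μ
    set d : ℕ → ℝ≥0∞ := fun k => eLpNorm (fun y => G (t, y) - Gs k (t, y)) 2 volume
    have hsm : ∀ H : ℝ × Space n → Val N, StronglyMeasurable H →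
        AEStronglyMeasurable (fun y => H (t, y)) μ := fun H hH =>
      (hH.comp_measurable measurable_prodMk_left).aestronglyMeasurable
    have hle : ∀ k, a - d k ≤ eLpNorm (fun y => Gs k (t, y)) 2 μ := by
      intro k
      rw [tsub_le_iff_right]
      have h1 : (fun y => G (t, y)) = (fun y => Gs k (t, y)) +
          fun y => G (t, y) - Gs k (t, y) := by funext y; simp
      calc a = eLpNorm ((fun y => Gs k (t, y)) + fun y => G (t, y) - Gs k (t, y)) 2 μ := by
            rw [← h1]
        _ ≤ _ := eLpNorm_add_le (hsm _ (hGs k)) ((hsm _ hG).sub (hsm _ (hGs k))) one_le_two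
        _ ≤ _ := by
            gcongr
            exact eLpNorm_mono_measure _ Measure.restrict_le_self
    have hlim2 : Tendsto (fun k => (a - d k) ^ 2 / ENNReal.ofReal (t ^ (n + 1))) atTop
        (𝓝 (a ^ 2 / ENNReal.ofReal (t ^ (n + 1)))) := by
      have h1 : Tendsto (fun k => a - d k) atTop (𝓝 (a - 0)) :=
        ENNReal.Tendsto.sub tendsto_const_nhds ht (Or.inr (by simp))
      rw [tsub_zero] at h1
      refine ENNReal.Tendsto.div_const ?_ (Or.inr (by simp [ht0']))
      exact (ENNReal.continuous_pow 2).continuousAt.tendsto.comp h1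
    rw [lintegral_enorm_sq_eq, ← hlim2.liminf_eq]
    refine liminf_le_liminf (Eventually.of_forall fun k => ?_)
    show _ ≤ _ / _
    rw [lintegral_enorm_sq_eq]
    gcongr
    exact hle k
  have hcone : ∀ x, coneSq G x ≤ liminf (fun k => coneSq (Gs k) x) atTop := by
    intro x
    rw [coneSq_eq_iterated hG]
    simp_rw [fun k => coneSq_eq_iterated (hGs k) x]
    refine le_trans (lintegral_mono_ae ?_) (lintegral_liminf_le fun k => ?_)
    · filter_upwards [hinner] with t ht
      exact ht x
    · have hrel : MeasurableSet {w : ℝ × Space n | w.2 ∈ Metric.ball x w.1} :=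
        measurableSet_lt (measurable_snd.dist measurable_const) measurable_fst
      have hm := (((hGs k).enorm.pow_const 2).indicator hrel).lintegral_prod_right'
        (ν := (volume : Measure (Space n)))
      have heq : (fun t : ℝ => ∫⁻ y in Metric.ball x t, ‖Gs k (t, y)‖ₑ ^ 2) = fun t => ∫⁻ y,
          {w : ℝ × Space n | w.2 ∈ Metric.ball x w.1}.indicator
            (fun w => ‖Gs k w‖ₑ ^ 2) (t, y) := by
        funext t
        rw [← lintegral_indicator Metric.isOpen_ball.measurableSet]
        rfl
      have : Measurable fun t : ℝ => ∫⁻ y in Metric.ball x t, ‖Gs k (t, y)‖ₑ ^ 2 := by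
        rw [heq]; exact hm
      exact this.div (by fun_prop)
  have hpow : ∀ x, coneSq G x ^ r ≤ liminf (fun k => coneSq (Gs k) x ^ r) atTop := by
    intro x
    refine (ENNReal.rpow_le_rpow (hcone x) hr.le).trans (le_of_eq ?_)
    exact (ENNReal.monotone_rpow_of_nonneg hr.le).map_liminf_of_continuousAt _
      (ENNReal.continuous_rpow_const.continuousAt)
  calc ∫⁻ x, coneSq G x ^ r ≤ ∫⁻ x, liminf (fun k => coneSq (Gs k) x ^ r) atTop :=
        lintegral_mono hpow
    _ ≤ liminf (fun k => ∫⁻ x, coneSq (Gs k) x ^ r) atTop :=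
        lintegral_liminf_le fun k => (measurable_coneSq (hGs k)).pow_const r
    _ ≤ B := by
        refine (liminf_le_liminf (Eventually.of_forall hB)).trans ?_
        simp

/-! ### Comparison of the conical and the dyadic square functions -/

/-- The scale of the dyadic cubes used at height `t`: `(n + 1) 2 ^ k ≤ t < 2 (n + 1) 2 ^ k`. The
factor `n + 1` exceeds the ratio of diameter and side length of a cube. -/
def scale (n : ℕ) (t : ℝ) : ℤ := ⌊Real.logb 2 (t / (n + 1))⌋

/-- The tile whose Whitney box contains the given point of the half space. -/
def tileOf (z : ℝ × Space n) : Tile n := (scale n z.1, cubeIdx (scale n z.1) z.2)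

lemma measurable_scale : Measurable (scale n) :=
  Int.measurable_floor.comp ((Real.measurable_log.comp (measurable_id.div_const _)).div_const _)

lemma scale_bounds {t : ℝ} (ht : 0 < t) :
    ((n : ℝ) + 1) * 2 ^ scale n t ≤ t ∧ t < 2 * (n + 1) * 2 ^ scale n t := by
  have hn : (0 : ℝ) < n + 1 := by positivity
  have h1 : (2 : ℝ) ^ Real.logb 2 (t / (n + 1)) = t / (n + 1) :=
    Real.rpow_logb (by norm_num) (by norm_num) (by positivity)
  constructor
  · have : (2 : ℝ) ^ scale n t ≤ t / (n + 1) := by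
      rw [← h1, ← Real.rpow_intCast]
      exact Real.rpow_le_rpow_of_exponent_le (by norm_num) (Int.floor_le _)
    rw [mul_comm]
    exact (le_div_iff₀ hn).mp this
  · have : t / (n + 1) < (2 : ℝ) ^ (scale n t + 1) := by
      rw [← h1, ← Real.rpow_intCast]
      refine Real.rpow_lt_rpow_of_exponent_lt (by norm_num) ?_
      push_cast
      exact Int.lt_floor_add_one _
    rw [div_lt_iff₀ hn, zpow_add_one₀ (by norm_num)] at this
    linarith

lemma measurable_tileOf : Measurable (tileOf (n := n)) := by
  have h2 : Measurable fun z : ℝ × Space n => (2 : ℝ) ^ scale n z.1 :=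
    (measurable_from_top (f := fun k : ℤ => (2 : ℝ) ^ k)).comp
      (measurable_scale.comp measurable_fst)
  refine (measurable_scale.comp measurable_fst).prodMk ?_
  refine measurable_pi_iff.mpr fun j => ?_
  exact Int.measurable_floor.comp (Measurable.div (by fun_prop) h2)

lemma measurableSet_tileOf (T : Set (Tile n)) : MeasurableSet (tileOf ⁻¹' T) :=
  measurable_tileOf (to_countable T).measurableSet

/-- The restriction of `F` to the Whitney boxes labelled by `T`. -/
def restr (T : Set (Tile n)) (F : ℝ × Space n → Val N) : ℝ × Space n → Val N :=
  (halfSpace n ∩ tileOf ⁻¹' T).indicator F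

/-- The energies of the restrictions of `F` to the individual Whitney boxes. -/
def tileEnergy (F : ℝ × Space n → Val N) (τ : Tile n) : ℝ≥0∞ :=
  ∫⁻ z in halfSpace n ∩ tileOf ⁻¹' {τ}, ‖F z‖ₑ ^ 2 / ENNReal.ofReal z.1

lemma measurableSet_box (T : Set (Tile n)) : MeasurableSet (halfSpace n ∩ tileOf ⁻¹' T) :=
  measurableSet_halfSpace.inter (measurableSet_tileOf T)

lemma stronglyMeasurable_restr {F : ℝ × Space n → Val N} (hF : StronglyMeasurable F)
    (T : Set (Tile n)) : StronglyMeasurable (restr T F) := hF.indicator (measurableSet_box T)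

lemma restr_univ_ae_eq (F : ℝ × Space n → Val N) :
    restr univ F =ᵐ[volume.restrict (halfSpace n)] F := by
  filter_upwards [self_mem_ae_restrict measurableSet_halfSpace] with z hz
  exact indicator_of_mem (show z ∈ halfSpace n ∩ tileOf ⁻¹' univ from ⟨hz, mem_univ _⟩) F

lemma restr_add_restr_compl (T : Set (Tile n)) (F : ℝ × Space n → Val N) :
    restr T F + restr Tᶜ F = restr univ F := by
  funext z
  by_cases hz : z ∈ halfSpace n
  · by_cases hT : tileOf z ∈ T <;> simp [restr, indicator, hz, hT]
  · simp [restr, indicator, hz]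

lemma energy_restr (T : Set (Tile n)) (F : ℝ × Space n → Val N) :
    energy (restr T F) = ∑' τ, T.indicator (tileEnergy F) τ := by
  have h1 : energy (restr T F) =
      ∫⁻ z in halfSpace n ∩ tileOf ⁻¹' T, ‖F z‖ₑ ^ 2 / ENNReal.ofReal z.1 := by
    rw [energy, ← lintegral_indicator measurableSet_halfSpace,
      ← lintegral_indicator (measurableSet_box T)]
    refine lintegral_congr fun z => ?_
    by_cases hz : z ∈ halfSpace n
    · by_cases hT : tileOf z ∈ T <;> simp [restr, indicator, hz, hT]
    · simp [indicator, hz]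
  have h2 : halfSpace n ∩ tileOf ⁻¹' T = ⋃ τ : T, halfSpace n ∩ tileOf ⁻¹' {(τ : Tile n)} := by
    ext z; simp
  rw [h1, h2, lintegral_iUnion (fun τ : T => measurableSet_box {(τ : Tile n)}), ← tsum_subtype]
  · rfl
  · intro τ τ' hne
    refine Set.disjoint_left.mpr fun z hz hz' => hne (Subtype.ext ?_)
    exact hz.2.symm.trans hz'.2

lemma tsum_tileEnergy (F : ℝ × Space n → Val N) : ∑' τ, tileEnergy F τ = energy F := by
  have h := energy_restr univ F
  rw [indicator_univ] at h
  rw [← h, energy, energy]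
  refine lintegral_congr_ae ?_
  filter_upwards [restr_univ_ae_eq F] with z hz
  rw [hz]

lemma tileEnergy_restr (T : Set (Tile n)) (F : ℝ × Space n → Val N) :
    tileEnergy (restr T F) = T.indicator (tileEnergy F) := by
  funext τ
  by_cases hτ : τ ∈ T
  · rw [indicator_of_mem hτ]
    refine setLIntegral_congr_fun (measurableSet_box {τ}) fun z hz => ?_
    have : z ∈ halfSpace n ∩ tileOf ⁻¹' T :=
      ⟨hz.1, by rw [mem_preimage, show tileOf z = τ from hz.2]; exact hτ⟩
    simp only [restr]
    rw [indicator_of_mem this]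
  · rw [indicator_of_notMem hτ, tileEnergy, setLIntegral_congr_fun (measurableSet_box {τ})
      (g := fun _ => 0), lintegral_zero]
    intro z hz
    have : z ∉ halfSpace n ∩ tileOf ⁻¹' T := fun h =>
      hτ (by have := h.2; rwa [mem_preimage, show tileOf z = τ from hz.2] at this)
    simp only [restr]
    rw [indicator_of_notMem this]
    simp

/-- The dyadic square function is pointwise dominated by the conical one, since the Whitney boxes
above the cubes containing `x` lie in the cone with vertex `x`. -/
lemma sq_tileEnergy_le (F : ℝ × Space n → Val N) (hF : StronglyMeasurable F) (x : Space n) :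
    sq (tileEnergy F) x ≤ ENNReal.ofReal ((2 * (n + 1)) ^ n) * coneSq F x := by
  rw [sq_eq]
  set A : ℤ → Set (ℝ × Space n) := fun k => halfSpace n ∩ tileOf ⁻¹' {(k, cubeIdx k x)} with hA
  have hAm : ∀ k, MeasurableSet (A k) := fun k => measurableSet_box _
  have hterm : ∀ k, tileEnergy F (k, cubeIdx k x) / volume (cube (k, cubeIdx k x)) ≤
      ENNReal.ofReal ((2 * (n + 1)) ^ n) *
        ∫⁻ z in A k, ‖F z‖ₑ ^ 2 / ENNReal.ofReal (z.1 ^ (n + 1)) := by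
    intro k
    have hmd : Measurable fun z : ℝ × Space n => ‖F z‖ₑ ^ 2 / ENNReal.ofReal z.1 :=
      (hF.enorm.pow_const 2).div (by fun_prop)
    rw [← lintegral_const_mul _ (measurable_density hF), div_eq_mul_inv, tileEnergy,
      ← lintegral_mul_const _ hmd]
    refine setLIntegral_mono' (hAm k) fun z hz => ?_
    have hz0 : 0 < z.1 := hz.1.1
    have hk : scale n z.1 = k := congrArg Prod.fst hz.2
    have hb := (scale_bounds (n := n) hz0).2
    rw [hk] at hb
    have h2k : (0 : ℝ) < 2 ^ k := by positivity
    rw [volume_cube, ← ENNReal.ofReal_inv_of_pos (by positivity), div_eq_mul_inv, div_eq_mul_inv,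
      ← ENNReal.ofReal_inv_of_pos hz0, ← ENNReal.ofReal_inv_of_pos (by positivity), mul_assoc,
      ← ENNReal.ofReal_mul (by positivity), mul_comm (ENNReal.ofReal _), mul_assoc,
      ← ENNReal.ofReal_mul (by positivity)]
    refine mul_le_mul_right (ENNReal.ofReal_le_ofReal ?_) _
    have h1 : z.1 ^ n ≤ (2 * (n + 1)) ^ n * ((2 : ℝ) ^ k) ^ n := by
      rw [← mul_pow]; exact pow_le_pow_left₀ hz0.le hb.le n
    rw [pow_succ, mul_inv, mul_comm (z.1 ^ n)⁻¹, mul_assoc]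
    gcongr
    rw [inv_mul_eq_div, inv_le_comm₀ (by positivity) (by positivity), inv_div,
      div_le_iff₀ (by positivity)]
    linarith
  calc ∑' k, tileEnergy F (k, cubeIdx k x) / volume (cube (k, cubeIdx k x))
      ≤ ∑' k, ENNReal.ofReal ((2 * (n + 1)) ^ n) *
        ∫⁻ z in A k, ‖F z‖ₑ ^ 2 / ENNReal.ofReal (z.1 ^ (n + 1)) := ENNReal.tsum_le_tsum hterm
    _ = ENNReal.ofReal ((2 * (n + 1)) ^ n) *
        ∫⁻ z in ⋃ k, A k, ‖F z‖ₑ ^ 2 / ENNReal.ofReal (z.1 ^ (n + 1)) := by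
        rw [ENNReal.tsum_mul_left, lintegral_iUnion hAm]
        intro k k' hne
        refine Set.disjoint_left.mpr fun z hz hz' => hne ?_
        exact congrArg Prod.fst (hz.2.symm.trans hz'.2)
    _ ≤ _ := by
        gcongr
        refine lintegral_mono_set (iUnion_subset fun k z hz => ?_)
        have hz0 : 0 < z.1 := hz.1.1
        have hk : scale n z.1 = k := congrArg Prod.fst hz.2
        have hmem : z.2 ∈ cube (k, cubeIdx k x) := by
          have h2 : cubeIdx (scale n z.1) z.2 = cubeIdx k x := congrArg Prod.snd hz.2
          rw [hk] at h2
          exact h2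
        refine ⟨hz0, ?_⟩
        rw [Metric.mem_ball]
        have h1 := dist_le_of_mem_cube hmem (mem_cube_cubeIdx k x)
        have hb := (scale_bounds (n := n) hz0).1
        rw [hk] at hb
        have h2k : (0 : ℝ) < 2 ^ k := by positivity
        simp only at h1
        linarith

lemma lintegral_dsf_rpow_le {F : ℝ × Space n → Val N} (hF : StronglyMeasurable F) {q : ℝ}
    (hq : 0 < q) :
    ∫⁻ x, dsf (tileEnergy F) x ^ q ≤
      ENNReal.ofReal ((2 * (n + 1)) ^ n) ^ (q / 2) * ∫⁻ x, coneSq F x ^ (q / 2) := by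
  rw [← lintegral_const_mul _ ((measurable_coneSq hF).pow_const _)]
  refine lintegral_mono fun x => ?_
  rw [dsf_rpow, ← ENNReal.mul_rpow_of_nonneg _ _ (by positivity)]
  exact ENNReal.rpow_le_rpow (sq_tileEnergy_le F hF x) (by positivity)

lemma scale_le_of_cube_subset (hn : 0 < n) {τ P : Tile n} (h : cube τ ⊆ cube P) : τ.1 ≤ P.1 := by
  have h1 := measure_mono (μ := volume) h
  rw [volume_cube, volume_cube, ENNReal.ofReal_le_ofReal_iff (by positivity)] at h1
  have h2 := (pow_le_pow_iff_left₀ (by positivity) (by positivity) hn.ne').mp h1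
  exact (zpow_le_zpow_iff_right₀ (by norm_num)).mp h2

lemma mem_of_restr_ne_zero (hn : 0 < n) {F : ℝ × Space n → Val N} {T : Set (Tile n)} {P : Tile n}
    (hT : ∀ τ ∈ T, cube τ ⊆ cube P) {z : ℝ × Space n} (hz : restr T F z ≠ 0) :
    0 < z.1 ∧ z.1 < 2 * (n + 1) * 2 ^ P.1 ∧ z.2 ∈ cube P := by
  have hmem : z ∈ halfSpace n ∩ tileOf ⁻¹' T := by
    by_contra h; exact hz (indicator_of_notMem h F)
  have hz0 : 0 < z.1 := hmem.1.1
  have hsub := hT _ hmem.2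
  refine ⟨hz0, ?_, hsub rfl⟩
  have h1 := scale_le_of_cube_subset hn hsub
  refine (scale_bounds (n := n) hz0).2.trans_le ?_
  gcongr
  · norm_num
  · exact h1

lemma volume_ball_zpow (x : Space n) (k : ℤ) {c : ℝ} (hc : 0 < c) :
    volume (Metric.ball x (c * 2 ^ k)) =
      ENNReal.ofReal (c ^ n) * volume (Metric.ball (0 : Space n) 1) *
        ENNReal.ofReal (((2 : ℝ) ^ k) ^ n) := by
  rw [Measure.addHaar_ball_of_pos _ _ (by positivity), finrank_euclideanSpace_fin, mul_pow,
    ENNReal.ofReal_mul (by positivity)]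
  ring

lemma volume_unitBall_ne_top : volume (Metric.ball (0 : Space n) 1) ≠ ⊤ :=
  measure_ball_lt_top.ne

/-- The `T^{1,2}` norm is controlled by the `L¹` norm of the dyadic square function. -/
lemma exists_lintegral_coneSq_rpow_half_le (hn : 0 < n) : ∃ C : ℝ≥0,
    ∀ F : ℝ × Space n → Val N, StronglyMeasurable F →
      ∫⁻ x, coneSq F x ^ (1 / 2 : ℝ) ≤ C * ∫⁻ x, dsf (tileEnergy F) x := by
  set b := volume (Metric.ball (0 : Space n) 1) with hbdef
  have hbt : b ≠ ⊤ := volume_unitBall_ne_top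
  set C₀ : ℝ≥0∞ := (ENNReal.ofReal ((4 * (n + 1)) ^ n) * b) ^ (1 / 2 : ℝ) * b ^ (1 / 2 : ℝ) with hC₀
  have hC₀t : C₀ ≠ ⊤ := ENNReal.mul_ne_top
    (ENNReal.rpow_ne_top_of_nonneg (by norm_num) (ENNReal.mul_ne_top ENNReal.ofReal_ne_top hbt))
    (ENNReal.rpow_ne_top_of_nonneg (by norm_num) hbt)
  refine ⟨(12 * C₀ + 1).toNNReal, fun F hF => ?_⟩
  have hCt : 12 * C₀ + 1 ≠ ⊤ := by finiteness
  rw [ENNReal.coe_toNNReal hCt]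
  by_cases hfin : ∫⁻ x, dsf (tileEnergy F) x = ⊤
  · rw [hfin, ENNReal.mul_top (by simp)]; exact le_top
  have key := le_lintegral_dsf_of_atoms hn (tileEnergy F)
    (fun T => ∫⁻ x, coneSq (restr T F) x ^ (1 / 2 : ℝ)) C₀ ?_ ?_ hfin
  · rw [coneSq_congr_ae (restr_univ_ae_eq F)] at key
    refine key.trans ?_
    gcongr
    exact le_self_add
  · intro f
    refine (lintegral_coneSq_rpow_half_le_tsum (stronglyMeasurable_restr hF univ)
      (U := fun i => halfSpace n ∩ tileOf ⁻¹' (f ⁻¹' {i})) (fun i => measurableSet_box _)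
      (fun z hz _ => ⟨f (tileOf z), show z ∈ halfSpace n ∩ _ from ⟨hz, rfl⟩⟩)).trans (le_of_eq ?_)
    congr 1; funext i
    have : (halfSpace n ∩ tileOf ⁻¹' (f ⁻¹' {i})).indicator (restr univ F)
        = restr (f ⁻¹' {i}) F := by
      funext z
      by_cases h : z ∈ halfSpace n ∩ tileOf ⁻¹' (f ⁻¹' {i})
      · rw [indicator_of_mem h, restr, restr, indicator_of_mem h,
          indicator_of_mem (show z ∈ halfSpace n ∩ tileOf ⁻¹' univ from ⟨h.1, mem_univ _⟩)]
      · rw [indicator_of_notMem h, restr, indicator_of_notMem h]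
    simp only [this]
  -- an atom lives in a box of height comparable with the side of `P`
  · intro P T hT
    obtain ⟨x₀, hx₀⟩ : (cube P).Nonempty := nonempty_of_measure_ne_zero (volume_cube_ne_zero P)
    have h2k : (0 : ℝ) < 2 ^ P.1 := by positivity
    refine (lintegral_coneSq_rpow_le_of_support (stronglyMeasurable_restr hF T) (x₀ := x₀)
      (ρ := 2 * (n + 1) * 2 ^ P.1) (fun z hz => ?_) (by norm_num) (by norm_num)).trans ?_
    · obtain ⟨_, h2, h3⟩ := mem_of_restr_ne_zero hn hT hz
      refine ⟨h2, (dist_le_of_mem_cube h3 hx₀).trans_lt ?_⟩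
      gcongr
      linarith
    · rw [energy_restr, show 2 * (2 * ((n : ℝ) + 1) * 2 ^ P.1) = (4 * (n + 1)) * 2 ^ P.1 by ring,
        volume_ball_zpow x₀ P.1 (by positivity), ← volume_cube,
        show (1 : ℝ) - 1 / 2 = 1 / 2 by norm_num, ← hbdef, hC₀]
      simp only [ENNReal.mul_rpow_of_nonneg _ _ (show (0 : ℝ) ≤ 1 / 2 by norm_num)]
      apply le_of_eq
      ring

lemma lintegral_coneSq_eq_dsf {F : ℝ × Space n → Val N} (hF : StronglyMeasurable F) :
    ∫⁻ x, coneSq F x = volume (Metric.ball (0 : Space n) 1) *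
      ∫⁻ x, dsf (tileEnergy F) x ^ (2 : ℝ) := by
  rw [lintegral_coneSq hF, ← tsum_tileEnergy, ← lintegral_sq]
  simp only [dsf_rpow]
  norm_num

/-- The `T^{q,2}` norm is controlled by the `L^q` norm of the dyadic square function. -/
theorem exists_lintegral_coneSq_rpow_le (hn : 0 < n) {q : ℝ} (hq : q ∈ Icc (1 : ℝ) 2) : ∃ C : ℝ≥0,
    ∀ F : ℝ × Space n → Val N, StronglyMeasurable F →
      ∫⁻ x, coneSq F x ^ (q / 2) ≤ C * ∫⁻ x, dsf (tileEnergy F) x ^ q := by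
  have hbt : volume (Metric.ball (0 : Space n) 1) ≠ ⊤ := volume_unitBall_ne_top
  obtain ⟨C₁, hC₁⟩ := exists_lintegral_coneSq_rpow_half_le (n := n) (N := N) hn
  rcases hq.1.eq_or_lt with rfl | hq1
  · refine ⟨C₁, fun F hF => ?_⟩
    simpa using hC₁ F hF
  rcases hq.2.eq_or_lt with rfl | hq2
  · refine ⟨(volume (Metric.ball (0 : Space n) 1)).toNNReal, fun F hF => ?_⟩
    rw [ENNReal.coe_toNNReal hbt, ← lintegral_coneSq_eq_dsf hF]
    simp
  obtain ⟨c, hc⟩ := exists_interpolation_const (n := n) hn hq1 hq2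
  set C₂ := (volume (Metric.ball (0 : Space n) 1)).toNNReal
  refine ⟨c * (C₁ + C₂) + 1, fun F hF => ?_⟩
  by_cases hfin : ∫⁻ x, dsf (tileEnergy F) x ^ q = ⊤
  · rw [hfin, ENNReal.mul_top (by simp)]; exact le_top
  -- the operator that is interpolated is the map from the energies to the conical square function
  have key := hc (tileEnergy F) C₁ C₂ (fun x => coneSq F x ^ (1 / 2 : ℝ))
    (fun T x => coneSq (restr T F) x ^ (1 / 2 : ℝ)) ((measurable_coneSq hF).pow_const _)
    (fun T => (measurable_coneSq (stronglyMeasurable_restr hF T)).pow_const _) ?_ ?_ ?_ hfin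
  · simp only [rpow_half_rpow] at key
    refine key.trans ?_
    push_cast
    gcongr
    exact le_self_add
  · intro T
    refine Filter.Eventually.of_forall fun x => ?_
    rw [← coneSq_congr_ae (restr_univ_ae_eq F), ← restr_add_restr_compl T]
    exact coneSq_add_rpow_half_le (stronglyMeasurable_restr hF T)
      (stronglyMeasurable_restr hF Tᶜ) x
  · intro T
    rw [← tileEnergy_restr]
    exact hC₁ _ (stronglyMeasurable_restr hF T)
  · intro T
    rw [← tileEnergy_restr, ENNReal.coe_toNNReal hbt,
      ← lintegral_coneSq_eq_dsf (stronglyMeasurable_restr hF T)]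
    simp only [rpow_half_rpow]
    simp

/-! ### Density in the tent spaces -/

/-- The box `[a, b] × B(0, R)`. -/
def box (n : ℕ) (a b R : ℝ) : Set (ℝ × Space n) := Icc a b ×ˢ Metric.closedBall 0 R

lemma isCompact_box (a b R : ℝ) : IsCompact (box n a b R) :=
  isCompact_Icc.prod (isCompact_closedBall 0 R)

/-- Bounded measurable functions supported in a compact box of the half space. -/
structure IsNice (F : ℝ × Space n → Val N) : Prop where
  meas : StronglyMeasurable F
  supp : ∃ a b R, 0 < a ∧ a < b ∧ 0 < R ∧ ∀ z, F z ≠ 0 → z ∈ box n a b R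
  bdd : ∃ C, ∀ z, ‖F z‖ ≤ C

lemma lintegral_enorm_sq_lt_top_of_box {F : ℝ × Space n → Val N} {a b R C : ℝ}
    (hs : ∀ z, F z ≠ 0 → z ∈ box n a b R) (hC : ∀ z, ‖F z‖ ≤ C) :
    ∫⁻ z, ‖F z‖ₑ ^ 2 < ⊤ := by
  calc ∫⁻ z, ‖F z‖ₑ ^ 2 ≤ ∫⁻ z, (box n a b R).indicator (fun _ => ENNReal.ofReal C ^ 2) z := by
        refine lintegral_mono fun z => ?_
        by_cases hz : F z = 0
        · simp [hz]
        · rw [indicator_of_mem (hs z hz)]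
          gcongr
          rw [← ofReal_norm]
          exact ENNReal.ofReal_le_ofReal (hC z)
    _ = ENNReal.ofReal C ^ 2 * volume (box n a b R) :=
        lintegral_indicator_const (isCompact_box a b R).measurableSet _
    _ < ⊤ := ENNReal.mul_lt_top (by finiteness) (isCompact_box a b R).measure_lt_top

lemma IsNice.lintegral_lt_top {F : ℝ × Space n → Val N} (hF : IsNice F) :
    ∫⁻ z, ‖F z‖ₑ ^ 2 < ⊤ := by
  obtain ⟨a, b, R, _, _, _, hs⟩ := hF.supp
  obtain ⟨C, hC⟩ := hF.bdd
  exact lintegral_enorm_sq_lt_top_of_box hs hC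

lemma IsNice.memLp {F : ℝ × Space n → Val N} (hF : IsNice F) : MemLp F 2 volume := by
  refine ⟨hF.meas.aestronglyMeasurable, ?_⟩
  have := hF.lintegral_lt_top
  rw [lintegral_enorm_sq_eq] at this
  by_contra h
  rw [not_lt_top_iff] at h
  simp [h] at this

lemma IsNice.add {F G : ℝ × Space n → Val N} (hF : IsNice F) (hG : IsNice G) : IsNice (F + G) := by
  obtain ⟨a, b, R, ha, hab, hR, hs⟩ := hF.supp
  obtain ⟨a', b', R', ha', hab', hR', hs'⟩ := hG.supp
  obtain ⟨C, hC⟩ := hF.bdd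
  obtain ⟨C', hC'⟩ := hG.bdd
  refine ⟨hF.meas.add hG.meas, ⟨min a a', max b b', max R R', lt_min ha ha',
    (min_le_left _ _).trans_lt (hab.trans_le (le_max_left _ _)), lt_max_of_lt_left hR, ?_⟩,
    ⟨C + C', fun z => (norm_add_le _ _).trans (add_le_add (hC z) (hC' z))⟩⟩
  intro z hz
  have : F z ≠ 0 ∨ G z ≠ 0 := by
    by_contra! h
    exact hz (by simp [h.1, h.2])
  rcases this with h | h
  · obtain ⟨⟨h1, h2⟩, h3⟩ := hs z h
    exact ⟨⟨(min_le_left _ _).trans h1, h2.trans (le_max_left _ _)⟩,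
      Metric.closedBall_subset_closedBall (le_max_left _ _) h3⟩
  · obtain ⟨⟨h1, h2⟩, h3⟩ := hs' z h
    exact ⟨⟨(min_le_right _ _).trans h1, h2.trans (le_max_right _ _)⟩,
      Metric.closedBall_subset_closedBall (le_max_right _ _) h3⟩

lemma IsNice.of_le {F G : ℝ × Space n → Val N} (hF : IsNice F) (hG : StronglyMeasurable G)
    {c : ℝ} (h : ∀ z, ‖G z‖ ≤ c * ‖F z‖) : IsNice G := by
  obtain ⟨a, b, R, ha, hab, hR, hs⟩ := hF.supp
  obtain ⟨C, hC⟩ := hF.bdd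
  refine ⟨hG, ⟨a, b, R, ha, hab, hR, fun z hz => hs z fun h0 => hz ?_⟩, ⟨|c| * C, fun z => ?_⟩⟩
  · have := h z
    rw [h0, norm_zero, mul_zero] at this
    exact norm_le_zero_iff.mp this
  · refine (h z).trans ?_
    calc c * ‖F z‖ ≤ |c| * ‖F z‖ := mul_le_mul_of_nonneg_right (le_abs_self c) (norm_nonneg _)
      _ ≤ |c| * C := mul_le_mul_of_nonneg_left (hC z) (abs_nonneg c)

lemma IsNice.indicator {F : ℝ × Space n → Val N} (hF : IsNice F) {A : Set (ℝ × Space n)}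
    (hA : MeasurableSet A) : IsNice (A.indicator F) :=
  hF.of_le (hF.meas.indicator hA) (c := 1) fun z => by
    rw [one_mul]; exact norm_indicator_le_norm_self F z

lemma IsNice.restr {F : ℝ × Space n → Val N} (hF : IsNice F) (T : Set (Tile n)) :
    IsNice (restr T F) := hF.indicator (measurableSet_box T)

lemma IsTest.isNice {F : ℝ × Space n → Val N} (hF : IsTest F) : IsNice F := by
  obtain ⟨h1, h2, h3⟩ := hF
  refine ⟨h1.continuous.stronglyMeasurable, ?_, ?_⟩
  · obtain ⟨a, ha, hat⟩ : ∃ a : ℝ, 0 < a ∧ ∀ z ∈ tsupport F, a ≤ z.1 := by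
      rcases (tsupport F).eq_empty_or_nonempty with he | hne
      · exact ⟨1, one_pos, by simp [he]⟩
      · obtain ⟨z, hz, hmin⟩ := h2.isCompact.exists_isMinOn hne continuous_fst.continuousOn
        exact ⟨z.1, (h3 hz).1, fun w hw => hmin hw⟩
    obtain ⟨R, hR⟩ := h2.isCompact.isBounded.subset_closedBall 0
    refine ⟨a, max (a + 1) R, max 1 R, ha, lt_max_of_lt_left (by linarith), by positivity, ?_⟩
    intro z hz
    have hz' := subset_tsupport F hz
    have h4 := hR hz'
    rw [mem_closedBall_zero_iff, Prod.norm_def, max_le_iff] at h4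
    refine ⟨⟨hat z hz', (le_abs_self _).trans (h4.1.trans (le_max_right _ _))⟩, ?_⟩
    rw [mem_closedBall_zero_iff]
    exact h4.2.trans (le_max_right _ _)
  · obtain ⟨C, hC⟩ := h1.continuous.bounded_above_of_compact_support h2
    exact ⟨C, hC⟩

/-- Test functions supported in a fixed box approximate a bounded function of compact support
in `L²`. -/
lemma IsNice.exists_isTest {F : ℝ × Space n → Val N} (hF : IsNice F) :
    ∃ a b R, 0 < a ∧ a < b ∧ 0 < R ∧ (∀ z, F z ≠ 0 → z ∈ box n a b R) ∧
      ∀ ε : ℝ, 0 < ε → ∃ φ : ℝ × Space n → Val N, IsTest φ ∧ (∀ z, φ z ≠ 0 → z ∈ box n a b R) ∧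
        ∫⁻ z, ‖(F - φ) z‖ₑ ^ 2 ≤ ENNReal.ofReal ε ^ 2 := by
  obtain ⟨a, b, R, ha, hab, hR, hs⟩ := hF.supp
  let f₁ : ContDiffBump ((a + b) / 2) := ⟨(b - a) / 2, (b - a) / 2 + a / 2, by linarith, by linarith⟩
  let f₂ : ContDiffBump (0 : Space n) := ⟨R, R + 1, hR, by linarith⟩
  set ψ : ℝ × Space n → ℝ := fun z => f₁ z.1 * f₂ z.2 with hψ
  have hψs : ∀ z, ψ z ≠ 0 → z ∈ box n (a / 2) (b + a / 2) (R + 1) := by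
    intro z hz
    have h1 : f₁ z.1 ≠ 0 := left_ne_zero_of_mul hz
    have h2 : f₂ z.2 ≠ 0 := right_ne_zero_of_mul hz
    have h1' : z.1 ∈ Function.support f₁ := h1
    have h2' : z.2 ∈ Function.support f₂ := h2
    rw [f₁.support_eq, Metric.mem_ball, Real.dist_eq, abs_lt] at h1'
    rw [f₂.support_eq] at h2'
    have h3 : f₁.rOut = (b - a) / 2 + a / 2 := rfl
    rw [h3] at h1'
    exact ⟨⟨by linarith [h1'.1], by linarith [h1'.2]⟩, Metric.ball_subset_closedBall h2'⟩
  have hψ1 : ∀ z, F z ≠ 0 → ψ z = 1 := by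
    intro z hz
    obtain ⟨⟨h1, h2⟩, h3⟩ := hs z hz
    have e1 : f₁ z.1 = 1 := f₁.one_of_mem_closedBall (by
      rw [Metric.mem_closedBall, Real.dist_eq, abs_le]
      have h4 : f₁.rIn = (b - a) / 2 := rfl
      rw [h4]
      constructor <;> linarith)
    have e2 : f₂ z.2 = 1 := f₂.one_of_mem_closedBall h3
    simp [hψ, e1, e2]
  refine ⟨a / 2, b + a / 2, R + 1, by linarith, by linarith, by linarith, ?_, ?_⟩
  · intro z hz
    exact hψs z (by rw [hψ1 z hz]; exact one_ne_zero)
  · intro ε hε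
    obtain ⟨g, hg1, hg2, hg3⟩ := hF.memLp.exist_eLpNorm_sub_le (by simp) one_le_two hε
    refine ⟨fun z => ψ z • g z, ⟨?_, ?_, ?_⟩, ?_, ?_⟩
    · have : ContDiff ℝ ∞ ψ :=
        (f₁.contDiff.comp contDiff_fst).mul (f₂.contDiff.comp contDiff_snd)
      exact this.smul hg2
    · refine hg1.mono fun z hz h => hz ?_
      simp only [h, smul_zero]
    · have hcl : IsClosed (box n (a / 2) (b + a / 2) (R + 1)) := (isCompact_box _ _ _).isClosed
      refine (closure_minimal (fun z hz => ?_) hcl).trans fun z hz => ⟨?_, mem_univ _⟩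
      · exact hψs z (fun h => hz (by simp [h]))
      · have h1 := hz.1.1
        exact lt_of_lt_of_le (by linarith) h1
    · intro z hz
      exact hψs z (fun h => hz (by simp [h]))
    · calc ∫⁻ z, ‖(F - fun z => ψ z • g z) z‖ₑ ^ 2 ≤ ∫⁻ z, ‖(F - g) z‖ₑ ^ 2 := by
            refine lintegral_mono fun z => ?_
            gcongr 1
            have h1 : (F - fun z => ψ z • g z) z = ψ z • (F - g) z := by
              simp only [Pi.sub_apply, smul_sub]
              by_cases hz : F z = 0
              · simp [hz]
              · simp only [hψ1 z hz, one_smul]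
            rw [h1, enorm_smul]
            have h2 : ‖ψ z‖ₑ ≤ 1 := by
              rw [← ofReal_norm, ENNReal.ofReal_le_one, Real.norm_of_nonneg
                (mul_nonneg f₁.nonneg f₂.nonneg)]
              exact mul_le_one₀ f₁.le_one f₂.nonneg f₂.le_one
            exact mul_le_of_le_one_left zero_le h2
        _ ≤ _ := by
            rw [lintegral_enorm_sq_eq]
            gcongr

lemma exists_lintegral_coneSq_rpow_le_of_box {a b R r : ℝ} (ha : 0 < a) (hr : 0 < r) (hr1 : r ≤ 1) :
    ∃ C : ℝ≥0, ∀ F : ℝ × Space n → Val N, StronglyMeasurable F →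
      (∀ z, F z ≠ 0 → z ∈ box n a b R) →
      ∫⁻ x, coneSq F x ^ r ≤ C * (∫⁻ z, ‖F z‖ₑ ^ 2) ^ r := by
  set ρ := max b R + 1
  set X := volume (Metric.ball (0 : Space n) (2 * ρ)) ^ (1 - r)
  set Y := volume (Metric.ball (0 : Space n) 1)
  have hX : X ≠ ⊤ := ENNReal.rpow_ne_top_of_nonneg (by linarith) measure_ball_lt_top.ne
  have hY : Y ≠ ⊤ := measure_ball_lt_top.ne
  have hZ : X * (Y * ENNReal.ofReal a⁻¹) ^ r ≠ ⊤ :=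
    ENNReal.mul_ne_top hX (ENNReal.rpow_ne_top_of_nonneg hr.le (by finiteness))
  refine ⟨(X * (Y * ENNReal.ofReal a⁻¹) ^ r).toNNReal, fun F hF hs => ?_⟩
  rw [ENNReal.coe_toNNReal hZ, mul_assoc, ← ENNReal.mul_rpow_of_nonneg _ _ hr.le]
  refine (lintegral_coneSq_rpow_le_of_support hF (x₀ := 0) (ρ := ρ) (fun z hz => ?_) hr hr1).trans ?_
  · obtain ⟨⟨_, h2⟩, h3⟩ := hs z hz
    exact ⟨(h2.trans (le_max_left _ _)).trans_lt (lt_add_one _),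
      ((Metric.mem_closedBall.mp h3).trans (le_max_right _ _)).trans_lt (lt_add_one _)⟩
  · refine mul_le_mul_right (ENNReal.rpow_le_rpow ?_ hr.le) _
    rw [mul_assoc]
    refine mul_le_mul_right ?_ _
    rw [energy, ← lintegral_const_mul _ (hF.enorm.pow_const 2)]
    refine (setLIntegral_le_lintegral _ _).trans (lintegral_mono fun z => ?_)
    by_cases hz : F z = 0
    · simp [hz]
    · have h1 := (hs z hz).1.1
      rw [ENNReal.div_eq_inv_mul, ENNReal.ofReal_inv_of_pos ha]
      gcongr

/-- Truncation in height, in space and in size. -/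
def truncSet (F : ℝ × Space n → Val N) (k : ℕ) : Set (ℝ × Space n) :=
  box n (1 / (k + 1)) (k + 2) (k + 1) ∩ {z | ‖F z‖ ≤ k}

lemma measurableSet_truncSet {F : ℝ × Space n → Val N} (hF : StronglyMeasurable F) (k : ℕ) :
    MeasurableSet (truncSet F k) :=
  (isCompact_box _ _ _).measurableSet.inter (measurableSet_le hF.norm.measurable measurable_const)

lemma isNice_truncSet {F : ℝ × Space n → Val N} (hF : StronglyMeasurable F) (k : ℕ) :
    IsNice ((truncSet F k).indicator F) := by
  refine ⟨hF.indicator (measurableSet_truncSet hF k), ⟨1 / (k + 1), k + 2, k + 1, by positivity, ?_,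
    by positivity, fun z hz => ?_⟩, ⟨k, fun z => ?_⟩⟩
  · have : 1 / ((k : ℝ) + 1) ≤ 1 := by
      rw [div_le_one (by positivity)]; linarith [k.cast_nonneg (α := ℝ)]
    linarith [k.cast_nonneg (α := ℝ)]
  · by_contra h
    exact hz (indicator_of_notMem (fun h' => h h'.1) F)
  · by_cases h : z ∈ truncSet F k
    · rw [indicator_of_mem h]; exact h.2
    · rw [indicator_of_notMem h, norm_zero]; exact k.cast_nonneg

lemma eventually_mem_truncSet (F : ℝ × Space n → Val N) {z : ℝ × Space n} (hz : z ∈ halfSpace n) :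
    ∀ᶠ k in Filter.atTop, z ∈ truncSet F k := by
  have hz0 : 0 < z.1 := hz.1
  obtain ⟨k₀, hk₀⟩ := exists_nat_ge (max (max z.1⁻¹ z.1) (max ‖z.2‖ ‖F z‖))
  filter_upwards [Filter.eventually_ge_atTop k₀] with k hk
  have hk' : (k₀ : ℝ) ≤ k := by exact_mod_cast hk
  have h := hk₀.trans hk'
  simp only [max_le_iff] at h
  obtain ⟨⟨h1, h2⟩, h3, h4⟩ := h
  refine ⟨⟨⟨?_, by linarith⟩, ?_⟩, h4⟩
  · rw [one_div, inv_le_comm₀ (by positivity) hz0]; linarith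
  · rw [mem_closedBall_zero_iff]; linarith

open Filter Topology in
lemma tendsto_lintegral_coneSq_truncSet {F : ℝ × Space n → Val N} (hF : StronglyMeasurable F)
    {r : ℝ} (hr : 0 < r) (hfin : ∫⁻ x, coneSq F x ^ r ≠ ⊤) :
    Tendsto (fun k => ∫⁻ x, coneSq (F - (truncSet F k).indicator F) x ^ r) atTop (𝓝 0) := by
  have hsub : ∀ k, F - (truncSet F k).indicator F = (truncSet F k)ᶜ.indicator F := fun k => by
    rw [indicator_compl]
  simp_rw [hsub]
  have hm : ∀ k, StronglyMeasurable ((truncSet F k)ᶜ.indicator F) := fun k =>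
    hF.indicator (measurableSet_truncSet hF k).compl
  have hle : ∀ k x, coneSq ((truncSet F k)ᶜ.indicator F) x ≤ coneSq F x := fun k x =>
    coneSq_mono (fun z => enorm_indicator_le_enorm_self F z) x
  have hlim : ∀ᵐ x, Tendsto (fun k => coneSq ((truncSet F k)ᶜ.indicator F) x ^ r) atTop (𝓝 0) := by
    filter_upwards [ae_lt_top ((measurable_coneSq hF).pow_const r) hfin] with x hx
    have hx' : coneSq F x ≠ ⊤ := fun h => by
      rw [h, ENNReal.top_rpow_of_pos hr] at hx
      exact lt_irrefl _ hx
    have h1 : Tendsto (fun k => coneSq ((truncSet F k)ᶜ.indicator F) x) atTop (𝓝 0) := by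
      have := tendsto_lintegral_of_dominated_convergence (μ := volume.restrict (cone x))
        (F := fun k z => ‖(truncSet F k)ᶜ.indicator F z‖ₑ ^ 2 / ENNReal.ofReal (z.1 ^ (n + 1)))
        (f := fun _ => 0) (fun z => ‖F z‖ₑ ^ 2 / ENNReal.ofReal (z.1 ^ (n + 1)))
        (fun k => measurable_density (hm k)) (fun k => Eventually.of_forall fun z => by
          have := enorm_indicator_le_enorm_self (s := (truncSet F k)ᶜ) F z
          simp only
          gcongr) hx' ?_
      · rw [lintegral_zero] at this
        exact this
      · filter_upwards [self_mem_ae_restrict (measurableSet_cone x)] with z hz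
        refine tendsto_const_nhds.congr' ?_
        filter_upwards [eventually_mem_truncSet F (cone_subset_halfSpace x hz)] with k hk
        rw [indicator_of_notMem (by simpa using hk)]
        simp
    have h2 := (ENNReal.continuous_rpow_const (y := r)).continuousAt.tendsto.comp h1
    rw [ENNReal.zero_rpow_of_pos hr] at h2
    exact h2
  have := tendsto_lintegral_of_dominated_convergence (μ := volume)
    (F := fun k x => coneSq ((truncSet F k)ᶜ.indicator F) x ^ r) (f := fun _ => 0)
    (fun x => coneSq F x ^ r) (fun k => (measurable_coneSq (hm k)).pow_const r)
    (fun k => Eventually.of_forall fun x => ENNReal.rpow_le_rpow (hle k x) hr.le) hfin hlim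
  simpa using this

lemma tentNorm_lt_iff {q : ℝ} (hq : 0 < q) {F : ℝ × Space n → Val N} {ε : ℝ≥0∞} :
    tentNorm q F < ε ↔ ∫⁻ x, coneSq F x ^ (q / 2) < ε ^ q := by
  rw [tentNorm_eq, one_div, ENNReal.rpow_inv_lt_iff hq]

lemma tentNorm_lt_top_iff {q : ℝ} (hq : 0 < q) {F : ℝ × Space n → Val N} :
    tentNorm q F < ⊤ ↔ ∫⁻ x, coneSq F x ^ (q / 2) < ⊤ := by
  rw [tentNorm_lt_iff hq, ENNReal.top_rpow_of_pos hq]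

lemma IsNice.tentNorm_lt_top {q : ℝ} (hq : q ∈ Icc (1 : ℝ) 2) {F : ℝ × Space n → Val N}
    (hF : IsNice F) : tentNorm q F < ⊤ := by
  have hq0 : 0 < q := by linarith [hq.1]
  obtain ⟨a, b, R, ha, _, _, hs⟩ := hF.supp
  obtain ⟨C, hC⟩ := exists_lintegral_coneSq_rpow_le_of_box (n := n) (N := N) (b := b) (R := R) ha
    (r := q / 2) (by positivity) (by linarith [hq.2])
  rw [tentNorm_lt_top_iff hq0]
  refine (hC F hF.meas hs).trans_lt (ENNReal.mul_lt_top (by simp) ?_)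
  exact ENNReal.rpow_lt_top_of_nonneg (by positivity) hF.lintegral_lt_top.ne

/-- A measurable function of finite tent norm is a limit of test functions. -/
lemma memTent_of_tentNorm_lt_top {q : ℝ} (hq : q ∈ Icc (1 : ℝ) 2) {F : ℝ × Space n → Val N}
    (hF : StronglyMeasurable F) (hfin : tentNorm q F < ⊤) : MemTent q F := by
  have hq0 : 0 < q := by linarith [hq.1]
  refine ⟨hF.aestronglyMeasurable, fun ε hε => ?_⟩
  rcases eq_or_ne ε ⊤ with rfl | hεt
  · refine ⟨0, ⟨contDiff_const, HasCompactSupport.zero, by simp [tsupport]⟩, ?_⟩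
    rwa [sub_zero]
  have hε2 : 0 < ε / 2 := ENNReal.half_pos hε.ne'
  have hε2q : 0 < (ε / 2) ^ q := ENNReal.rpow_pos hε2 (by finiteness)
  have h1 := tendsto_lintegral_coneSq_truncSet hF (r := q / 2) (by positivity)
    ((tentNorm_lt_top_iff hq0).mp hfin).ne
  obtain ⟨k, hk⟩ := (h1.eventually (gt_mem_nhds hε2q)).exists
  set F' := (truncSet F k).indicator F with hF'
  have hnice : IsNice F' := isNice_truncSet hF k
  obtain ⟨a, b, R, ha, _, _, hs, happrox⟩ := hnice.exists_isTest
  obtain ⟨C, hC⟩ := exists_lintegral_coneSq_rpow_le_of_box (n := n) (N := N) (b := b) (R := R) ha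
    (r := q / 2) (by positivity) (by linarith [hq.2])
  obtain ⟨δ, hδ, hδε⟩ : ∃ δ : ℝ, 0 < δ ∧ C * (ENNReal.ofReal δ ^ 2) ^ (q / 2) < (ε / 2) ^ q := by
    have hcont : Filter.Tendsto (fun δ : ℝ => C * (ENNReal.ofReal δ ^ 2) ^ (q / 2)) (nhds 0)
        (nhds (C * (ENNReal.ofReal 0 ^ 2) ^ (q / 2))) := by
      refine ENNReal.Tendsto.const_mul ?_ (Or.inr (by simp))
      refine (ENNReal.continuous_rpow_const.tendsto _).comp ?_
      exact ((ENNReal.continuous_pow 2).comp ENNReal.continuous_ofReal).tendsto 0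
    have h0 : C * (ENNReal.ofReal 0 ^ 2) ^ (q / 2) < (ε / 2) ^ q := by
      rw [ENNReal.ofReal_zero, zero_pow two_ne_zero, ENNReal.zero_rpow_of_pos (by positivity),
        mul_zero]
      exact hε2q
    have h2 := (hcont.mono_left (nhdsWithin_le_nhds (s := Ioi 0))).eventually (gt_mem_nhds h0)
    obtain ⟨δ, hδ1, hδ2⟩ := (h2.and self_mem_nhdsWithin).exists
    exact ⟨δ, hδ2, hδ1⟩
  obtain ⟨φ, hφ, hφs, hφd⟩ := happrox δ hδ
  refine ⟨φ, hφ, ?_⟩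
  have hφn := hφ.isNice
  have hdecomp : F - φ = (F - F') + (F' - φ) := by abel
  rw [hdecomp]
  refine (tentNorm_add_le hq.1 (hF.sub hnice.meas) (hnice.meas.sub hφn.meas)).trans_lt ?_
  rw [← ENNReal.add_halves ε]
  refine ENNReal.add_lt_add ?_ ?_
  · rwa [tentNorm_lt_iff hq0]
  · rw [tentNorm_lt_iff hq0]
    refine (hC (F' - φ) (hnice.meas.sub hφn.meas) (fun z hz => ?_)).trans_lt (lt_of_le_of_lt ?_ hδε)
    · by_cases h : F' z = 0
      · exact hφs z (fun h' => hz (by simp [h, h']))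
      · exact hs z h
    · gcongr

/-- Elements of the tent space have finite norm. -/
lemma MemTent.exists_stronglyMeasurable {q : ℝ} (hq : q ∈ Icc (1 : ℝ) 2)
    {F : ℝ × Space n → Val N} (hF : MemTent q F) :
    ∃ F', StronglyMeasurable F' ∧ F =ᵐ[volume.restrict (halfSpace n)] F' ∧ tentNorm q F' < ⊤ := by
  obtain ⟨F', hF', hae⟩ := hF.1
  refine ⟨F', hF', hae, ?_⟩
  obtain ⟨φ, hφ, hlt⟩ := hF.2 1 one_pos
  have h1 : tentNorm q (F' - φ) < 1 := by
    rwa [← tentNorm_congr_ae q (hae.sub (ae_eq_refl φ))]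
  have h2 : F' = (F' - φ) + φ := by abel
  rw [h2]
  refine (tentNorm_add_le hq.1 (hF'.sub hφ.isNice.meas) hφ.isNice.meas).trans_lt ?_
  exact ENNReal.add_lt_top.mpr ⟨h1.trans ENNReal.one_lt_top, hφ.isNice.tentNorm_lt_top hq⟩

/-! ### Slices and joint representatives -/

instance secondCountableTopology_L2 : SecondCountableTopology (L2 n N) := by
  have : Fact ((2 : ℝ≥0∞) ≠ ⊤) := ⟨by simp⟩
  infer_instance

lemma eLpNorm_two_lt_top_iff {X : Type*} [MeasurableSpace X] {μ : Measure X} {f : X → Val N} :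
    eLpNorm f 2 μ < ⊤ ↔ ∫⁻ x, ‖f x‖ₑ ^ 2 ∂μ < ⊤ := by
  rw [lintegral_enorm_sq_eq]
  constructor
  · intro h; finiteness
  · intro h
    by_contra h'
    rw [not_lt_top_iff] at h'
    simp [h'] at h

lemma eLpNorm_two_eq {X : Type*} [MeasurableSpace X] {μ : Measure X} (f : X → Val N) :
    eLpNorm f 2 μ = (∫⁻ x, ‖f x‖ₑ ^ 2 ∂μ) ^ (1 / 2 : ℝ) := by
  rw [lintegral_enorm_sq_eq, rpow_half_sq]

lemma slice_of_memLp {F : ℝ × Space n → Val N} {s : ℝ}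
    (h : MemLp (fun y => F (s, y)) 2 volume) : slice F s = h.toLp _ := dif_pos h

lemma coeFn_slice {F : ℝ × Space n → Val N} {s : ℝ} (h : MemLp (fun y => F (s, y)) 2 volume) :
    slice F s =ᵐ[volume] fun y => F (s, y) := by
  rw [slice_of_memLp h]
  exact h.coeFn_toLp

lemma enorm_slice {F : ℝ × Space n → Val N} {s : ℝ} (h : MemLp (fun y => F (s, y)) 2 volume) :
    ‖slice F s‖ₑ = eLpNorm (fun y => F (s, y)) 2 volume := by
  rw [Lp.enorm_def]
  exact eLpNorm_congr_ae (coeFn_slice h)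

lemma enorm_slice_le (F : ℝ × Space n → Val N) (s : ℝ) :
    ‖slice F s‖ₑ ≤ eLpNorm (fun y => F (s, y)) 2 volume := by
  by_cases h : MemLp (fun y => F (s, y)) 2 volume
  · exact (enorm_slice h).le
  · simp [slice, h]

lemma slice_congr {F G : ℝ × Space n → Val N} {s : ℝ}
    (h : (fun y => F (s, y)) =ᵐ[volume] fun y => G (s, y)) : slice F s = slice G s := by
  by_cases hF : MemLp (fun y => F (s, y)) 2 volume
  · rw [slice_of_memLp hF, slice_of_memLp ((memLp_congr_ae h).mp hF)]
    exact MemLp.toLp_congr _ _ h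
  · have hG : ¬ MemLp (fun y => G (s, y)) 2 volume := fun h' => hF ((memLp_congr_ae h).mpr h')
    simp [slice, hF, hG]

lemma slice_add {F G : ℝ × Space n → Val N} {s : ℝ} (hF : MemLp (fun y => F (s, y)) 2 volume)
    (hG : MemLp (fun y => G (s, y)) 2 volume) : slice (F + G) s = slice F s + slice G s := by
  rw [slice_of_memLp hF, slice_of_memLp hG, slice_of_memLp (F := F + G) (hF.add hG)]
  exact MemLp.toLp_add _ _

lemma memLp_slice_iff {F : ℝ × Space n → Val N} (hF : StronglyMeasurable F) {s : ℝ} :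
    MemLp (fun y => F (s, y)) 2 volume ↔ ∫⁻ y, ‖F (s, y)‖ₑ ^ 2 < ⊤ := by
  rw [← eLpNorm_two_lt_top_iff]
  exact ⟨fun h => h.2, fun h => ⟨(hF.comp_measurable
    measurable_prodMk_left).aestronglyMeasurable, h⟩⟩

lemma measurable_lintegral_slice {F : ℝ × Space n → Val N} (hF : StronglyMeasurable F)
    (r : ℝ≥0∞) (hr : r ≠ 0) (hr' : r ≠ ⊤) :
    Measurable fun s => eLpNorm (fun y => F (s, y)) r volume := by
  simp_rw [eLpNorm_eq_lintegral_rpow_enorm_toReal hr hr']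
  exact (Measurable.lintegral_prod_right' (f := fun z : ℝ × Space n => ‖F z‖ₑ ^ r.toReal)
    (hF.enorm.pow_const _)).pow_const _

lemma IsNice.memLp_slice {F : ℝ × Space n → Val N} (hF : IsNice F) (s : ℝ) :
    MemLp (fun y => F (s, y)) 2 volume := by
  rw [memLp_slice_iff hF.meas]
  obtain ⟨a, b, R, _, _, _, hs⟩ := hF.supp
  obtain ⟨C, hC⟩ := hF.bdd
  calc ∫⁻ y, ‖F (s, y)‖ₑ ^ 2
      ≤ ∫⁻ y, (Metric.closedBall (0 : Space n) R).indicator (fun _ => ENNReal.ofReal C ^ 2) y := by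
        refine lintegral_mono fun y => ?_
        by_cases hz : F (s, y) = 0
        · simp [hz]
        · rw [indicator_of_mem (hs _ hz).2]
          gcongr
          rw [← ofReal_norm]
          exact ENNReal.ofReal_le_ofReal (hC _)
    _ = ENNReal.ofReal C ^ 2 * volume (Metric.closedBall (0 : Space n) R) :=
        lintegral_indicator_const measurableSet_closedBall _
    _ < ⊤ := ENNReal.mul_lt_top (by finiteness) measure_closedBall_lt_top

/-- Slices depend measurably on the height: the distances from `F(s, ·)` to fixed elements of `L²`
do, and the balls generate the Borel sets of a separable metric space. -/
lemma stronglyMeasurable_slice {F : ℝ × Space n → Val N} (hF : StronglyMeasurable F) :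
    StronglyMeasurable (slice F) := by
  classical
  let _ : MeasurableSpace (L2 n N) := borel _
  have : BorelSpace (L2 n N) := ⟨rfl⟩
  refine Measurable.stronglyMeasurable ?_
  have hset : MeasurableSet {s : ℝ | MemLp (fun y => F (s, y)) 2 volume} := by
    simp_rw [memLp_slice_iff hF]
    exact measurableSet_lt (Measurable.lintegral_prod_right'
      (f := fun z : ℝ × Space n => ‖F z‖ₑ ^ 2) (hF.enorm.pow_const _)) measurable_const
  have hdist : ∀ u : L2 n N, Measurable fun s => edist (slice F s) u := by
    intro u
    have h1 : (fun s => edist (slice F s) u) =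
        {s : ℝ | MemLp (fun y => F (s, y)) 2 volume}.piecewise
          (fun s => (∫⁻ y, ‖F (s, y) - u y‖ₑ ^ 2) ^ (1 / 2 : ℝ)) fun _ => edist 0 u := by
      ext s
      by_cases hs : MemLp (fun y => F (s, y)) 2 volume
      · rw [piecewise_eq_of_mem _ _ _ (show s ∈ {s : ℝ | MemLp (fun y => F (s, y)) 2 volume} from hs), ← eLpNorm_two_eq,
          Lp.edist_def]
        refine eLpNorm_congr_ae ?_
        filter_upwards [coeFn_slice hs] with y hy
        simp [hy]
      · rw [piecewise_eq_of_notMem _ _ _ (show s ∉ {s : ℝ | MemLp (fun y => F (s, y)) 2 volume} from hs)]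
        simp [slice, hs]
    rw [h1]
    refine Measurable.piecewise hset ?_ measurable_const
    refine Measurable.pow_const ?_ _
    refine Measurable.lintegral_prod_right' (f := fun z : ℝ × Space n => ‖F z - u z.2‖ₑ ^ 2) ?_
    exact ((hF.sub ((Lp.stronglyMeasurable u).comp_measurable measurable_snd)).enorm).pow_const _
  refine measurable_of_isOpen fun U hU => ?_
  have h2 : slice F ⁻¹' U = ⋃ i : {i : ℕ × ℕ // Metric.eball
      (TopologicalSpace.denseSeq (L2 n N) i.1) ((i.2 : ℝ≥0∞) + 1)⁻¹ ⊆ U},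
      {s | edist (slice F s) (TopologicalSpace.denseSeq (L2 n N) i.1.1) <
        ((i.1.2 : ℝ≥0∞) + 1)⁻¹} := by
    ext s
    simp only [mem_preimage, mem_iUnion, mem_ofPred_eq]
    constructor
    · intro hs
      obtain ⟨ε, hε, hεU⟩ := EMetric.isOpen_iff.mp hU _ hs
      obtain ⟨k, hk⟩ := ENNReal.exists_inv_nat_lt (ENNReal.half_pos hε.ne').ne'
      have hk' : ((k : ℝ≥0∞) + 1)⁻¹ < ε / 2 :=
        (ENNReal.inv_le_inv.mpr le_self_add).trans_lt hk
      have hpos : (0 : ℝ≥0∞) < ((k : ℝ≥0∞) + 1)⁻¹ := by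
        rw [ENNReal.inv_pos]; finiteness
      obtain ⟨d, hd⟩ := EMetric.mem_closure_iff.mp
        ((TopologicalSpace.denseRange_denseSeq (L2 n N)) (slice F s)) _ hpos
      obtain ⟨⟨i, rfl⟩, hd⟩ := hd
      refine ⟨⟨(i, k), fun v hv => hεU ?_⟩, hd⟩
      rw [Metric.mem_eball] at hv ⊢
      calc edist v (slice F s) ≤ edist v _ + edist _ (slice F s) := edist_triangle _ _ _
        _ < ε / 2 + ε / 2 := ENNReal.add_lt_add (hv.trans hk') (by rw [edist_comm]; exact hd.trans hk')
        _ = ε := ENNReal.add_halves ε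
    · rintro ⟨⟨i, hi⟩, h⟩
      exact hi h
  rw [h2]
  exact MeasurableSet.iUnion fun i => measurableSet_lt (hdist _) measurable_const

/-- A measurable `L²`-valued function is a uniform limit of measurable functions with values in a
countable set. -/
lemma exists_index_approx {g : ℝ → L2 n N} (hg : StronglyMeasurable g) :
    ∃ i : ℕ → ℝ → ℕ, (∀ k, Measurable (i k)) ∧
      ∀ k t, ‖TopologicalSpace.denseSeq (L2 n N) (i k t) - g t‖ < (1 / 2) ^ k := by
  classical
  have hex : ∀ (k : ℕ) (t : ℝ), ∃ j, ‖TopologicalSpace.denseSeq (L2 n N) j - g t‖ < (1 / 2) ^ k := by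
    intro k t
    obtain ⟨j, hj⟩ := (TopologicalSpace.denseRange_denseSeq (L2 n N)).exists_dist_lt (g t)
      (show (0 : ℝ) < (1 / 2) ^ k by positivity)
    exact ⟨j, by rwa [dist_comm, dist_eq_norm] at hj⟩
  refine ⟨fun k t => Nat.find (hex k t), fun k => measurable_find _ fun j => ?_,
    fun k t => Nat.find_spec (hex k t)⟩
  exact measurableSet_lt (stronglyMeasurable_const.sub hg).norm.measurable measurable_const

lemma stronglyMeasurable_coeFn_index {i : ℝ → ℕ} (hi : Measurable i) (d : ℕ → L2 n N) :
    StronglyMeasurable fun z : ℝ × Space n => d (i z.1) z.2 := by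
  have h1 : Measurable fun w : ℕ × Space n => d w.1 w.2 :=
    measurable_from_prod_countable_right fun j => (Lp.stronglyMeasurable (d j)).measurable
  exact (h1.comp ((hi.comp measurable_fst).prodMk measurable_snd)).stronglyMeasurable

open Filter Topology in
lemma exists_joint {g : ℝ → L2 n N} (hg : StronglyMeasurable g) :
    ∃ G : ℝ × Space n → Val N, StronglyMeasurable G ∧
      ∀ t, (fun y => G (t, y)) =ᵐ[volume] g t := by
  obtain ⟨i, hi, hlt⟩ := exists_index_approx hg
  set d := TopologicalSpace.denseSeq (L2 n N)
  refine ⟨fun z => limUnder atTop fun k => d (i k z.1) z.2,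
    StronglyMeasurable.limUnder fun k => stronglyMeasurable_coeFn_index (hi k) d, fun t => ?_⟩
  have hsum : ∑' k : ℕ, ENNReal.ofReal (3 * (1 / 2) ^ k) ≠ ⊤ := by
    rw [← ENNReal.ofReal_tsum_of_nonneg (fun k => by positivity)
      (summable_geometric_two.mul_left 3)]
    simp
  have hb : ∀ k, eLpNorm (⇑(d (i k t)) - ⇑(g t)) 2 volume ≤ ENNReal.ofReal ((1 / 2) ^ k) := by
    intro k
    have := (hlt k t).le
    rw [← eLpNorm_congr_ae (Lp.coeFn_sub (d (i k t)) (g t)), ← Lp.enorm_def, ← ofReal_norm]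
    exact ENNReal.ofReal_le_ofReal this
  have hcau : ∀ᵐ y, ∃ l, Tendsto (fun k => d (i k t) y) atTop (𝓝 l) := by
    refine Lp.ae_tendsto_of_cauchy_eLpNorm (p := 2) (fun k => Lp.aestronglyMeasurable _)
      (by norm_num) hsum ?_
    intro K k l hk hl
    have h1 : (⇑(d (i k t)) - ⇑(d (i l t))) =
        (⇑(d (i k t)) - ⇑(g t)) - (⇑(d (i l t)) - ⇑(g t)) := by abel
    rw [h1]
    refine (eLpNorm_sub_le ((Lp.aestronglyMeasurable _).sub (Lp.aestronglyMeasurable _))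
      ((Lp.aestronglyMeasurable _).sub (Lp.aestronglyMeasurable _)) (by norm_num)).trans_lt ?_
    refine (add_le_add (hb k) (hb l)).trans_lt ?_
    rw [← ENNReal.ofReal_add (by positivity) (by positivity)]
    refine (ENNReal.ofReal_lt_ofReal_iff (by positivity)).mpr ?_
    have h2 : ((1 : ℝ) / 2) ^ k ≤ (1 / 2) ^ K := pow_le_pow_of_le_one (by norm_num) (by norm_num) hk
    have h3 : ((1 : ℝ) / 2) ^ l ≤ (1 / 2) ^ K := pow_le_pow_of_le_one (by norm_num) (by norm_num) hl
    have h4 : (0 : ℝ) < (1 / 2) ^ K := by positivity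
    linarith
  have hlim : ∀ᵐ y, Tendsto (fun k => d (i k t) y) atTop
      (𝓝 (limUnder atTop fun k => d (i k t) y)) := by
    filter_upwards [hcau] with y hy
    exact tendsto_nhds_limUnder hy
  have hmem : eLpNorm ((fun y => limUnder atTop fun k => d (i k t) y) - ⇑(g t)) 2 volume ≤ 0 := by
    refine (Lp.eLpNorm_lim_le_liminf_eLpNorm (f := fun k => ⇑(d (i k t)) - ⇑(g t))
      (fun k => (Lp.aestronglyMeasurable _).sub (Lp.aestronglyMeasurable _)) _ ?_).trans ?_
    · filter_upwards [hlim] with y hy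
      exact hy.sub_const _
    · have hz : Tendsto (fun k : ℕ => ENNReal.ofReal ((1 / 2) ^ k)) atTop (𝓝 0) := by
        have := ENNReal.tendsto_ofReal (tendsto_pow_atTop_nhds_zero_of_lt_one
          (show (0 : ℝ) ≤ 1 / 2 by norm_num) (by norm_num))
        simpa using this
      have := tendsto_of_tendsto_of_tendsto_of_le_of_le tendsto_const_nhds hz
        (fun _ => zero_le) hb
      rw [this.liminf_eq]
  have hmeas : AEStronglyMeasurable (fun y => limUnder atTop fun k => d (i k t) y) volume :=
    aestronglyMeasurable_of_tendsto_ae _ (fun k => Lp.aestronglyMeasurable _) hlim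
  have h0 := (eLpNorm_eq_zero_iff (hmeas.sub (Lp.aestronglyMeasurable _)) (by norm_num)).mp
    (le_antisymm hmem zero_le)
  filter_upwards [h0] with y hy
  exact sub_eq_zero.mp hy

open scoped Classical in
/-- A jointly measurable function on the half space whose slices represent the values of an
`L²`-valued function of the height. It is `0` when that function is not measurable. -/
def jointRep (g : ℝ → L2 n N) : ℝ × Space n → Val N :=
  if h : AEStronglyMeasurable g (volume.restrict (Ioi 0)) then
    (exists_joint h.stronglyMeasurable_mk).choose else 0

lemma stronglyMeasurable_jointRep (g : ℝ → L2 n N) : StronglyMeasurable (jointRep g) := by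
  unfold jointRep
  split_ifs with h
  · exact (exists_joint h.stronglyMeasurable_mk).choose_spec.1
  · exact stronglyMeasurable_zero

lemma jointRep_ae {g : ℝ → L2 n N} (h : AEStronglyMeasurable g (volume.restrict (Ioi 0))) :
    ∀ᵐ t ∂(volume.restrict (Ioi 0)), (fun y => jointRep g (t, y)) =ᵐ[volume] g t := by
  filter_upwards [h.ae_eq_mk] with t ht
  unfold jointRep
  rw [dif_pos h, ht]
  exact (exists_joint h.stronglyMeasurable_mk).choose_spec.2 t

open Filter Topology in
lemma StronglyMeas.aestronglyMeasurable_apply {K : OpKernel n N} (hK : StronglyMeas K)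
    {g : ℝ → L2 n N} (hg : StronglyMeasurable g) :
    AEStronglyMeasurable (fun z : ℝ × ℝ => K z.1 z.2 (g z.2))
      (volume.restrict (Ioi 0 ×ˢ Ioi 0)) := by
  obtain ⟨i, hi, hlt⟩ := exists_index_approx hg
  set d := TopologicalSpace.denseSeq (L2 n N)
  refine aestronglyMeasurable_of_tendsto_ae atTop
    (f := fun k z => K z.1 z.2 (d (i k z.2))) (fun k => ?_) (Eventually.of_forall fun z => ?_)
  · have hcov : (⋃ j, {z : ℝ × ℝ | i k z.2 = j}) = univ := by
      ext z; simp
    rw [← Measure.restrict_univ (μ := volume.restrict (Ioi (0 : ℝ) ×ˢ Ioi (0 : ℝ))), ← hcov,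
      aestronglyMeasurable_iUnion_iff]
    intro j
    have hj : MeasurableSet {z : ℝ × ℝ | i k z.2 = j} :=
      ((hi k).comp measurable_snd) (measurableSet_singleton j)
    refine ((hK (d j)).mono_measure Measure.restrict_le_self).congr ?_
    filter_upwards [self_mem_ae_restrict hj] with z hz
    rw [show i k z.2 = j from hz]
  · refine ((K z.1 z.2).continuous.tendsto _).comp ?_
    rw [tendsto_iff_norm_sub_tendsto_zero]
    exact squeeze_zero (fun _ => norm_nonneg _) (fun k => (hlt k z.2).le)
      (tendsto_pow_atTop_nhds_zero_of_lt_one (by norm_num) (by norm_num))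

/-! ### Integral operators with operator-valued kernels -/

/-- The measure `ds/s` on `(0, ∞)`. -/
def dlog : Measure ℝ := (volume.restrict (Ioi 0)).withDensity fun s => ENNReal.ofReal s⁻¹

lemma lintegral_dlog (f : ℝ → ℝ≥0∞) :
    ∫⁻ s, f s ∂dlog = ∫⁻ s in Ioi 0, ENNReal.ofReal s⁻¹ * f s :=
  lintegral_withDensity_eq_lintegral_mul_non_measurable _ (by fun_prop)
    (Filter.Eventually.of_forall fun _ => ENNReal.ofReal_lt_top) f

lemma ae_dlog : ae dlog = ae (volume.restrict (Ioi (0 : ℝ))) := by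
  refine le_antisymm (withDensity_absolutelyContinuous _ _).ae_le
    (withDensity_absolutelyContinuous' (by fun_prop) ?_).ae_le
  filter_upwards [self_mem_ae_restrict measurableSet_Ioi] with s hs
  have : 0 < s := hs
  simpa using this

lemma ae_dlog_pos : ∀ᵐ s ∂dlog, 0 < s := by
  rw [ae_dlog]
  exact self_mem_ae_restrict measurableSet_Ioi

instance : SFinite dlog := by unfold dlog; infer_instance

lemma energy_eq {G : ℝ × Space n → Val N} (hG : StronglyMeasurable G) :
    energy G = ∫⁻ t, eLpNorm (fun y => G (t, y)) 2 volume ^ 2 ∂dlog := by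
  have hm : Measurable fun z : ℝ × Space n => ‖G z‖ₑ ^ 2 / ENNReal.ofReal z.1 :=
    (hG.enorm.pow_const 2).div (by fun_prop)
  rw [energy, lintegral_halfSpace hm, lintegral_dlog]
  refine setLIntegral_congr_fun measurableSet_Ioi fun t ht => ?_
  have ht : 0 < t := ht
  simp only [ENNReal.div_eq_inv_mul]
  rw [lintegral_const_mul' _ _ (by simpa using ht), lintegral_enorm_sq_eq,
    ENNReal.ofReal_inv_of_pos ht]

/-- The smaller of the `L²` norm and of the rescaled `L^p` norm at scale `max {t,s}`, the two
quantities that control `‖K(t,s) f‖₂`. -/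
def scaledNorm (p σ t s : ℝ) (f : Space n → Val N) : ℝ≥0∞ :=
  min (eLpNorm f 2 volume)
    (ENNReal.ofReal (max t s ^ (-σ)) * eLpNorm f (ENNReal.ofReal p) volume)

lemma scaledNorm_congr {p σ t s : ℝ} {f g : Space n → Val N} (h : f =ᵐ[volume] g) :
    scaledNorm p σ t s f = scaledNorm p σ t s g := by
  rw [scaledNorm, scaledNorm, eLpNorm_congr_ae h, eLpNorm_congr_ae h]

lemma scaledNorm_mono {p σ t s : ℝ} {f g : Space n → Val N} (h : ∀ y, ‖f y‖ ≤ ‖g y‖) :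
    scaledNorm p σ t s f ≤ scaledNorm p σ t s g :=
  min_le_min (eLpNorm_mono h) (mul_le_mul_right (eLpNorm_mono h) _)

lemma measurable_scaledNorm {F : ℝ × Space n → Val N} (hF : StronglyMeasurable F) {p : ℝ}
    (hp : 0 < p) (σ t : ℝ) : Measurable fun s => scaledNorm p σ t s fun y => F (s, y) := by
  refine (measurable_lintegral_slice hF 2 (by norm_num) (by norm_num)).min (Measurable.mul ?_ ?_)
  · fun_prop
  · exact measurable_lintegral_slice hF _ (by simpa using hp) (by simp)

/-- Strongly measurable kernels dominated by the weight `w` in the `L²` norm and in the rescaled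
`L^p`-`L²` norm. -/
structure Dominated (p σ : ℝ) (w : ℝ → ℝ → ℝ≥0∞) (κ : OpKernel n N) : Prop where
  meas : StronglyMeas κ
  le : ∀ t s, 0 < t → 0 < s → ∀ u : L2 n N, ‖κ t s u‖ₑ ≤ w t s * scaledNorm p σ t s u

lemma Dominated.le_slice {p σ : ℝ} {w : ℝ → ℝ → ℝ≥0∞} {κ : OpKernel n N} (h : Dominated p σ w κ)
    (F : ℝ × Space n → Val N) {t s : ℝ} (ht : 0 < t) (hs : 0 < s) :
    ‖κ t s (slice F s)‖ₑ ≤ w t s * scaledNorm p σ t s fun y => F (s, y) := by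
  by_cases hF : MemLp (fun y => F (s, y)) 2 volume
  · rw [← scaledNorm_congr (coeFn_slice hF)]
    exact h.le t s ht hs _
  · simp [slice, hF]

lemma Dominated.le_two {p σ : ℝ} {w : ℝ → ℝ → ℝ≥0∞} {κ : OpKernel n N} (h : Dominated p σ w κ)
    {t s : ℝ} (ht : 0 < t) (hs : 0 < s) (u : L2 n N) : ‖κ t s u‖ₑ ≤ w t s * ‖u‖ₑ :=
  (h.le t s ht hs u).trans (mul_le_mul_right (by rw [Lp.enorm_def]; exact min_le_left _ _) _)

/-- Functions on which the operators with a kernel dominated by `w` are given by absolutely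
convergent integrals. -/
def Admissible (p σ : ℝ) (w : ℝ → ℝ → ℝ≥0∞) (F : ℝ × Space n → Val N) : Prop :=
  (∀ᵐ s ∂dlog, MemLp (fun y => F (s, y)) 2 volume) ∧
    ∀ᵐ t ∂dlog, ∫⁻ s, w t s * scaledNorm p σ t s (fun y => F (s, y)) ∂dlog < ⊤

/-- The integral `∫₀^∞ κ(t,s) F(s, ·) ds/s`. -/
def op (κ : OpKernel n N) (F : ℝ × Space n → Val N) (t : ℝ) : L2 n N :=
  ∫ s in Ioi (0 : ℝ), s⁻¹ • κ t s (slice F s)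

/-- A measurable function on the half space that represents `T_κ F`. -/
def image (κ : OpKernel n N) (F : ℝ × Space n → Val N) : ℝ × Space n → Val N := jointRep (op κ F)

lemma stronglyMeasurable_image (κ : OpKernel n N) (F : ℝ × Space n → Val N) :
    StronglyMeasurable (image κ F) := stronglyMeasurable_jointRep _

lemma aestronglyMeasurable_integrand {κ : OpKernel n N} (hκ : StronglyMeas κ)
    {F : ℝ × Space n → Val N} (hF : StronglyMeasurable F) :
    AEStronglyMeasurable (fun z : ℝ × ℝ => z.2⁻¹ • κ z.1 z.2 (slice F z.2))
      ((volume.restrict (Ioi 0)).prod (volume.restrict (Ioi 0))) := by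
  rw [Measure.prod_restrict]
  have h1 : AEStronglyMeasurable (fun z : ℝ × ℝ => z.2⁻¹)
      (volume.restrict (Ioi (0 : ℝ) ×ˢ Ioi (0 : ℝ))) := measurable_snd.inv.aestronglyMeasurable
  exact h1.smul (hκ.aestronglyMeasurable_apply (stronglyMeasurable_slice hF))

lemma aestronglyMeasurable_op {κ : OpKernel n N} (hκ : StronglyMeas κ)
    {F : ℝ × Space n → Val N} (hF : StronglyMeasurable F) :
    AEStronglyMeasurable (op κ F) (volume.restrict (Ioi 0)) :=
  (aestronglyMeasurable_integrand hκ hF).integral_prod_right'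

lemma image_ae {κ : OpKernel n N} (hκ : StronglyMeas κ)
    {F : ℝ × Space n → Val N} (hF : StronglyMeasurable F) :
    ∀ᵐ t ∂dlog, (fun y => image κ F (t, y)) =ᵐ[volume] op κ F t := by
  rw [ae_dlog]
  exact jointRep_ae (aestronglyMeasurable_op hκ hF)

lemma lintegral_enorm_integrand (κ : OpKernel n N) (F : ℝ × Space n → Val N) (t : ℝ) :
    ∫⁻ s in Ioi (0 : ℝ), ‖s⁻¹ • κ t s (slice F s)‖ₑ = ∫⁻ s, ‖κ t s (slice F s)‖ₑ ∂dlog := by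
  rw [lintegral_dlog]
  refine setLIntegral_congr_fun measurableSet_Ioi fun s hs => ?_
  have hs : 0 < s := hs
  rw [enorm_smul, ← ofReal_norm s⁻¹, Real.norm_of_nonneg (inv_nonneg.mpr hs.le)]

lemma Dominated.integrableOn {p σ : ℝ} {w : ℝ → ℝ → ℝ≥0∞} {κ : OpKernel n N}
    (h : Dominated p σ w κ) {F : ℝ × Space n → Val N} (hF : StronglyMeasurable F)
    (hadm : Admissible p σ w F) :
    ∀ᵐ t ∂dlog, IntegrableOn (fun s : ℝ => s⁻¹ • κ t s (slice F s)) (Ioi 0) := by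
  have h1 := (aestronglyMeasurable_integrand h.meas hF).prodMk_left
  rw [← ae_dlog] at h1
  filter_upwards [h1, hadm.2, ae_dlog_pos] with t ht hfin ht0
  refine ⟨ht, ?_⟩
  rw [hasFiniteIntegral_iff_enorm, lintegral_enorm_integrand]
  refine lt_of_le_of_lt (lintegral_mono_ae ?_) hfin
  filter_upwards [ae_dlog_pos] with s hs
  exact h.le_slice F ht0 hs

lemma Dominated.isImage {p σ : ℝ} {w : ℝ → ℝ → ℝ≥0∞} {κ : OpKernel n N}
    (h : Dominated p σ w κ) {F : ℝ × Space n → Val N} (hF : StronglyMeasurable F)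
    (hadm : Admissible p σ w F) : IsImage κ F (image κ F) := by
  refine ⟨?_, ?_⟩
  · rw [← ae_dlog]
    exact hadm.1
  · have h1 := h.integrableOn hF hadm
    have h2 := image_ae h.meas hF
    rw [← ae_dlog]
    filter_upwards [h1, h2] with t ht1 ht2
    exact ⟨ht1, ht2⟩

/-- The image only depends on the class of `F` modulo null sets. -/
lemma IsImage.congr_left {κ : OpKernel n N} {F F' G : ℝ × Space n → Val N}
    (h : F =ᵐ[volume.restrict (halfSpace n)] F') (hG : IsImage κ F' G) : IsImage κ F G := by
  have h1 := ae_ae_of_ae_halfSpace h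
  obtain ⟨h2, h3⟩ := hG
  refine ⟨?_, ?_⟩
  · filter_upwards [h1, h2] with s hs1 hs2
    exact (memLp_congr_ae hs1).mpr hs2
  · filter_upwards [h3] with t ht
    have h4 : ∀ᵐ s ∂(volume.restrict (Ioi (0 : ℝ))),
        s⁻¹ • κ t s (slice F s) = s⁻¹ • κ t s (slice F' s) := by
      filter_upwards [h1] with s hs
      rw [slice_congr hs]
    exact ⟨ht.1.congr_fun_ae (by filter_upwards [h4] with s hs using hs.symm),
      ht.2.trans (by rw [integral_congr_ae h4])⟩

/-- A function with the same slices is again an image. -/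
lemma IsImage.congr_right {κ : OpKernel n N} {F G G' : ℝ × Space n → Val N}
    (h : G =ᵐ[volume.restrict (halfSpace n)] G') (hG : IsImage κ F G) : IsImage κ F G' := by
  refine ⟨hG.1, ?_⟩
  filter_upwards [hG.2, ae_ae_of_ae_halfSpace h] with t ht h1
  refine ⟨ht.1, ?_⟩
  have h2 : (fun y => G (t, y)) =ᵐ[volume] fun y => G' (t, y) := h1
  exact h2.symm.trans ht.2

lemma IsImage.add {κ κ' : OpKernel n N} {F G G' : ℝ × Space n → Val N}
    (h : IsImage κ F G) (h' : IsImage κ' F G') : IsImage (κ + κ') F (G + G') := by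
  refine ⟨h.1, ?_⟩
  filter_upwards [h.2, h'.2] with t ht ht'
  have h1 : (fun s : ℝ => s⁻¹ • (κ + κ') t s (slice F s)) =
      (fun s : ℝ => s⁻¹ • κ t s (slice F s)) + fun s : ℝ => s⁻¹ • κ' t s (slice F s) := by
    ext1 s
    simp only [Pi.add_apply, add_apply, smul_add]
  rw [h1]
  refine ⟨ht.1.add ht'.1, ?_⟩
  have h2 : ∫ s in Ioi (0 : ℝ), ((fun s : ℝ => s⁻¹ • κ t s (slice F s)) +
      fun s : ℝ => s⁻¹ • κ' t s (slice F s)) s = op κ F t + op κ' F t := integral_add ht.1 ht'.1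
  rw [h2]
  filter_upwards [ht.2, ht'.2, Lp.coeFn_add (op κ F t) (op κ' F t)] with y h3 h4 h5
  rw [h5, Pi.add_apply, Pi.add_apply, h3, h4]
  rfl

/-- Two images of the same function agree almost everywhere. -/
lemma IsImage.ae_eq_image {κ : OpKernel n N} (hκ : StronglyMeas κ) {F G : ℝ × Space n → Val N}
    (hF : StronglyMeasurable F) (hG : AEStronglyMeasurable G (volume.restrict (halfSpace n)))
    (h : IsImage κ F G) : G =ᵐ[volume.restrict (halfSpace n)] image κ F := by
  obtain ⟨G', hG', hae⟩ := hG
  refine hae.trans ?_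
  have h' := h.congr_right hae
  refine ae_halfSpace_of_ae_ae
    (hG'.measurableSet_eq_fun (stronglyMeasurable_image κ F)) ?_
  have h2 := image_ae hκ hF
  rw [ae_dlog] at h2
  filter_upwards [h'.2, h2] with t ht ht2
  exact ht.2.trans ht2.symm

lemma op_add {p σ : ℝ} {w : ℝ → ℝ → ℝ≥0∞} {κ : OpKernel n N}
    (h : Dominated p σ w κ) {F G : ℝ × Space n → Val N} (hF : StronglyMeasurable F)
    (hG : StronglyMeasurable G) (hadmF : Admissible p σ w F) (hadmG : Admissible p σ w G) :
    ∀ᵐ t ∂dlog, op κ (F + G) t = op κ F t + op κ G t := by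
  filter_upwards [h.integrableOn hF hadmF, h.integrableOn hG hadmG] with t h1 h2
  rw [op, op, op, ← integral_add h1 h2]
  refine integral_congr_ae ?_
  have h3 := hadmF.1
  have h4 := hadmG.1
  rw [ae_dlog] at h3 h4
  filter_upwards [h3, h4] with s hs1 hs2
  rw [slice_add hs1 hs2, map_add, smul_add]

lemma image_add_ae {p σ : ℝ} {w : ℝ → ℝ → ℝ≥0∞} {κ : OpKernel n N}
    (h : Dominated p σ w κ) {F G : ℝ × Space n → Val N} (hF : StronglyMeasurable F)
    (hG : StronglyMeasurable G) (hadmF : Admissible p σ w F) (hadmG : Admissible p σ w G) :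
    image κ (F + G) =ᵐ[volume.restrict (halfSpace n)] image κ F + image κ G := by
  refine ae_halfSpace_of_ae_ae ((stronglyMeasurable_image _ _).measurableSet_eq_fun
    ((stronglyMeasurable_image _ _).add (stronglyMeasurable_image _ _))) ?_
  rw [← ae_dlog]
  filter_upwards [op_add h hF hG hadmF hadmG, image_ae h.meas hF, image_ae h.meas hG,
    image_ae h.meas (hF.add hG)] with t h1 h2 h3 h4
  filter_upwards [h2, h3, h4, Lp.coeFn_add (op κ F t) (op κ G t)] with y h5 h6 h7 h8
  rw [h7, h1, h8, Pi.add_apply, Pi.add_apply, h5, h6]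

/-- Minkowski's integral inequality on a measurable set. -/
lemma eLpNorm_indicator_op_le (κ : OpKernel n N) (F : ℝ × Space n → Val N) (t : ℝ)
    {A : Set (Space n)} (hA : MeasurableSet A) :
    eLpNorm (A.indicator (op κ F t)) 2 volume ≤
      ∫⁻ s, eLpNorm (A.indicator (κ t s (slice F s))) 2 volume ∂dlog := by
  have hr : ∀ u : L2 n N, eLpNorm (A.indicator u) 2 volume =
      ‖LpToLpRestrictCLM (Space n) (Val N) ℂ volume 2 A u‖ₑ := by
    intro u
    rw [eLpNorm_indicator_eq_eLpNorm_restrict hA, Lp.enorm_def]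
    exact (eLpNorm_congr_ae (LpToLpRestrictCLM_coeFn ℂ A u)).symm
  simp_rw [hr]
  by_cases hi : IntegrableOn (fun s : ℝ => s⁻¹ • κ t s (slice F s)) (Ioi 0)
  · rw [op, ← ContinuousLinearMap.integral_comp_comm _ hi, lintegral_dlog]
    refine (enorm_integral_le_lintegral_enorm _).trans (le_of_eq ?_)
    refine setLIntegral_congr_fun measurableSet_Ioi fun s hs => ?_
    have hs : 0 < s := hs
    rw [ContinuousLinearMap.map_smul_of_tower, enorm_smul, ← ofReal_norm s⁻¹,
      Real.norm_of_nonneg (inv_nonneg.mpr hs.le)]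
  · rw [op, integral_undef hi, map_zero, enorm_zero]
    exact zero_le

lemma enorm_op_le (κ : OpKernel n N) (F : ℝ × Space n → Val N) (t : ℝ) :
    ‖op κ F t‖ₑ ≤ ∫⁻ s, ‖κ t s (slice F s)‖ₑ ∂dlog := by
  rw [← lintegral_enorm_integrand]
  exact enorm_integral_le_lintegral_enorm _

open Filter Topology in
lemma tendsto_slice {F : ℝ × Space n → Val N} {Fs : ℕ → ℝ × Space n → Val N}
    (hFs : ∀ k, StronglyMeasurable (Fs k)) (hle : ∀ k z, ‖Fs k z‖ ≤ ‖F z‖) {s : ℝ} (hs : 0 < s)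
    (hlim : ∀ z ∈ halfSpace n, Tendsto (fun k => Fs k z) atTop (𝓝 (F z)))
    (hF : MemLp (fun y => F (s, y)) 2 volume) :
    Tendsto (fun k => slice (Fs k) s) atTop (𝓝 (slice F s)) := by
  have hmem : ∀ k, MemLp (fun y => Fs k (s, y)) 2 volume := fun k =>
    hF.of_le ((hFs k).comp_measurable measurable_prodMk_left).aestronglyMeasurable
      (Eventually.of_forall fun y => hle k _)
  have h1 : Tendsto (fun k => ∫⁻ y, ‖Fs k (s, y) - F (s, y)‖ₑ ^ 2) atTop (𝓝 0) := by
    have := tendsto_lintegral_of_dominated_convergence' (μ := (volume : Measure (Space n)))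
      (F := fun k y => ‖Fs k (s, y) - F (s, y)‖ₑ ^ 2) (f := fun _ => 0)
      (fun y => 4 * ‖F (s, y)‖ₑ ^ 2)
      (fun k => (((hmem k).1.sub hF.1).enorm.pow_const 2))
      (fun k => Eventually.of_forall fun y => ?_) ?_ (Eventually.of_forall fun y => ?_)
    · simpa using this
    · have h2 : ‖Fs k (s, y) - F (s, y)‖ₑ ≤ 2 * ‖F (s, y)‖ₑ := by
        refine (enorm_sub_le).trans ?_
        rw [two_mul]
        gcongr
        rw [enorm_le_iff_norm_le]
        exact hle k _
      calc ‖Fs k (s, y) - F (s, y)‖ₑ ^ 2 ≤ (2 * ‖F (s, y)‖ₑ) ^ 2 := by gcongr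
        _ = 4 * ‖F (s, y)‖ₑ ^ 2 := by rw [mul_pow]; norm_num
    · rw [lintegral_const_mul' _ _ (by norm_num)]
      exact ENNReal.mul_ne_top (by norm_num) (eLpNorm_two_lt_top_iff.mp hF.2).ne
    · have h3 : Tendsto (fun k => Fs k (s, y) - F (s, y)) atTop (𝓝 0) := by
        simpa using (hlim (s, y) ⟨hs, mem_univ _⟩).sub_const (F (s, y))
      have h4 := ((ENNReal.continuous_pow 2).tendsto _).comp h3.enorm
      simpa [Function.comp_def] using h4
  rw [tendsto_iff_edist_tendsto_0]
  have h5 : ∀ k, edist (slice (Fs k) s) (slice F s) =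
      (∫⁻ y, ‖Fs k (s, y) - F (s, y)‖ₑ ^ 2) ^ (1 / 2 : ℝ) := by
    intro k
    rw [Lp.edist_def, ← eLpNorm_two_eq]
    refine eLpNorm_congr_ae ?_
    filter_upwards [coeFn_slice (hmem k), coeFn_slice hF] with y h6 h7
    rw [Pi.sub_apply, h6, h7]
  simp_rw [h5]
  have h6 := (ENNReal.continuous_rpow_const (y := 1 / 2)).tendsto 0 |>.comp h1
  rw [ENNReal.zero_rpow_of_pos (by norm_num)] at h6
  exact h6

open Filter Topology in
/-- Dominated convergence for the operators, in the kernel and in the function. -/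
lemma tendsto_op {p σ : ℝ} (hp : 0 < p) {w : ℝ → ℝ → ℝ≥0∞} (hw : ∀ t, Measurable (w t))
    (hwt : ∀ t s, w t s ≠ ⊤) {κ : OpKernel n N} {κs : ℕ → OpKernel n N}
    (h : ∀ k, Dominated p σ w (κs k)) {F : ℝ × Space n → Val N} {Fs : ℕ → ℝ × Space n → Val N}
    (hF : StronglyMeasurable F)
    (hFs : ∀ k, StronglyMeasurable (Fs k)) (hle : ∀ k z, ‖Fs k z‖ ≤ ‖F z‖)
    (hlim : ∀ z ∈ halfSpace n, Tendsto (fun k => Fs k z) atTop (𝓝 (F z)))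
    (hκlim : ∀ t s, 0 < t → 0 < s → ∀ u, Tendsto (fun k => κs k t s u) atTop (𝓝 (κ t s u)))
    (hadm : Admissible p σ w F) :
    ∀ᵐ t ∂dlog, Tendsto (fun k => op (κs k) (Fs k) t) atTop (𝓝 (op κ F t)) := by
  have h1 : ∀ᵐ t ∂dlog, ∀ k, AEStronglyMeasurable
      (fun s => s⁻¹ • κs k t s (slice (Fs k) s)) (volume.restrict (Ioi 0)) := by
    rw [ae_dlog, ae_all_iff]
    exact fun k => (aestronglyMeasurable_integrand (h k).meas (hFs k)).prodMk_left
  filter_upwards [h1, hadm.2, ae_dlog_pos] with t ht hfin ht0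
  have hm : Measurable fun s => ENNReal.ofReal s⁻¹ *
      (w t s * scaledNorm p σ t s fun y => F (s, y)) :=
    Measurable.mul (by fun_prop) ((hw t).mul (measurable_scaledNorm hF hp σ t))
  rw [lintegral_dlog] at hfin
  refine tendsto_integral_of_dominated_convergence
    (fun s => (ENNReal.ofReal s⁻¹ * (w t s * scaledNorm p σ t s fun y => F (s, y))).toReal)
    ht (integrable_toReal_of_lintegral_ne_top hm.aemeasurable hfin.ne) (fun k => ?_) ?_
  · filter_upwards [self_mem_ae_restrict measurableSet_Ioi, ae_lt_top hm hfin.ne] with s hs hlt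
    have hs : 0 < s := hs
    rw [← ENNReal.ofReal_le_iff_le_toReal hlt.ne, ofReal_norm, enorm_smul, ← ofReal_norm s⁻¹,
      Real.norm_of_nonneg (inv_nonneg.mpr hs.le)]
    refine mul_le_mul_right (((h k).le_slice _ ht0 hs).trans ?_) _
    exact mul_le_mul_right (scaledNorm_mono fun y => hle k _) _
  · have h2 := hadm.1
    rw [ae_dlog] at h2
    filter_upwards [self_mem_ae_restrict measurableSet_Ioi, h2] with s hs hmem
    have hs : 0 < s := hs
    refine Tendsto.const_smul ?_ _
    have h3 := tendsto_slice hFs hle hs hlim hmem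
    have h4 : Tendsto (fun k => κs k t s (slice (Fs k) s - slice F s)) atTop (𝓝 0) := by
      rw [tendsto_iff_edist_tendsto_0]
      have h5 : Tendsto (fun k => w t s * ‖slice (Fs k) s - slice F s‖ₑ) atTop (𝓝 0) := by
        have h6 : Tendsto (fun k => slice (Fs k) s - slice F s) atTop (𝓝 0) := by
          simpa using h3.sub_const (slice F s)
        have := ENNReal.Tendsto.const_mul (a := w t s) h6.enorm (Or.inr (hwt t s))
        simpa using this
      refine tendsto_of_tendsto_of_tendsto_of_le_of_le tendsto_const_nhds h5
        (fun _ => zero_le) fun k => ?_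
      simp only [edist_zero_right]
      exact (h k).le_two ht0 hs _
    have h7 := h4.add (hκlim t s ht0 hs (slice F s))
    simpa using h7

open Filter Topology in
lemma tendsto_eLpNorm_image {κ : OpKernel n N} {κs : ℕ → OpKernel n N}
    (hκ : StronglyMeas κ) (hκs : ∀ k, StronglyMeas (κs k))
    {F : ℝ × Space n → Val N} {Fs : ℕ → ℝ × Space n → Val N} (hF : StronglyMeasurable F)
    (hFs : ∀ k, StronglyMeasurable (Fs k))
    (h : ∀ᵐ t ∂dlog, Tendsto (fun k => op (κs k) (Fs k) t) atTop (𝓝 (op κ F t))) :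
    ∀ᵐ t ∂(volume.restrict (Ioi 0)), Tendsto (fun k => eLpNorm (fun y => image κ F (t, y) -
      image (κs k) (Fs k) (t, y)) 2 volume) atTop (𝓝 0) := by
  have h1 : ∀ᵐ t ∂dlog, ∀ k, (fun y => image (κs k) (Fs k) (t, y)) =ᵐ[volume] op (κs k) (Fs k) t :=
    ae_all_iff.mpr fun k => image_ae (hκs k) (hFs k)
  rw [← ae_dlog]
  filter_upwards [h, h1, image_ae hκ hF] with t ht ht1 ht2
  rw [tendsto_iff_edist_tendsto_0] at ht
  refine ht.congr fun k => ?_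
  rw [edist_comm, Lp.edist_def]
  refine eLpNorm_congr_ae ?_
  filter_upwards [ht1 k, ht2] with y h3 h4
  rw [Pi.sub_apply, h3, h4]

open Filter Topology in
/-- Fatou's lemma for images. -/
lemma lintegral_coneSq_image_le_of_tendsto {κ : OpKernel n N} {κs : ℕ → OpKernel n N}
    (hκ : StronglyMeas κ) (hκs : ∀ k, StronglyMeas (κs k))
    {F : ℝ × Space n → Val N} {Fs : ℕ → ℝ × Space n → Val N} (hF : StronglyMeasurable F)
    (hFs : ∀ k, StronglyMeasurable (Fs k))
    (h : ∀ᵐ t ∂dlog, Tendsto (fun k => op (κs k) (Fs k) t) atTop (𝓝 (op κ F t)))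
    {r : ℝ} (hr : 0 < r) {B : ℝ≥0∞}
    (hB : ∀ k, ∫⁻ x, coneSq (image (κs k) (Fs k)) x ^ r ≤ B) :
    ∫⁻ x, coneSq (image κ F) x ^ r ≤ B :=
  lintegral_coneSq_rpow_le_of_tendsto (stronglyMeasurable_image _ _)
    (fun _ => stronglyMeasurable_image _ _) (tendsto_eLpNorm_image hκ hκs hF hFs h) hr hB

/-! ### Schur's lemma on the half line -/

/-- The scalar kernel `min(t/s, s/t)^ε`. -/
def schurKer (ε t s : ℝ) : ℝ≥0∞ := ENNReal.ofReal (min (t / s) (s / t) ^ ε)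

lemma measurable_schurKer (ε : ℝ) : Measurable fun z : ℝ × ℝ => schurKer ε z.1 z.2 := by
  unfold schurKer
  fun_prop

lemma schurKer_comm (ε t s : ℝ) : schurKer ε t s = schurKer ε s t := by
  rw [schurKer, schurKer, min_comm]

lemma lintegral_schurKer_le {ε t : ℝ} (hε : 0 < ε) (ht : 0 < t) :
    ∫⁻ s, schurKer ε t s ∂dlog ≤ ENNReal.ofReal (2 / ε) := by
  rw [lintegral_dlog]
  have hun : Ioi (0 : ℝ) ⊆ Ioo 0 t ∪ Ici t := fun s hs => by
    rcases lt_or_ge s t with h | h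
    · exact Or.inl ⟨hs, h⟩
    · exact Or.inr h
  refine (lintegral_mono_set hun).trans ((lintegral_union_le _ _ _).trans ?_)
  have h1 : ∫⁻ s in Ioo 0 t, ENNReal.ofReal s⁻¹ * schurKer ε t s ≤ ENNReal.ofReal (1 / ε) := by
    calc ∫⁻ s in Ioo 0 t, ENNReal.ofReal s⁻¹ * schurKer ε t s
        ≤ ∫⁻ s in Ioo 0 t, ENNReal.ofReal (t ^ (-ε)) * ENNReal.ofReal (s ^ (ε - 1)) := by
          refine setLIntegral_mono' measurableSet_Ioo fun s hs => ?_
          have hs0 : 0 < s := hs.1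
          rw [schurKer, ← ENNReal.ofReal_mul (by positivity), ← ENNReal.ofReal_mul (by positivity)]
          refine ENNReal.ofReal_le_ofReal ?_
          calc s⁻¹ * min (t / s) (s / t) ^ ε ≤ s⁻¹ * (s / t) ^ ε := by
                gcongr
                exact min_le_right _ _
            _ = t ^ (-ε) * s ^ (ε - 1) := by
                rw [Real.div_rpow hs0.le ht.le, Real.rpow_sub_one hs0.ne', Real.rpow_neg ht.le]
                field_simp
      _ = ENNReal.ofReal (1 / ε) := by
          rw [lintegral_const_mul _ (by fun_prop), lintegral_Ioo_rpow hε ht.le,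
            ← ENNReal.ofReal_mul (by positivity)]
          congr 1
          rw [mul_div_assoc', ← Real.rpow_add ht, neg_add_cancel, Real.rpow_zero]
  have h2 : ∫⁻ s in Ici t, ENNReal.ofReal s⁻¹ * schurKer ε t s ≤ ENNReal.ofReal (1 / ε) := by
    rw [setLIntegral_congr (Ioi_ae_eq_Ici (a := t)).symm]
    calc ∫⁻ s in Ioi t, ENNReal.ofReal s⁻¹ * schurKer ε t s
        ≤ ∫⁻ s in Ioi t, ENNReal.ofReal (t ^ ε) * ENNReal.ofReal (s ^ (-ε - 1)) := by
          refine setLIntegral_mono' measurableSet_Ioi fun s hs => ?_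
          have hs0 : 0 < s := ht.trans hs
          rw [schurKer, ← ENNReal.ofReal_mul (by positivity), ← ENNReal.ofReal_mul (by positivity)]
          refine ENNReal.ofReal_le_ofReal ?_
          calc s⁻¹ * min (t / s) (s / t) ^ ε ≤ s⁻¹ * (t / s) ^ ε := by
                gcongr
                exact min_le_left _ _
            _ = t ^ ε * s ^ (-ε - 1) := by
                rw [Real.div_rpow ht.le hs0.le, Real.rpow_sub_one hs0.ne', Real.rpow_neg hs0.le]
                field_simp
      _ = ENNReal.ofReal (1 / ε) := by
          rw [lintegral_const_mul _ (by fun_prop), lintegral_Ioi_rpow hε ht,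
            ← ENNReal.ofReal_mul (by positivity)]
          congr 1
          rw [mul_div_assoc', ← Real.rpow_add ht, add_neg_cancel, Real.rpow_zero]
  refine (add_le_add h1 h2).trans (le_of_eq ?_)
  rw [← ENNReal.ofReal_add (by positivity) (by positivity)]
  congr 1
  ring

/-- Schur's lemma for `min(t/s, s/t)^ε` on `L²(ds/s)`. -/
lemma lintegral_schurKer_sq_le {ε : ℝ} (hε : 0 < ε) {f : ℝ → ℝ≥0∞} (hf : Measurable f) :
    ∫⁻ t, (∫⁻ s, schurKer ε t s * f s ∂dlog) ^ 2 ∂dlog ≤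
      ENNReal.ofReal (2 / ε) ^ 2 * ∫⁻ s, f s ^ 2 ∂dlog := by
  have hm : ∀ t, Measurable (schurKer ε t) := fun t =>
    (measurable_schurKer ε).comp measurable_prodMk_left
  have hcs : ∀ t, 0 < t → (∫⁻ s, schurKer ε t s * f s ∂dlog) ^ 2 ≤
      ENNReal.ofReal (2 / ε) * ∫⁻ s, schurKer ε t s * f s ^ 2 ∂dlog := by
    intro t ht
    have h1 := ENNReal.lintegral_mul_norm_pow_le (μ := dlog) (hm t).aemeasurable
      ((hm t).mul (hf.pow_const 2)).aemeasurable (p := 1 / 2) (q := 1 / 2)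
      (by norm_num) (by norm_num) (by norm_num)
    have h2 : ∀ s, schurKer ε t s ^ (1 / 2 : ℝ) * (schurKer ε t * fun s => f s ^ 2) s ^ (1 / 2 : ℝ)
        = schurKer ε t s * f s := by
      intro s
      rw [Pi.mul_apply, ENNReal.mul_rpow_of_nonneg _ _ (by norm_num), rpow_half_sq, ← mul_assoc,
        ← ENNReal.rpow_add_of_nonneg _ _ (by norm_num) (by norm_num)]
      norm_num
    simp_rw [h2] at h1
    calc (∫⁻ s, schurKer ε t s * f s ∂dlog) ^ 2
        ≤ ((∫⁻ s, schurKer ε t s ∂dlog) ^ (1 / 2 : ℝ) *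
          (∫⁻ s, (schurKer ε t * fun s => f s ^ 2) s ∂dlog) ^ (1 / 2 : ℝ)) ^ 2 := by gcongr
      _ = (∫⁻ s, schurKer ε t s ∂dlog) * ∫⁻ s, (schurKer ε t * fun s => f s ^ 2) s ∂dlog := by
          rw [mul_pow, sq_rpow_half, sq_rpow_half]
      _ ≤ _ := mul_le_mul_left (lintegral_schurKer_le hε ht) _
  calc ∫⁻ t, (∫⁻ s, schurKer ε t s * f s ∂dlog) ^ 2 ∂dlog
      ≤ ∫⁻ t, ENNReal.ofReal (2 / ε) * ∫⁻ s, schurKer ε t s * f s ^ 2 ∂dlog ∂dlog := by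
        refine lintegral_mono_ae ?_
        filter_upwards [ae_dlog_pos] with t ht using hcs t ht
    _ = ENNReal.ofReal (2 / ε) * ∫⁻ s, ∫⁻ t, schurKer ε t s * f s ^ 2 ∂dlog ∂dlog := by
        rw [lintegral_const_mul' _ _ (by simp), lintegral_lintegral_swap]
        exact ((measurable_schurKer ε).mul ((hf.comp measurable_snd).pow_const 2)).aemeasurable
    _ ≤ ENNReal.ofReal (2 / ε) * ∫⁻ s, ENNReal.ofReal (2 / ε) * f s ^ 2 ∂dlog := by
        refine mul_le_mul_right (lintegral_mono_ae ?_) _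
        filter_upwards [ae_dlog_pos] with s hs
        simp_rw [schurKer_comm ε _ s]
        rw [lintegral_mul_const _ (hm s)]
        exact mul_le_mul_left (lintegral_schurKer_le hε hs) _
    _ = _ := by
        rw [lintegral_const_mul' _ _ (by simp), ← mul_assoc, ← pow_two]

lemma energy_indicator_image {κ : OpKernel n N} (hκ : StronglyMeas κ)
    {F : ℝ × Space n → Val N} (hF : StronglyMeasurable F) {U : Set (ℝ × Space n)}
    (hU : MeasurableSet U) :
    energy (U.indicator (image κ F)) =
      ∫⁻ t, eLpNorm ((Prod.mk t ⁻¹' U).indicator (op κ F t)) 2 volume ^ 2 ∂dlog := by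
  rw [energy_eq ((stronglyMeasurable_image κ F).indicator hU)]
  refine lintegral_congr_ae ?_
  filter_upwards [image_ae hκ hF] with t ht
  congr 1
  refine eLpNorm_congr_ae ?_
  filter_upwards [ht] with y hy
  by_cases h : (t, y) ∈ U
  · rw [indicator_of_mem h, indicator_of_mem (show y ∈ Prod.mk t ⁻¹' U from h), hy]
  · rw [indicator_of_notMem h, indicator_of_notMem (show y ∉ Prod.mk t ⁻¹' U from h)]

lemma energy_indicator_image_le {κ : OpKernel n N} (hκ : StronglyMeas κ)
    {F : ℝ × Space n → Val N} (hF : StronglyMeasurable F) {U : Set (ℝ × Space n)}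
    (hU : MeasurableSet U) {ε : ℝ} (hε : 0 < ε) {W : ℝ≥0∞}
    (hW : ∀ t s, 0 < t → 0 < s →
      eLpNorm ((Prod.mk t ⁻¹' U).indicator (κ t s (slice F s))) 2 volume ≤
        W * schurKer ε t s * ‖slice F s‖ₑ) :
    energy (U.indicator (image κ F)) ≤ (W * ENNReal.ofReal (2 / ε)) ^ 2 * energy F := by
  have hslice : Measurable fun s => ‖slice F s‖ₑ := (stronglyMeasurable_slice hF).enorm
  have hm : ∀ t, Measurable (schurKer ε t) := fun t =>
    (measurable_schurKer ε).comp measurable_prodMk_left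
  rw [energy_indicator_image hκ hF hU]
  calc ∫⁻ t, eLpNorm ((Prod.mk t ⁻¹' U).indicator (op κ F t)) 2 volume ^ 2 ∂dlog
      ≤ ∫⁻ t, W ^ 2 * (∫⁻ s, schurKer ε t s * ‖slice F s‖ₑ ∂dlog) ^ 2 ∂dlog := by
        refine lintegral_mono_ae ?_
        filter_upwards [ae_dlog_pos] with t ht
        rw [← mul_pow]
        refine pow_le_pow_left' ((eLpNorm_indicator_op_le κ F t
          (measurable_prodMk_left hU)).trans ?_) 2
        rw [← lintegral_const_mul W (f := fun s => schurKer ε t s * ‖slice F s‖ₑ)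
          ((hm t).mul hslice)]
        refine lintegral_mono_ae ?_
        filter_upwards [ae_dlog_pos] with s hs
        rw [← mul_assoc]
        exact hW t s ht hs
    _ = W ^ 2 * ∫⁻ t, (∫⁻ s, schurKer ε t s * ‖slice F s‖ₑ ∂dlog) ^ 2 ∂dlog := by
        rw [lintegral_const_mul]
        exact (Measurable.lintegral_prod_right' (f := fun z : ℝ × ℝ =>
          schurKer ε z.1 z.2 * ‖slice F z.2‖ₑ)
          ((measurable_schurKer ε).mul (hslice.comp measurable_snd))).pow_const 2
    _ ≤ W ^ 2 * (ENNReal.ofReal (2 / ε) ^ 2 * ∫⁻ s, ‖slice F s‖ₑ ^ 2 ∂dlog) :=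
        mul_le_mul_right (lintegral_schurKer_sq_le hε hslice) _
    _ ≤ (W * ENNReal.ofReal (2 / ε)) ^ 2 * energy F := by
        rw [mul_pow, mul_assoc, energy_eq hF]
        gcongr with s
        exact enorm_slice_le F s

/-! ### Operators with off-diagonal decay on functions supported above a cube -/

/-- Kernels with Schur decay in `t/s` and, on functions supported in a dyadic cube `P` at heights at
most comparable with its side length, with decay of order `M` away from `P`. In `off_le` the points
`(t, x)`, `x ∈ A`, are at distance at least `ρ` from `P`, either in height or in space. -/
structure LocalBound (ε M : ℝ) (W : ℝ≥0∞) (κ : OpKernel n N) : Prop where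
  le : ∀ t s, 0 < t → 0 < s → ∀ u : L2 n N, ‖κ t s u‖ₑ ≤ W * schurKer ε t s * ‖u‖ₑ
  off_le : ∀ (P : Tile n) (A : Set (Space n)), MeasurableSet A → ∀ t s ρ, 0 < t → 0 < s →
    s < 2 * (n + 1) * (2 : ℝ) ^ P.1 → 0 < ρ → (ρ ≤ t ∨ ∀ x ∈ A, ∀ y ∈ cube P, ρ ≤ dist x y) →
    ∀ u : L2 n N, (∀ᵐ y, y ∉ cube P → u y = 0) →
    eLpNorm (A.indicator (κ t s u)) 2 volume ≤
      W * schurKer ε t s * ENNReal.ofReal (((2 : ℝ) ^ P.1 / ρ) ^ M) * ‖u‖ₑ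

lemma LocalBound.energy_image_le {ε M : ℝ} {W : ℝ≥0∞} {κ : OpKernel n N} (h : LocalBound ε M W κ)
    (hκ : StronglyMeas κ) (hε : 0 < ε) {F : ℝ × Space n → Val N} (hF : StronglyMeasurable F) :
    energy (image κ F) ≤ (W * ENNReal.ofReal (2 / ε)) ^ 2 * energy F := by
  have := energy_indicator_image_le hκ hF MeasurableSet.univ hε (W := W) fun t s ht hs => by
    rw [preimage_univ, indicator_univ, ← Lp.enorm_def]
    exact h.le t s ht hs _
  rwa [indicator_univ] at this

lemma LocalBound.energy_annulus_le {ε M : ℝ} {W : ℝ≥0∞} {κ : OpKernel n N}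
    (h : LocalBound ε M W κ)
    (hκ : StronglyMeas κ) (hε : 0 < ε) {F : ℝ × Space n → Val N} (hF : StronglyMeasurable F)
    {P : Tile n} (hsupp : ∀ z, F z ≠ 0 → z.1 < 2 * (n + 1) * 2 ^ P.1 ∧ z.2 ∈ cube P)
    {ρ : ℝ} (hρ : 0 < ρ) {U : Set (ℝ × Space n)} (hU : MeasurableSet U)
    (hUρ : ∀ t x, (t, x) ∈ U → ρ ≤ t ∨ ∀ y ∈ cube P, ρ ≤ dist x y) :
    energy (U.indicator (image κ F)) ≤
      (W * ENNReal.ofReal (((2 : ℝ) ^ P.1 / ρ) ^ M) * ENNReal.ofReal (2 / ε)) ^ 2 * energy F := by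
  refine energy_indicator_image_le hκ hF hU hε fun t s ht hs => ?_
  by_cases hmem : MemLp (fun y => F (s, y)) 2 volume
  swap
  · refine (eLpNorm_indicator_le _).trans ?_
    rw [← Lp.enorm_def]
    simp [slice, hmem]
  by_cases hs2 : s < 2 * (n + 1) * 2 ^ P.1
  · rw [mul_right_comm W]
    refine h.off_le P _ (measurable_prodMk_left hU) t s ρ ht hs hs2 hρ ?_ _ ?_
    · by_cases htρ : ρ ≤ t
      · exact Or.inl htρ
      · exact Or.inr fun x hx => (hUρ t x hx).resolve_left htρ
    · filter_upwards [coeFn_slice hmem] with y hy hyP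
      rw [hy]
      by_contra h0
      exact hyP (hsupp _ h0).2
  · have h0 : slice F s = 0 := by
      rw [slice_of_memLp hmem]
      have : (fun y => F (s, y)) = 0 := by
        ext1 y
        by_contra h0
        exact hs2 (hsupp _ h0).1
      simp only [this]
      exact MemLp.toLp_zero _
    refine (eLpNorm_indicator_le _).trans ?_
    rw [← Lp.enorm_def]
    simp [h0]

/-- The `T^{1,2}` norm of the image of a function supported in the tent region above a cube. The
half space is split into dyadic annuli `U k` around the cube; on each of them the Cauchy-Schwarz
inequality costs `2^{kn/2}` and the decay gains `2^{-kM}`. -/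
lemma exists_lintegral_coneSq_image_le_of_support {ε M : ℝ} (hε : 0 < ε) (hM : (n : ℝ) / 2 < M) :
    ∃ c : ℝ≥0, ∀ (W : ℝ≥0∞) (κ : OpKernel n N), LocalBound ε M W κ → StronglyMeas κ →
      ∀ (P : Tile n) (F : ℝ × Space n → Val N), StronglyMeasurable F →
      (∀ z, F z ≠ 0 → z.1 < 2 * (n + 1) * 2 ^ P.1 ∧ z.2 ∈ cube P) →
      ∫⁻ x, coneSq (image κ F) x ^ (1 / 2 : ℝ) ≤
        c * W * volume (cube P) ^ (1 / 2 : ℝ) * energy F ^ (1 / 2 : ℝ) := by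
  have hM0 : 0 < M := lt_of_le_of_lt (by positivity) hM
  set b := volume (Metric.ball (0 : Space n) 1) with hbdef
  have hbt : b ≠ ⊤ := volume_unitBall_ne_top
  -- on the `k`-th annulus, of radius about `2 ^ k` side lengths, `v k` is the square root of the
  -- relative volume and `a k` the decay of the square root of the energy
  set a : ℕ → ℝ≥0∞ := fun k => ENNReal.ofReal (2 ^ M * ((1 / 2) ^ M) ^ k) with hadef
  set v : ℕ → ℝ≥0∞ := fun k => (ENNReal.ofReal ((8 * (n + 1) * 2 ^ k) ^ n) * b) ^ (1 / 2 : ℝ)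
    with hvdef
  set S : ℝ≥0∞ := ∑' k, v k * a k with hSdef
  have hS : S ≠ ⊤ := by
    set r : ℝ := (2 : ℝ) ^ ((n : ℝ) / 2) * (1 / 2) ^ M with hr
    have hr0 : 0 < r := by positivity
    have hr1 : r < 1 := by
      rw [hr, one_div, Real.inv_rpow (by norm_num), ← Real.rpow_neg (by norm_num),
        ← Real.rpow_add (by norm_num)]
      exact Real.rpow_lt_one_of_one_lt_of_neg (by norm_num) (by linarith)
    have hv : ∀ k, v k * a k = ((ENNReal.ofReal ((8 * (n + 1)) ^ n) * b) ^ (1 / 2 : ℝ) *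
        ENNReal.ofReal (2 ^ M)) * ENNReal.ofReal r ^ k := by
      intro k
      have h1 : ENNReal.ofReal ((8 * (n + 1) * 2 ^ k) ^ n) ^ (1 / 2 : ℝ) =
          ENNReal.ofReal ((8 * (n + 1)) ^ n) ^ (1 / 2 : ℝ) *
            ENNReal.ofReal (2 ^ ((n : ℝ) / 2)) ^ k := by
        rw [ENNReal.ofReal_rpow_of_nonneg (by positivity) (by norm_num),
          ENNReal.ofReal_rpow_of_nonneg (by positivity) (by norm_num),
          ← ENNReal.ofReal_pow (by positivity), ← ENNReal.ofReal_mul (by positivity)]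
        congr 1
        rw [mul_pow, Real.mul_rpow (by positivity) (by positivity)]
        congr 1
        rw [← Real.rpow_natCast (2 ^ k : ℝ) n, ← Real.rpow_natCast (2 : ℝ) k, ← Real.rpow_mul
          (by norm_num), ← Real.rpow_mul (by norm_num), ← Real.rpow_natCast _ k, ← Real.rpow_mul
          (by norm_num)]
        congr 1
        ring
      simp only [hvdef, hadef]
      rw [ENNReal.mul_rpow_of_nonneg _ _ (by norm_num), h1,
        ENNReal.mul_rpow_of_nonneg _ _ (by norm_num), ENNReal.ofReal_mul (by positivity),
        ENNReal.ofReal_pow (p := ((1 : ℝ) / 2) ^ M) (by positivity), hr,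
        ENNReal.ofReal_mul (p := 2 ^ ((n : ℝ) / 2)) (by positivity),
        mul_pow (ENNReal.ofReal (2 ^ ((n : ℝ) / 2)))]
      ac_rfl
    simp only [hSdef, hv]
    rw [ENNReal.tsum_mul_left, ENNReal.tsum_geometric]
    refine ENNReal.mul_ne_top (ENNReal.mul_ne_top ?_ (by simp)) ?_
    · exact ENNReal.rpow_ne_top_of_nonneg (by norm_num) (by finiteness)
    · rw [ENNReal.inv_ne_top]
      exact (tsub_pos_iff_lt.mpr (ENNReal.ofReal_lt_one.mpr hr1)).ne'
  set C := S * (b ^ (1 / 2 : ℝ) * ENNReal.ofReal (2 / ε)) with hC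
  have hCt : C ≠ ⊤ := ENNReal.mul_ne_top hS (ENNReal.mul_ne_top
    (ENNReal.rpow_ne_top_of_nonneg (by norm_num) hbt) (by simp))
  refine ⟨C.toNNReal, fun W κ h hκ P F hF hsupp => ?_⟩
  rw [ENNReal.coe_toNNReal hCt]
  obtain ⟨x₀, hx₀⟩ : (cube P).Nonempty := nonempty_of_measure_ne_zero (volume_cube_ne_zero P)
  set ℓ : ℝ := 2 ^ P.1 with hℓ
  have hℓ0 : 0 < ℓ := by positivity
  set ρ : ℕ → ℝ := fun k => 4 * (n + 1) * 2 ^ k * ℓ with hρ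
  have hρ0 : ∀ k, 0 < ρ k := fun k => by positivity
  set D : ℕ → Set (ℝ × Space n) := fun k => Ioo 0 (ρ k) ×ˢ Metric.ball x₀ (ρ k) with hD
  have hDm : ∀ k, MeasurableSet (D k) := fun k => measurableSet_Ioo.prod measurableSet_ball
  set U : ℕ → Set (ℝ × Space n) := fun k => D k \ ⋃ j < k, D j with hUdef
  have hUm : ∀ k, MeasurableSet (U k) := fun k =>
    (hDm k).diff (MeasurableSet.biUnion (to_countable _) fun j _ => hDm j)
  have hcov : ∀ z ∈ halfSpace n, image κ F z ≠ 0 → ∃ k, z ∈ U k := by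
    classical
    intro z hz _
    have hz0 : 0 < z.1 := hz.1
    have hex : ∃ k, z ∈ D k := by
      have ht : Filter.Tendsto ρ Filter.atTop Filter.atTop :=
        ((tendsto_pow_atTop_atTop_of_one_lt (by norm_num : (1 : ℝ) < 2)).const_mul_atTop
          (by positivity)).atTop_mul_const hℓ0
      obtain ⟨k, hk⟩ := (ht.eventually_gt_atTop (max z.1 (dist z.2 x₀))).exists
      exact ⟨k, ⟨hz0, (le_max_left _ _).trans_lt hk⟩, (le_max_right _ _).trans_lt hk⟩
    refine ⟨Nat.find hex, Nat.find_spec hex, fun h' => ?_⟩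
    simp only [mem_iUnion] at h'
    obtain ⟨j, hj, hj'⟩ := h'
    exact Nat.find_min hex hj hj'
  have hen : ∀ k, energy ((U k).indicator (image κ F)) ≤
      (W * a k * ENNReal.ofReal (2 / ε)) ^ 2 * energy F := by
    intro k
    rcases k with _ | k
    · refine (energy_indicator_image_le hκ hF (hUm 0) hε (W := W) fun t s ht hs => ?_).trans ?_
      · refine (eLpNorm_indicator_le _).trans ?_
        rw [← Lp.enorm_def]
        exact h.le t s ht hs _
      · gcongr
        refine le_mul_of_one_le_right' ?_
        simp only [hadef, pow_zero, mul_one, ENNReal.one_le_ofReal]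
        exact Real.one_le_rpow (by norm_num) hM0.le
    · refine (h.energy_annulus_le hκ hε hF hsupp (ρ := ρ k / 2) (by have := hρ0 k; positivity)
        (hUm (k + 1)) fun t x hx => ?_).trans ?_
      · by_cases htρ : ρ k ≤ t
        · exact Or.inl (by linarith [hρ0 k])
        · refine Or.inr fun y hy => ?_
          push Not at htρ
          have hnot : (t, x) ∉ D k := fun h' => hx.2 (mem_biUnion (Nat.lt_succ_self k) h')
          have hd : ρ k ≤ dist x x₀ := by
            by_contra! h'
            exact hnot ⟨⟨hx.1.1.1, htρ⟩, h'⟩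
          have h2 := dist_le_of_mem_cube hy hx₀
          have h3 := dist_triangle x y x₀
          have h4 : n * ℓ ≤ ρ k / 2 := by
            simp only [hρ]
            have : (1 : ℝ) ≤ 2 ^ k := one_le_pow₀ (by norm_num)
            have h5 : n * ℓ ≤ 2 * (n + 1) * 1 * ℓ := by nlinarith
            have h6 : 2 * ((n : ℝ) + 1) * 1 * ℓ ≤ 2 * (n + 1) * 2 ^ k * ℓ := by gcongr
            linarith
          linarith
      · have hak : (ℓ / (ρ k / 2)) ^ M ≤ 2 ^ M * ((1 / 2) ^ M) ^ (k + 1) := by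
          have h1 : (2 : ℝ) ^ M * ((1 / 2) ^ M) ^ (k + 1) = ((1 / 2) ^ k) ^ M := by
            rw [pow_succ', ← mul_assoc, ← Real.mul_rpow (by norm_num) (by norm_num),
              ← Real.rpow_natCast (((1 : ℝ) / 2) ^ M), ← Real.rpow_natCast ((1 : ℝ) / 2),
              ← Real.rpow_mul (by norm_num), ← Real.rpow_mul (by norm_num), mul_comm M]
            norm_num
          rw [h1]
          refine Real.rpow_le_rpow (by have := hρ0 k; positivity) ?_ hM0.le
          simp only [hρ]
          rw [one_div, inv_pow, div_le_iff₀ (by positivity)]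
          field_simp
          nlinarith [n.cast_nonneg (α := ℝ)]
        gcongr
        exact ENNReal.ofReal_le_ofReal hak
  have hterm : ∀ k, ∫⁻ x, coneSq ((U k).indicator (image κ F)) x ^ (1 / 2 : ℝ) ≤
      v k * a k * (b ^ (1 / 2 : ℝ) * ENNReal.ofReal (2 / ε) * W * volume (cube P) ^ (1 / 2 : ℝ) *
        energy F ^ (1 / 2 : ℝ)) := by
    intro k
    refine (lintegral_coneSq_rpow_le_of_support ((stronglyMeasurable_image κ F).indicator (hUm k))
      (x₀ := x₀) (ρ := ρ k) (fun z hz => ?_) (by norm_num) (by norm_num)).trans ?_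
    · have hzU : z ∈ U k := by
        by_contra h'
        exact hz (indicator_of_notMem h' _)
      exact ⟨hzU.1.1.2, hzU.1.2⟩
    · rw [show 2 * ρ k = (8 * (n + 1) * 2 ^ k) * 2 ^ P.1 by simp only [hρ]; ring,
        volume_ball_zpow x₀ P.1 (by positivity), ← volume_cube,
        show (1 : ℝ) - 1 / 2 = 1 / 2 by norm_num, ENNReal.mul_rpow_of_nonneg _ _ (by norm_num)]
      calc v k * volume (cube P) ^ (1 / 2 : ℝ) *
            (b * energy ((U k).indicator (image κ F))) ^ (1 / 2 : ℝ)
          ≤ v k * volume (cube P) ^ (1 / 2 : ℝ) *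
            (b * ((W * a k * ENNReal.ofReal (2 / ε)) ^ 2 * energy F)) ^ (1 / 2 : ℝ) :=
            mul_le_mul_right (ENNReal.rpow_le_rpow (mul_le_mul_right (hen k) _) (by norm_num)) _
        _ = _ := by
            rw [ENNReal.mul_rpow_of_nonneg _ _ (by norm_num),
              ENNReal.mul_rpow_of_nonneg _ _ (by norm_num), rpow_half_sq]
            ring
  refine (lintegral_coneSq_rpow_half_le_tsum (stronglyMeasurable_image κ F) hUm hcov).trans ?_
  refine (ENNReal.tsum_le_tsum hterm).trans (le_of_eq ?_)
  rw [ENNReal.tsum_mul_right, ← hSdef, hC]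
  ring

/-! ### Bounds on functions of compact support -/

lemma IsNice.exists_eLpNorm_slice_le {F : ℝ × Space n → Val N} (hF : IsNice F) :
    ∃ a b : ℝ, ∃ D : ℝ≥0, 0 < a ∧ a < b ∧ ∀ s, eLpNorm (fun y => F (s, y)) 2 volume ≤
      (Icc a b).indicator (fun _ => (D : ℝ≥0∞)) s := by
  obtain ⟨a, b, R, ha, hab, _, hs⟩ := hF.supp
  obtain ⟨C, hC⟩ := hF.bdd
  set D := (ENNReal.ofReal C ^ 2 * volume (Metric.closedBall (0 : Space n) R)) ^ (1 / 2 : ℝ)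
  have hD : D ≠ ⊤ := ENNReal.rpow_ne_top_of_nonneg (by norm_num)
    (ENNReal.mul_ne_top (by finiteness) measure_closedBall_lt_top.ne)
  refine ⟨a, b, D.toNNReal, ha, hab, fun s => ?_⟩
  rw [ENNReal.coe_toNNReal hD]
  by_cases h : s ∈ Icc a b
  · rw [indicator_of_mem h, eLpNorm_two_eq]
    refine ENNReal.rpow_le_rpow ?_ (by norm_num)
    rw [← lintegral_indicator_const measurableSet_closedBall]
    refine lintegral_mono fun y => ?_
    by_cases hz : F (s, y) = 0
    · simp [hz]
    · rw [indicator_of_mem (hs _ hz).2]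
      gcongr
      rw [← ofReal_norm]
      exact ENNReal.ofReal_le_ofReal (hC _)
  · rw [indicator_of_notMem h]
    have h0 : (fun y => F (s, y)) = 0 := by
      ext1 y
      by_contra hz
      exact h (hs _ hz).1
    simp [h0]

lemma dlog_Icc_lt_top {a b : ℝ} (ha : 0 < a) : dlog (Icc a b) < ⊤ := by
  have h1 : dlog (Icc a b) = ∫⁻ s, (Icc a b).indicator 1 s ∂dlog :=
    (lintegral_indicator_one measurableSet_Icc).symm
  rw [h1, lintegral_dlog]
  calc ∫⁻ s in Ioi 0, ENNReal.ofReal s⁻¹ * (Icc a b).indicator 1 s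
      ≤ ∫⁻ s, (Icc a b).indicator (fun _ => ENNReal.ofReal a⁻¹) s := by
        refine (setLIntegral_le_lintegral _ _).trans (lintegral_mono fun s => ?_)
        by_cases h : s ∈ Icc a b
        · rw [indicator_of_mem h, indicator_of_mem h, Pi.one_apply, mul_one]
          exact ENNReal.ofReal_le_ofReal (inv_anti₀ ha h.1)
        · rw [indicator_of_notMem h, indicator_of_notMem h, mul_zero]
    _ = ENNReal.ofReal a⁻¹ * volume (Icc a b) := lintegral_indicator_const measurableSet_Icc _
    _ < ⊤ := ENNReal.mul_lt_top (by simp) measure_Icc_lt_top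

lemma IsNice.admissible {F : ℝ × Space n → Val N} (hF : IsNice F) {p σ : ℝ} {w : ℝ → ℝ → ℝ≥0∞}
    {c : ℝ≥0} (hw : ∀ t s, w t s ≤ c) : Admissible p σ w F := by
  obtain ⟨a, b, D, ha, hab, hD⟩ := hF.exists_eLpNorm_slice_le
  refine ⟨Filter.Eventually.of_forall hF.memLp_slice, Filter.Eventually.of_forall fun t => ?_⟩
  calc ∫⁻ s, w t s * scaledNorm p σ t s (fun y => F (s, y)) ∂dlog
      ≤ ∫⁻ s, c * (Icc a b).indicator (fun _ => (D : ℝ≥0∞)) s ∂dlog := by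
        refine lintegral_mono fun s => mul_le_mul' (hw t s) ?_
        exact (min_le_left _ _).trans (hD s)
    _ = c * (D * dlog (Icc a b)) := by
        rw [lintegral_const_mul' _ _ (by simp), lintegral_indicator_const measurableSet_Icc]
    _ < ⊤ := ENNReal.mul_lt_top (by simp) (ENNReal.mul_lt_top (by simp) (dlog_Icc_lt_top ha))

lemma op_restr_univ (κ : OpKernel n N) (F : ℝ × Space n → Val N) :
    op κ (restr univ F) = op κ F := by
  ext1 t
  refine setIntegral_congr_fun measurableSet_Ioi fun s hs => ?_
  have h : (fun y => restr univ F (s, y)) = fun y => F (s, y) := by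
    ext1 y
    exact indicator_of_mem (show (s, y) ∈ halfSpace n ∩ tileOf ⁻¹' univ from
      ⟨⟨hs, mem_univ _⟩, mem_univ _⟩) F
  have : slice (restr univ F) s = slice F s := slice_congr (by rw [h])
  simp only [this]

lemma image_restr_univ (κ : OpKernel n N) (F : ℝ × Space n → Val N) :
    image κ (restr univ F) = image κ F := by
  rw [image, image, op_restr_univ]

lemma jointRep_zero : jointRep (0 : ℝ → L2 n N) =ᵐ[volume.restrict (halfSpace n)] 0 := by
  refine ae_halfSpace_of_ae_ae ((stronglyMeasurable_jointRep _).measurableSet_eq_fun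
    stronglyMeasurable_zero) ?_
  filter_upwards [jointRep_ae (n := n) (N := N) (g := 0) aestronglyMeasurable_zero] with t ht
  filter_upwards [ht, Lp.coeFn_zero (Val N) 2 (volume : Measure (Space n))] with y h1 h2
  rw [h1, Pi.zero_apply, h2]
  rfl

lemma image_zero (κ : OpKernel n N) :
    image κ 0 =ᵐ[volume.restrict (halfSpace n)] 0 := by
  have h0 : op κ (0 : ℝ × Space n → Val N) = 0 := by
    ext1 t
    have h1 : ∀ s, slice (0 : ℝ × Space n → Val N) s = 0 := fun s => by
      rw [slice_of_memLp (F := 0) (s := s) (MemLp.zero' (p := 2) (μ := volume))]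
      exact MemLp.toLp_zero _
    simp [op, h1]
  rw [image, h0]
  exact jointRep_zero

section Nice

variable {p σ : ℝ} {w : ℝ → ℝ → ℝ≥0∞} {c : ℝ≥0} {κ : OpKernel n N}

lemma coneSq_image_add_le (hκ : Dominated p σ w κ) (hw : ∀ t s, w t s ≤ c)
    {F G : ℝ × Space n → Val N} (hF : IsNice F) (hG : IsNice G) (x : Space n) :
    coneSq (image κ (F + G)) x ^ (1 / 2 : ℝ) ≤
      coneSq (image κ F) x ^ (1 / 2 : ℝ) + coneSq (image κ G) x ^ (1 / 2 : ℝ) := by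
  rw [coneSq_congr_ae (image_add_ae hκ hF.meas hG.meas (hF.admissible hw) (hG.admissible hw))]
  exact coneSq_add_rpow_half_le (stronglyMeasurable_image _ _) (stronglyMeasurable_image _ _) x

lemma coneSq_image_le_restr (hκ : Dominated p σ w κ) (hw : ∀ t s, w t s ≤ c)
    {F : ℝ × Space n → Val N} (hF : IsNice F) (T : Set (Tile n)) (x : Space n) :
    coneSq (image κ F) x ^ (1 / 2 : ℝ) ≤
      coneSq (image κ (restr T F)) x ^ (1 / 2 : ℝ) +
        coneSq (image κ (restr Tᶜ F)) x ^ (1 / 2 : ℝ) := by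
  rw [← image_restr_univ, ← restr_add_restr_compl T F]
  exact coneSq_image_add_le hκ hw (hF.restr T) (hF.restr Tᶜ) x

open Filter Topology in
/-- Countable subadditivity over partitions of the tiles. -/
lemma lintegral_coneSq_image_le_tsum (hp : 0 < p) (hκ : Dominated p σ w κ)
    (hwm : ∀ t, Measurable (w t)) (hw : ∀ t s, w t s ≤ c)
    {F : ℝ × Space n → Val N} (hF : IsNice F) (f : Tile n → ℕ) :
    ∫⁻ x, coneSq (image κ F) x ^ (1 / 2 : ℝ) ≤
      ∑' k, ∫⁻ x, coneSq (image κ (restr (f ⁻¹' {k}) F)) x ^ (1 / 2 : ℝ) := by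
  set N' : Set (Tile n) → ℝ≥0∞ := fun T => ∫⁻ x, coneSq (image κ (restr T F)) x ^ (1 / 2 : ℝ)
  have hfin : ∀ k, N' (f ⁻¹' Iio k) ≤ ∑ j ∈ Finset.range k, N' (f ⁻¹' {j}) := by
    intro k
    induction k with
    | zero =>
      have h0 : restr (f ⁻¹' Iio 0) F = 0 := by
        funext z
        simp [restr]
      simp only [N', h0, coneSq_congr_ae (image_zero κ)]
      simp [coneSq]
    | succ k ih =>
      rw [Finset.sum_range_succ]
      refine le_trans ?_ (add_le_add ih le_rfl)
      have hadd : restr (f ⁻¹' Iio (k + 1)) F =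
          restr (f ⁻¹' Iio k) F + restr (f ⁻¹' {k}) F := by
        funext z
        simp only [restr, Pi.add_apply, indicator, mem_inter_iff, mem_preimage, mem_Iio,
          mem_singleton_iff]
        by_cases hz : z ∈ halfSpace n
        · rcases lt_trichotomy (f (tileOf z)) k with h | h | h
          · simp [hz, h, h.ne, h.trans (Nat.lt_succ_self k)]
          · simp [hz, h]
          · simp [hz, h.ne', not_lt.mpr h.le, show ¬ f (tileOf z) < k + 1 by omega]
        · simp [hz]
      simp only [N']
      rw [hadd, ← lintegral_add_left ((measurable_coneSq (stronglyMeasurable_image _ _)).pow_const _)]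
      exact lintegral_mono fun x => coneSq_image_add_le hκ hw (hF.restr _) (hF.restr _) x
  have hlim := tendsto_op hp hwm (fun t s => ((hw t s).trans_lt (by simp)).ne) (fun _ => hκ)
    hF.meas (Fs := fun k => restr (f ⁻¹' Iio k) F) (fun k => (hF.restr _).meas)
    (fun k z => norm_indicator_le_norm_self F z) (fun z hz => by
      refine tendsto_const_nhds.congr' ?_
      filter_upwards [eventually_gt_atTop (f (tileOf z))] with k hk
      exact (indicator_of_mem (show z ∈ halfSpace n ∩ tileOf ⁻¹' (f ⁻¹' Iio k) from ⟨hz, hk⟩) F).symm)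
    (fun t s _ _ u => tendsto_const_nhds) (hF.admissible hw)
  refine lintegral_coneSq_image_le_of_tendsto hκ.meas (fun _ => hκ.meas) hF.meas
    (fun k => (hF.restr _).meas) hlim (by norm_num) fun k => ?_
  exact (hfin k).trans (ENNReal.sum_le_tsum _)

/-- Kernels with off-diagonal decay of order more than `n/2` are bounded for the `T^{1,2}` norm. The
constant depends linearly on the size `W` of the kernel, and not on the weight `w` and its bound `c`,
which only serve to make the integrals converge. -/
theorem exists_lintegral_coneSq_image_rpow_half_le (hn : 0 < n) (N : ℕ) {ε M : ℝ} (hε : 0 < ε)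
    (hM : (n : ℝ) / 2 < M) :
    ∃ C : ℝ≥0, ∀ (W : ℝ≥0∞) (p σ : ℝ) (w : ℝ → ℝ → ℝ≥0∞) (c : ℝ≥0) (κ : OpKernel n N), 0 < p →
      LocalBound ε M W κ → Dominated p σ w κ → (∀ t, Measurable (w t)) → (∀ t s, w t s ≤ c) →
      ∀ F : ℝ × Space n → Val N, IsNice F →
      ∫⁻ x, coneSq (image κ F) x ^ (1 / 2 : ℝ) ≤ C * W * ∫⁻ x, coneSq F x ^ (1 / 2 : ℝ) := by
  obtain ⟨C₀, hC₀⟩ := exists_lintegral_coneSq_image_le_of_support (n := n) (N := N) hε hM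
  set C := 12 * C₀ * ENNReal.ofReal ((2 * (n + 1)) ^ n) ^ (1 / 2 : ℝ) with hC
  have hCt : C ≠ ⊤ := ENNReal.mul_ne_top (by finiteness)
    (ENNReal.rpow_ne_top_of_nonneg (by norm_num) (by simp))
  refine ⟨C.toNNReal, fun W p σ w c κ hp hloc hκ hwm hw F hF => ?_⟩
  rw [ENNReal.coe_toNNReal hCt]
  have hdsf := lintegral_dsf_rpow_le hF.meas (q := 1) one_pos
  simp only [ENNReal.rpow_one] at hdsf
  have hfin : ∫⁻ x, dsf (tileEnergy F) x ≠ ⊤ := by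
    refine (hdsf.trans_lt (ENNReal.mul_lt_top ?_ ?_)).ne
    · exact ENNReal.rpow_lt_top_of_nonneg (by norm_num) (by simp)
    · exact (tentNorm_lt_top_iff one_pos).mp (hF.tentNorm_lt_top ⟨le_rfl, one_le_two⟩)
  have key := le_lintegral_dsf_of_atoms hn (tileEnergy F)
    (fun T => ∫⁻ x, coneSq (image κ (restr T F)) x ^ (1 / 2 : ℝ)) (C₀ * W) ?_ ?_ hfin
  · simp only [image_restr_univ] at key
    refine key.trans ((mul_le_mul_right hdsf _).trans (le_of_eq ?_))
    rw [hC]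
    ring
  · intro f
    obtain ⟨e⟩ : Nonempty ((ℤ × Tile n) ≃ ℕ) := nonempty_equiv_of_countable
    simp only [image_restr_univ]
    refine (lintegral_coneSq_image_le_tsum hp hκ hwm hw hF (fun τ => e (f τ))).trans (le_of_eq ?_)
    rw [← e.tsum_eq]
    refine tsum_congr fun i => ?_
    have : (fun τ => e (f τ)) ⁻¹' {e i} = f ⁻¹' {i} := by
      ext τ
      simp
    rw [this]
  · intro P T hT
    rw [← energy_restr]
    exact hC₀ W κ hloc hκ.meas P (restr T F) (hF.restr T).meas fun z hz =>
      (mem_of_restr_ne_zero hn hT hz).2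

lemma LocalBound.lintegral_coneSq_image_le {ε M : ℝ} {W : ℝ≥0∞} (h : LocalBound ε M W κ)
    (hκ : StronglyMeas κ) (hε : 0 < ε) {F : ℝ × Space n → Val N} (hF : StronglyMeasurable F) :
    ∫⁻ x, coneSq (image κ F) x ≤ (W * ENNReal.ofReal (2 / ε)) ^ 2 * ∫⁻ x, coneSq F x := by
  rw [lintegral_coneSq (stronglyMeasurable_image _ _), lintegral_coneSq hF, mul_left_comm]
  exact mul_le_mul_right (h.energy_image_le hκ hε hF) _

/-- Interpolation between `T^{1,2}` and `T^{r,2}`; `δ` is at our disposal to balance the two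
bounds. -/
theorem exists_lintegral_coneSq_image_interpolation (hn : 0 < n) (N : ℕ) {q r : ℝ} (hq : 1 < q)
    (hqr : q < r) (hr : r ≤ 2) :
    ∃ C : ℝ≥0, ∀ (p σ : ℝ) (w : ℝ → ℝ → ℝ≥0∞) (c : ℝ≥0) (κ : OpKernel n N) (C₁ C₂ : ℝ≥0∞),
      Dominated p σ w κ → (∀ t s, w t s ≤ c) →
      (∀ F : ℝ × Space n → Val N, IsNice F →
        ∫⁻ x, coneSq (image κ F) x ^ (1 / 2 : ℝ) ≤ C₁ * ∫⁻ x, coneSq F x ^ (1 / 2 : ℝ)) →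
      (∀ F : ℝ × Space n → Val N, IsNice F →
        ∫⁻ x, coneSq (image κ F) x ^ (r / 2) ≤ C₂ * ∫⁻ x, coneSq F x ^ (r / 2)) →
      ∀ δ : ℝ, 0 < δ → ∀ F : ℝ × Space n → Val N, IsNice F →
        ENNReal.ofReal δ ^ q * ∫⁻ x, coneSq (image κ F) x ^ (q / 2) ≤
          C * (ENNReal.ofReal δ * C₁ + ENNReal.ofReal δ ^ r * C₂) *
            ∫⁻ x, coneSq F x ^ (q / 2) := by
  obtain ⟨c₀, hc₀⟩ := exists_interpolation_const hn hq hqr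
  obtain ⟨A₁, hA₁⟩ := exists_lintegral_coneSq_rpow_le (n := n) (N := N) hn (q := 1)
    ⟨le_rfl, one_le_two⟩
  obtain ⟨A₂, hA₂⟩ := exists_lintegral_coneSq_rpow_le (n := n) (N := N) hn (q := r)
    ⟨by linarith, hr⟩
  have hq0 : 0 < q := by linarith
  have hr0 : 0 < r := by linarith
  set B := ENNReal.ofReal ((2 * (n + 1)) ^ n) ^ (q / 2) with hB
  have hBt : B ≠ ⊤ := ENNReal.rpow_ne_top_of_nonneg (by positivity) (by simp)
  set C := c₀ * (A₁ + A₂) * B with hC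
  have hCt : C ≠ ⊤ := ENNReal.mul_ne_top (by finiteness) hBt
  refine ⟨C.toNNReal, fun p σ w c κ C₁ C₂ hκ hw h1 h2 δ hδ F hF => ?_⟩
  rw [ENNReal.coe_toNNReal hCt]
  set d := ENNReal.ofReal δ with hd
  have hmeas : ∀ F : ℝ × Space n → Val N, Measurable fun x => coneSq (image κ F) x ^ (1 / 2 : ℝ) :=
    fun F => (measurable_coneSq (stronglyMeasurable_image _ _)).pow_const _
  have hdsf := lintegral_dsf_rpow_le hF.meas hq0
  -- interpolate `δ T_κ` in place of `T_κ`
  have key := hc₀ (tileEnergy F) (d * C₁ * A₁) (d ^ r * C₂ * A₂)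
    (fun x => d * coneSq (image κ F) x ^ (1 / 2 : ℝ))
    (fun T x => d * coneSq (image κ (restr T F)) x ^ (1 / 2 : ℝ))
    ((hmeas F).const_mul _) (fun T => (hmeas _).const_mul _)
    (fun T => Filter.Eventually.of_forall fun x => by
      rw [← mul_add]
      exact mul_le_mul_right (coneSq_image_le_restr hκ hw hF T x) _)
    (fun T => by
      rw [lintegral_const_mul _ (hmeas _), mul_assoc, mul_assoc]
      refine mul_le_mul_right ((h1 _ (hF.restr T)).trans (mul_le_mul_right ?_ _)) _
      have := hA₁ _ (hF.restr T).meas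
      simp only [ENNReal.rpow_one, tileEnergy_restr] at this
      exact this)
    (fun T => by
      simp only [ENNReal.mul_rpow_of_nonneg _ _ hr0.le, rpow_half_rpow]
      rw [lintegral_const_mul _ ((measurable_coneSq (stronglyMeasurable_image _ _)).pow_const _),
        mul_assoc, mul_assoc]
      refine mul_le_mul_right ((h2 _ (hF.restr T)).trans (mul_le_mul_right ?_ _)) _
      have := hA₂ _ (hF.restr T).meas
      rwa [tileEnergy_restr] at this)
    (hdsf.trans_lt (ENNReal.mul_lt_top hBt.lt_top ((tentNorm_lt_top_iff hq0).mp
      (hF.tentNorm_lt_top ⟨hq.le, hqr.le.trans hr⟩)))).ne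
  simp only [ENNReal.mul_rpow_of_nonneg _ _ hq0.le, rpow_half_rpow] at key
  rw [lintegral_const_mul _ ((measurable_coneSq (stronglyMeasurable_image _ _)).pow_const _)] at key
  refine key.trans ?_
  calc c₀ * (d * C₁ * A₁ + d ^ r * C₂ * A₂) * ∫⁻ x, dsf (tileEnergy F) x ^ q
      ≤ c₀ * (d * C₁ * (A₁ + A₂) + d ^ r * C₂ * (A₁ + A₂)) *
          (B * ∫⁻ x, coneSq F x ^ (q / 2)) := by
        gcongr
        · exact le_self_add
        · exact le_add_self
    _ = C * (d * C₁ + d ^ r * C₂) * ∫⁻ x, coneSq F x ^ (q / 2) := by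
        rw [hC]; ring

end Nice

/-! ### Scalar multiples of a kernel with off-diagonal bounds -/

/-- The kernel `m(t,s) K(t,s)`. -/
def mulK (m : ℝ → ℝ → ℂ) (K : OpKernel n N) : OpKernel n N := fun t s => m t s • K t s

lemma StronglyMeas.mulK {K : OpKernel n N} (hK : StronglyMeas K) {m : ℝ → ℝ → ℂ}
    (hm : Measurable (Function.uncurry m)) : StronglyMeas (mulK m K) := fun u => by
  have h1 : AEStronglyMeasurable (fun z : ℝ × ℝ => m z.1 z.2)
      (volume.restrict (Ioi (0 : ℝ) ×ˢ Ioi (0 : ℝ))) := hm.aestronglyMeasurable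
  exact h1.smul (hK u)

/-- The weight that controls `m K` when `|m| ≤ D`. The minimum with `D` makes it bounded also where
`t` or `s` is negative. -/
def mulWeight (B D : ℝ≥0) (m : ℝ → ℝ → ℂ) (t s : ℝ) : ℝ≥0∞ := B * min ‖m t s‖ₑ D

lemma measurable_mulWeight (B D : ℝ≥0) {m : ℝ → ℝ → ℂ} (hm : Measurable (Function.uncurry m))
    (t : ℝ) : Measurable (mulWeight B D m t) := by
  have h1 : Measurable fun s => m t s := hm.comp measurable_prodMk_left
  exact (h1.enorm.min measurable_const).const_mul _

lemma mulWeight_le (B D : ℝ≥0) (m : ℝ → ℝ → ℂ) (t s : ℝ) : mulWeight B D m t s ≤ (B * D : ℝ≥0) := by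
  rw [ENNReal.coe_mul]
  exact mul_le_mul_right (min_le_right _ _) _

/-- The two consequences of uniform boundedness and of the off-diagonal bounds that are used:
boundedness `L² → L²` and (rescaled) `L^p → L²`, and decay away from dyadic cubes. -/
structure KernelBound (p σ M : ℝ) (B : ℝ≥0) (K : OpKernel n N) : Prop where
  meas : StronglyMeas K
  le : ∀ t s, 0 < t → 0 < s → ∀ u : L2 n N, ‖K t s u‖ₑ ≤ B * scaledNorm p σ t s u
  off_le : ∀ (P : Tile n) (A : Set (Space n)), MeasurableSet A → ∀ t s d, 0 < t → 0 < s → 0 ≤ d →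
    (∀ x ∈ A, ∀ y ∈ cube P, d ≤ dist x y) → ∀ u : L2 n N, (∀ᵐ y, y ∉ cube P → u y = 0) →
    eLpNorm (A.indicator (K t s u)) 2 volume ≤
      B * ENNReal.ofReal (((2 : ℝ) ^ P.1 / max t s) ^ σ * (1 + d / max t s) ^ (-M)) * ‖u‖ₑ

lemma setDist_nonneg (A B : Set (Space n)) : 0 ≤ setDist A B :=
  Real.iInf_nonneg fun _ => dist_nonneg

/-- Hölder's inequality on a cube. -/
lemma eLpNorm_le_of_cube {p : ℝ} (hp : p ∈ Icc (1 : ℝ) 2) {P : Tile n} {u : L2 n N}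
    (hu : ∀ᵐ y, y ∉ cube P → u y = 0) :
    eLpNorm u (ENNReal.ofReal p) volume ≤
      ENNReal.ofReal (((2 : ℝ) ^ P.1) ^ ((n : ℝ) * (1 / p - 1 / 2))) * ‖u‖ₑ := by
  have hp0 : 0 < p := by linarith [hp.1]
  have hind : (cube P).indicator u =ᵐ[volume] u := by
    filter_upwards [hu] with y hy
    by_cases h : y ∈ cube P
    · rw [indicator_of_mem h]
    · rw [indicator_of_notMem h, hy h]
  have h2 : (ENNReal.ofReal p).toReal = p := ENNReal.toReal_ofReal hp0.le
  have h1 := eLpNorm_le_eLpNorm_mul_rpow_measure_univ (μ := volume.restrict (cube P))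
    (p := ENNReal.ofReal p) (q := 2) (f := u)
    (by rw [← ENNReal.ofReal_ofNat 2]; exact ENNReal.ofReal_le_ofReal hp.2)
    (Lp.aestronglyMeasurable u).restrict
  rw [← eLpNorm_indicator_eq_eLpNorm_restrict (measurableSet_cube P),
    ← eLpNorm_indicator_eq_eLpNorm_restrict (measurableSet_cube P), eLpNorm_congr_ae hind,
    eLpNorm_congr_ae hind, Measure.restrict_apply_univ, volume_cube, h2, ← Lp.enorm_def] at h1
  refine h1.trans (le_of_eq ?_)
  rw [mul_comm, ENNReal.ofReal_rpow_of_pos (by positivity), ← Real.rpow_natCast, ← Real.rpow_mul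
    (by positivity)]
  simp

lemma exists_kernelBound {p M : ℝ} (hp : p ∈ Icc (1 : ℝ) 2) (hM : 0 ≤ M) {K : OpKernel n N}
    (hKmeas : StronglyMeas K) (hKbdd : UniformlyBounded K) (hKoff : OffDiagonal p M K) :
    ∃ B : ℝ≥0, KernelBound p ((n : ℝ) * (1 / p - 1 / 2)) M B K := by
  obtain ⟨B₀, hB₀⟩ := hKbdd
  obtain ⟨C, hC, hoff⟩ := hKoff
  have hp0 : 0 < p := by linarith [hp.1]
  set σ := (n : ℝ) * (1 / p - 1 / 2) with hσ
  have hBt : ENNReal.ofReal B₀ + ENNReal.ofReal C ≠ ⊤ := by finiteness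
  refine ⟨(ENNReal.ofReal B₀ + ENNReal.ofReal C).toNNReal, hKmeas, ?_, ?_⟩
  · intro t s ht hs u
    rw [ENNReal.coe_toNNReal hBt, scaledNorm, mul_min]
    refine le_min ?_ ?_
    · calc ‖K t s u‖ₑ ≤ ‖K t s‖ₑ * ‖u‖ₑ := (K t s).le_opENorm u
        _ ≤ (ENNReal.ofReal B₀ + ENNReal.ofReal C) * eLpNorm u 2 volume := by
          rw [← Lp.enorm_def]
          gcongr
          rw [← ofReal_norm]
          exact (ENNReal.ofReal_le_ofReal (hB₀ t s ht hs)).trans le_self_add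
    · have hmx : 0 < max t s := lt_max_of_lt_left ht
      by_cases hu : MemLp u (ENNReal.ofReal p) volume
      · have h1 := hoff univ univ MeasurableSet.univ MeasurableSet.univ t s ht hs u u hu
          (by rw [indicator_univ])
        rw [indicator_univ, ← Lp.enorm_def] at h1
        refine h1.trans ?_
        rw [← mul_assoc]
        gcongr
        calc ENNReal.ofReal (C * max t s ^ (-σ) *
              (1 + setDist (univ : Set (Space n)) univ / max t s) ^ (-M))
            ≤ ENNReal.ofReal (C * max t s ^ (-σ)) := by
              refine ENNReal.ofReal_le_ofReal (mul_le_of_le_one_right (by positivity) ?_)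
              refine Real.rpow_le_one_of_one_le_of_nonpos ?_ (by linarith)
              have := setDist_nonneg (univ : Set (Space n)) univ
              have : 0 ≤ setDist (univ : Set (Space n)) univ / max t s := by positivity
              linarith
          _ = ENNReal.ofReal C * ENNReal.ofReal (max t s ^ (-σ)) := ENNReal.ofReal_mul hC.le
          _ ≤ _ := mul_le_mul_left le_add_self _
      · have h1 : eLpNorm u (ENNReal.ofReal p) volume = ⊤ := by
          by_contra h
          exact hu ⟨Lp.aestronglyMeasurable u, lt_top_iff_ne_top.mpr h⟩
        have h2 : ENNReal.ofReal (max t s ^ (-σ)) ≠ 0 := by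
          have : 0 < max t s ^ (-σ) := by positivity
          simpa using this
        have h3 : ENNReal.ofReal B₀ + ENNReal.ofReal C ≠ 0 := by
          simp [hC]
        rw [h1, ENNReal.mul_top h2, ENNReal.mul_top h3]
        exact le_top
  · intro P A hA t s d ht hs hd hdist u hu
    rw [ENNReal.coe_toNNReal hBt]
    rcases A.eq_empty_or_nonempty with rfl | hne
    · simp
    have hPne : (cube P).Nonempty := nonempty_of_measure_ne_zero (volume_cube_ne_zero P)
    have hmx : 0 < max t s := lt_max_of_lt_left ht
    have hle := eLpNorm_le_of_cube hp hu
    have hmem : MemLp u (ENNReal.ofReal p) volume :=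
      ⟨Lp.aestronglyMeasurable u, hle.trans_lt (ENNReal.mul_lt_top (by simp) (by simp))⟩
    have h1 := hoff A (cube P) hA (measurableSet_cube P) t s ht hs u u hmem (by
      filter_upwards [hu] with y hy
      by_cases h : y ∈ cube P
      · rw [indicator_of_mem h]
      · rw [indicator_of_notMem h, hy h])
    have hsd : d ≤ setDist A (cube P) := by
      have : Nonempty (A × cube P) := ⟨⟨_, hne.some_mem⟩, ⟨_, hPne.some_mem⟩⟩
      exact le_ciInf fun z => hdist _ z.1.2 _ z.2.2
    refine h1.trans ((mul_le_mul' (ENNReal.ofReal_le_ofReal (q := C * (max t s ^ (-σ) *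
      (1 + d / max t s) ^ (-M))) ?_) hle).trans ?_)
    · rw [mul_assoc]
      refine mul_le_mul_of_nonneg_left (mul_le_mul_of_nonneg_left ?_ (by positivity)) hC.le
      exact Real.rpow_le_rpow_of_nonpos (by positivity) (by gcongr) (by linarith)
    · have h2 : C * (max t s ^ (-σ) * (1 + d / max t s) ^ (-M)) * ((2 : ℝ) ^ P.1) ^ σ =
          C * (((2 : ℝ) ^ P.1 / max t s) ^ σ * (1 + d / max t s) ^ (-M)) := by
        rw [Real.div_rpow (by positivity) hmx.le, Real.rpow_neg hmx.le σ]
        ring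
      rw [← mul_assoc, ← ENNReal.ofReal_mul (by positivity), h2, ENNReal.ofReal_mul hC.le]
      exact mul_le_mul_left (mul_le_mul_left le_add_self _) _

lemma KernelBound.dominated {p σ M : ℝ} {B : ℝ≥0} {K : OpKernel n N} (hK : KernelBound p σ M B K)
    {D : ℝ≥0} {m : ℝ → ℝ → ℂ} (hm : Measurable (Function.uncurry m))
    (hmD : ∀ t s, 0 < t → 0 < s → ‖m t s‖ ≤ D) :
    Dominated p σ (mulWeight B D m) (mulK m K) := by
  refine ⟨hK.meas.mulK hm, fun t s ht hs u => ?_⟩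
  have h1 : mulWeight B D m t s = B * ‖m t s‖ₑ := by
    rw [mulWeight, min_eq_left]
    rw [← ofReal_norm, ← ENNReal.ofReal_coe_nnreal]
    exact ENNReal.ofReal_le_ofReal (hmD t s ht hs)
  rw [h1, mulK, smul_apply, enorm_smul, mul_comm (B : ℝ≥0∞), mul_assoc]
  exact mul_le_mul_right (hK.le t s ht hs u) _

/-- A gain of `(s / max {t,s})^{M' - σ}` in the multiplier turns the off-diagonal decay at scale
`max {t,s}` into decay at the scale of the cube. -/
lemma KernelBound.localBound {p σ M : ℝ} {B : ℝ≥0} {K : OpKernel n N} (hK : KernelBound p σ M B K)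
    {D : ℝ≥0} {m : ℝ → ℝ → ℂ} {ε M' : ℝ} (hσ : 0 ≤ σ) (hσM : σ ≤ M') (hM' : M' ≤ M)
    (hm : ∀ t s, 0 < t → 0 < s →
      ‖m t s‖ ≤ D * min (t / s) (s / t) ^ ε * (s / max t s) ^ (M' - σ)) :
    LocalBound ε M' (B * D * ENNReal.ofReal ((2 * (n + 1)) ^ (M' - σ))) (mulK m K) := by
  have hc1 : (1 : ℝ) ≤ (2 * (n + 1)) ^ (M' - σ) :=
    Real.one_le_rpow (by linarith [n.cast_nonneg (α := ℝ)]) (by linarith)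
  refine ⟨fun t s ht hs u => ?_, fun P A hA t s ρ ht hs hsP hρ hcase u hu => ?_⟩
  · have h1 : ‖m t s‖ₑ ≤ D * schurKer ε t s := by
      rw [schurKer, ← ENNReal.ofReal_coe_nnreal, ← ENNReal.ofReal_mul (NNReal.coe_nonneg D), ← ofReal_norm]
      refine ENNReal.ofReal_le_ofReal ((hm t s ht hs).trans (mul_le_of_le_one_right ?_ ?_))
      · positivity
      · refine Real.rpow_le_one (by positivity) ?_ (by linarith)
        exact (div_le_one (lt_max_of_lt_left ht)).mpr (le_max_right _ _)
    have h2 : ‖K t s u‖ₑ ≤ B * ‖u‖ₑ := by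
      refine (hK.le t s ht hs u).trans (mul_le_mul_right ?_ _)
      rw [Lp.enorm_def]
      exact min_le_left _ _
    rw [mulK, smul_apply, enorm_smul]
    calc ‖m t s‖ₑ * ‖K t s u‖ₑ ≤ (D * schurKer ε t s) * (B * ‖u‖ₑ) := mul_le_mul' h1 h2
      _ = B * D * 1 * schurKer ε t s * ‖u‖ₑ := by ring
      _ ≤ _ := by
        gcongr
        exact ENNReal.one_le_ofReal.mpr hc1
  · set ℓ : ℝ := 2 ^ P.1 with hℓ
    have hℓ0 : 0 < ℓ := by positivity
    set μ := max t s with hμ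
    have hμ0 : 0 < μ := lt_max_of_lt_left ht
    obtain ⟨d, hd0, hd, hdρ⟩ : ∃ d, 0 ≤ d ∧ (∀ x ∈ A, ∀ y ∈ cube P, d ≤ dist x y) ∧
        (1 + d / μ) ^ (-M) ≤ (ρ / μ) ^ (-M') := by
      rcases hcase with h | h
      · refine ⟨0, le_rfl, fun _ _ _ _ => dist_nonneg, ?_⟩
        rw [zero_div, add_zero, Real.one_rpow]
        refine Real.one_le_rpow_of_pos_of_le_one_of_nonpos (by positivity) ?_ (by linarith)
        exact (div_le_one hμ0).mpr (h.trans (le_max_left _ _))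
      · refine ⟨ρ, hρ.le, h, ?_⟩
        have h1 : 0 < ρ / μ := by positivity
        calc (1 + ρ / μ) ^ (-M) ≤ (1 + ρ / μ) ^ (-M') :=
              Real.rpow_le_rpow_of_exponent_le (by linarith) (by linarith)
          _ ≤ (ρ / μ) ^ (-M') := Real.rpow_le_rpow_of_nonpos h1 (by linarith) (by linarith)
    have hreal : ‖m t s‖ * ((ℓ / μ) ^ σ * (1 + d / μ) ^ (-M)) ≤
        D * min (t / s) (s / t) ^ ε * ((2 * (n + 1)) ^ (M' - σ) * (ℓ / ρ) ^ M') := by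
      calc ‖m t s‖ * ((ℓ / μ) ^ σ * (1 + d / μ) ^ (-M))
          ≤ (D * min (t / s) (s / t) ^ ε * (s / μ) ^ (M' - σ)) *
              ((ℓ / μ) ^ σ * (ρ / μ) ^ (-M')) := by
            gcongr
            exact hm t s ht hs
        _ = D * min (t / s) (s / t) ^ ε * ((s / ℓ) ^ (M' - σ) * (ℓ / ρ) ^ M') := by
            rw [mul_assoc]
            congr 1
            rw [Real.div_rpow hs.le hμ0.le, Real.div_rpow hℓ0.le hμ0.le,
              Real.div_rpow hρ.le hμ0.le, Real.div_rpow hs.le hℓ0.le, Real.div_rpow hℓ0.le hρ.le,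
              Real.rpow_sub hs, Real.rpow_sub hμ0, Real.rpow_sub hℓ0, Real.rpow_neg hρ.le,
              Real.rpow_neg hμ0.le]
            have h1 : ρ ^ M' ≠ 0 := by positivity
            have h2 : μ ^ M' ≠ 0 := by positivity
            have h3 : ℓ ^ M' ≠ 0 := by positivity
            have h4 : μ ^ σ ≠ 0 := by positivity
            have h5 : ℓ ^ σ ≠ 0 := by positivity
            have h6 : s ^ σ ≠ 0 := by positivity
            field_simp
        _ ≤ _ := by
            gcongr
            rw [div_le_iff₀ hℓ0]
            exact hsP.le
    have h1 := hK.off_le P A hA t s d ht hs hd0 hd u hu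
    have h2 : A.indicator (mulK m K t s u) =ᵐ[volume] m t s • A.indicator (K t s u) := by
      filter_upwards [Lp.coeFn_smul (m t s) (K t s u)] with y hy
      rw [Pi.smul_apply]
      by_cases h : y ∈ A
      · rw [indicator_of_mem h, indicator_of_mem h]
        exact hy
      · rw [indicator_of_notMem h, indicator_of_notMem h, smul_zero]
    rw [eLpNorm_congr_ae h2, eLpNorm_const_smul]
    calc ‖m t s‖ₑ * eLpNorm (A.indicator (K t s u)) 2 volume
        ≤ ‖m t s‖ₑ * (B * ENNReal.ofReal ((ℓ / μ) ^ σ * (1 + d / μ) ^ (-M)) * ‖u‖ₑ) :=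
          mul_le_mul_right h1 _
      _ = B * ENNReal.ofReal (‖m t s‖ * ((ℓ / μ) ^ σ * (1 + d / μ) ^ (-M))) * ‖u‖ₑ := by
          rw [ENNReal.ofReal_mul (norm_nonneg _), ofReal_norm]
          ring
      _ ≤ B * ENNReal.ofReal (D * min (t / s) (s / t) ^ ε *
            ((2 * (n + 1)) ^ (M' - σ) * (ℓ / ρ) ^ M')) * ‖u‖ₑ := by gcongr
      _ = _ := by
          rw [ENNReal.ofReal_mul (by positivity), ENNReal.ofReal_mul (by positivity),
            ENNReal.ofReal_mul (by positivity), ENNReal.ofReal_coe_nnreal, schurKer]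
          ring

/-! ### From functions of compact support to the tent space -/

/-- A bound on bounded functions of compact support gives boundedness on the tent space, provided
that the integrals converge on all of it. -/
lemma boundedOnTent_of_isNice {p σ q : ℝ} (hp : 0 < p) (hq : q ∈ Icc (1 : ℝ) 2)
    {w : ℝ → ℝ → ℝ≥0∞} {c : ℝ≥0} {κ : OpKernel n N} (hκ : Dominated p σ w κ)
    (hwm : ∀ t, Measurable (w t)) (hw : ∀ t s, w t s ≤ c)
    (hadm : ∀ F : ℝ × Space n → Val N, StronglyMeasurable F → tentNorm q F < ⊤ →
      Admissible p σ w F) {C : ℝ≥0}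
    (hC : ∀ F : ℝ × Space n → Val N, IsNice F →
      ∫⁻ x, coneSq (image κ F) x ^ (q / 2) ≤ C * ∫⁻ x, coneSq F x ^ (q / 2)) :
    BoundedOnTent q κ (C ^ (1 / q)) := by
  have hq0 : 0 < q := by linarith [hq.1]
  intro F hF
  obtain ⟨F', hF', hae, hfin⟩ := hF.exists_stronglyMeasurable hq
  have hadm' := hadm F' hF' hfin
  have hle : ∫⁻ x, coneSq (image κ F') x ^ (q / 2) ≤ C * ∫⁻ x, coneSq F' x ^ (q / 2) := by
    have hlim := tendsto_op hp hwm (fun t s => ((hw t s).trans_lt (by simp)).ne) (fun _ => hκ)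
      hF' (Fs := fun k => (truncSet F' k).indicator F') (fun k => (isNice_truncSet hF' k).meas)
      (fun k z => norm_indicator_le_norm_self F' z) (fun z hz => by
        refine tendsto_const_nhds.congr' ?_
        filter_upwards [eventually_mem_truncSet F' hz] with k hk
        exact (indicator_of_mem hk F').symm)
      (fun t s _ _ u => tendsto_const_nhds) hadm'
    refine lintegral_coneSq_image_le_of_tendsto hκ.meas (fun _ => hκ.meas) hF'
      (fun k => (isNice_truncSet hF' k).meas) hlim (by positivity) fun k => ?_
    refine (hC _ (isNice_truncSet hF' k)).trans (mul_le_mul_right (lintegral_mono fun x => ?_) _)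
    exact ENNReal.rpow_le_rpow (coneSq_mono (fun z => enorm_indicator_le_enorm_self F' z) x)
      (by positivity)
  have hnorm : tentNorm q (image κ F') ≤ (C ^ (1 / q) : ℝ≥0) * tentNorm q F := by
    rw [tentNorm_congr_ae q hae, tentNorm_eq, tentNorm_eq,
      ENNReal.coe_rpow_of_nonneg _ (by positivity), ← ENNReal.mul_rpow_of_nonneg _ _ (by positivity)]
    exact ENNReal.rpow_le_rpow hle (by positivity)
  refine ⟨image κ F', memTent_of_tentNorm_lt_top hq (stronglyMeasurable_image _ _) ?_,
    (hκ.isImage hF' hadm').congr_left hae, hnorm⟩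
  rw [tentNorm_congr_ae q hae] at hnorm
  exact hnorm.trans_lt (ENNReal.mul_lt_top (by simp) hfin)

lemma BoundedOnTent.add {q : ℝ} (hq : q ∈ Icc (1 : ℝ) 2) {κ κ' : OpKernel n N} {C C' : ℝ≥0}
    (h : BoundedOnTent q κ C) (h' : BoundedOnTent q κ' C') : BoundedOnTent q (κ + κ') (C + C') := by
  intro F hF
  obtain ⟨G, hG, hKG, hCG⟩ := h F hF
  obtain ⟨G', hG', hKG', hCG'⟩ := h' F hF
  obtain ⟨H, hH, hGH, hfin⟩ := hG.exists_stronglyMeasurable hq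
  obtain ⟨H', hH', hGH', hfin'⟩ := hG'.exists_stronglyMeasurable hq
  have hadd := tentNorm_add_le hq.1 hH hH'
  refine ⟨H + H', memTent_of_tentNorm_lt_top hq (hH.add hH')
    (hadd.trans_lt (ENNReal.add_lt_top.mpr ⟨hfin, hfin'⟩)),
    (hKG.congr_right hGH).add (hKG'.congr_right hGH'), hadd.trans ?_⟩
  rw [← tentNorm_congr_ae q hGH, ← tentNorm_congr_ae q hGH', ENNReal.coe_add, add_mul]
  exact add_le_add hCG hCG'

/-! ### Convergence of the integrals on the tent spaces -/

/-- The heights of the Whitney boxes above cubes of side `2 ^ k`. -/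
def layer (n : ℕ) (k : ℤ) : Set ℝ := Ioi 0 ∩ scale n ⁻¹' {k}

lemma measurableSet_layer (k : ℤ) : MeasurableSet (layer n k) :=
  measurableSet_Ioi.inter ((measurable_scale) (measurableSet_singleton k))

lemma iUnion_layer : ⋃ k, layer n k = Ioi 0 := by
  ext s
  simp [layer]

lemma dlog_layer_le_one (k : ℤ) : dlog (layer n k) ≤ 1 := by
  have h1 : dlog (layer n k) = ∫⁻ s, (layer n k).indicator 1 s ∂dlog :=
    (lintegral_indicator_one (measurableSet_layer k)).symm
  set a : ℝ := (n + 1) * 2 ^ k with ha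
  have ha0 : 0 < a := by positivity
  have hmem : ∀ s ∈ layer n k, s ∈ Ico a (2 * a) := fun s hs => by
    have h2 := scale_bounds (n := n) (show 0 < s from hs.1)
    rw [show scale n s = k from hs.2] at h2
    exact ⟨h2.1, by rw [ha, ← mul_assoc]; exact h2.2⟩
  rw [h1, lintegral_dlog]
  calc ∫⁻ s in Ioi 0, ENNReal.ofReal s⁻¹ * (layer n k).indicator 1 s
      ≤ ∫⁻ s, (Ico a (2 * a)).indicator (fun _ => ENNReal.ofReal a⁻¹) s := by
        refine (setLIntegral_le_lintegral _ _).trans (lintegral_mono fun s => ?_)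
        by_cases h : s ∈ layer n k
        · rw [indicator_of_mem h, indicator_of_mem (hmem s h), Pi.one_apply, mul_one]
          exact ENNReal.ofReal_le_ofReal (inv_anti₀ ha0 (hmem s h).1)
        · rw [indicator_of_notMem h, mul_zero]
          exact zero_le
    _ = ENNReal.ofReal a⁻¹ * volume (Ico a (2 * a)) :=
        lintegral_indicator_const measurableSet_Ico _
    _ = 1 := by
        rw [Real.volume_Ico, ← ENNReal.ofReal_mul (by positivity), two_mul, add_sub_cancel_right,
          inv_mul_cancel₀ ha0.ne', ENNReal.ofReal_one]

/-- Hölder's inequality on a set of finite measure. -/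
lemma lintegral_rpow_le_of_le_one {X : Type*} [MeasurableSpace X] {μ : Measure X} {f : X → ℝ≥0∞}
    (hf : AEMeasurable f μ) {θ : ℝ} (h0 : 0 ≤ θ) (h1 : θ ≤ 1) :
    ∫⁻ x, f x ^ θ ∂μ ≤ (∫⁻ x, f x ∂μ) ^ θ * μ univ ^ (1 - θ) := by
  have := ENNReal.lintegral_mul_norm_pow_le hf (g := 1) aemeasurable_one h0
    (sub_nonneg.mpr h1) (by ring)
  simpa using this

lemma ENNReal_tsum_rpow_le {ι : Type*} (f : ι → ℝ≥0∞) {θ : ℝ} (h : 1 ≤ θ) :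
    ∑' i, f i ^ θ ≤ (∑' i, f i) ^ θ := by
  have hsplit : ∀ a : ℝ≥0∞, a ^ θ = a * a ^ (θ - 1) := fun a => by
    nth_rewrite 2 [← ENNReal.rpow_one a]
    rw [← ENNReal.rpow_add_of_nonneg _ _ zero_le_one (by linarith)]
    congr 1
    ring
  rw [hsplit (∑' i, f i), ← ENNReal.tsum_mul_right]
  refine ENNReal.tsum_le_tsum fun i => ?_
  rw [hsplit]
  exact mul_le_mul_right (ENNReal.rpow_le_rpow (ENNReal.le_tsum i) (by linarith)) _

lemma lintegral_eq_tsum_cube (k : ℤ) (f : Space n → ℝ≥0∞) :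
    ∫⁻ y, f y = ∑' κ : Fin n → ℤ, ∫⁻ y in cube (k, κ), f y := by
  have h1 : (⋃ κ : Fin n → ℤ, cube ((k, κ) : Tile n)) = univ := by
    ext y
    simp [cube]
  rw [← setLIntegral_univ, ← h1, lintegral_iUnion (fun κ => measurableSet_cube _)]
  intro κ κ' hne
  refine disjoint_left.mpr fun y hy hy' => hne ?_
  exact (show cubeIdx k y = κ from hy).symm.trans hy'

lemma tileEnergy_eq {F : ℝ × Space n → Val N} (hF : StronglyMeasurable F) (τ : Tile n) :
    tileEnergy F τ = ∫⁻ s in layer n τ.1, (∫⁻ y in cube τ, ‖F (s, y)‖ₑ ^ 2) ∂dlog := by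
  have h1 : tileEnergy F τ = energy (restr {τ} F) := by
    rw [energy_restr, tsum_eq_single
      (f := fun τ' => ({τ} : Set (Tile n)).indicator (tileEnergy F) τ') τ (fun τ' h =>
      indicator_of_notMem (show τ' ∉ ({τ} : Set (Tile n)) from h) _)]
    exact (indicator_of_mem (mem_singleton τ) _).symm
  rw [h1, energy_eq (stronglyMeasurable_restr hF _), ← lintegral_indicator (measurableSet_layer _)]
  refine lintegral_congr_ae ?_
  filter_upwards [ae_dlog_pos] with s hs
  rw [← lintegral_enorm_sq_eq]
  by_cases h : s ∈ layer n τ.1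
  · rw [indicator_of_mem h, ← lintegral_indicator (measurableSet_cube τ)]
    refine lintegral_congr fun y => ?_
    have hsc : scale n s = τ.1 := h.2
    by_cases hy : y ∈ cube τ
    · rw [indicator_of_mem hy, restr, indicator_of_mem]
      refine ⟨⟨hs, mem_univ _⟩, ?_⟩
      show (scale n s, cubeIdx (scale n s) y) = τ
      rw [hsc, show cubeIdx τ.1 y = τ.2 from hy]
    · rw [indicator_of_notMem hy, restr, indicator_of_notMem]
      · simp
      · rintro ⟨_, h'⟩
        have h' : (scale n s, cubeIdx (scale n s) y) = τ := h'
        refine hy ?_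
        rw [← h']
        rfl
  · rw [indicator_of_notMem h]
    have : ∀ y, restr {τ} F (s, y) = 0 := fun y => by
      refine indicator_of_notMem (fun h' => h ⟨hs, ?_⟩) F
      have h' : (scale n s, cubeIdx (scale n s) y) = τ := h'.2
      show scale n s = τ.1
      rw [← h']
    simp [this]

/-- Hölder's inequality on a Whitney box. -/
lemma lintegral_box_rpow_le {F : ℝ × Space n → Val N} (hF : StronglyMeasurable F) (τ : Tile n)
    {r : ℝ} (hr0 : 0 < r) (hr : r ≤ 2) :
    ∫⁻ s in layer n τ.1, (∫⁻ y in cube τ, ‖F (s, y)‖ₑ ^ r) ∂dlog ≤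
      tileEnergy F τ ^ (r / 2) * volume (cube τ) ^ (1 - r / 2) := by
  have hm : Measurable fun s => ∫⁻ y in cube τ, ‖F (s, y)‖ₑ ^ 2 :=
    Measurable.lintegral_prod_right' (f := fun z : ℝ × Space n => ‖F z‖ₑ ^ 2)
      (hF.enorm.pow_const 2)
  have hpow : ∀ z, ‖F z‖ₑ ^ r = (‖F z‖ₑ ^ 2) ^ (r / 2) := fun z => by
    rw [← ENNReal.rpow_natCast, ← ENNReal.rpow_mul]
    congr 1
    push_cast
    ring
  have h1 : ∀ s, ∫⁻ y in cube τ, ‖F (s, y)‖ₑ ^ r ≤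
      (∫⁻ y in cube τ, ‖F (s, y)‖ₑ ^ 2) ^ (r / 2) * volume (cube τ) ^ (1 - r / 2) := by
    intro s
    simp_rw [hpow]
    have := lintegral_rpow_le_of_le_one (μ := volume.restrict (cube τ))
      (f := fun y => ‖F (s, y)‖ₑ ^ 2)
      ((hF.comp_measurable measurable_prodMk_left).enorm.pow_const 2).aemeasurable
      (θ := r / 2) (by positivity) (by linarith)
    rwa [Measure.restrict_apply_univ] at this
  refine (lintegral_mono h1).trans ?_
  rw [lintegral_mul_const _ (hm.pow_const _), tileEnergy_eq hF]
  refine mul_le_mul_left ?_ _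
  refine (lintegral_rpow_le_of_le_one hm.aemeasurable (by positivity) (by linarith)).trans ?_
  rw [Measure.restrict_apply_univ]
  refine mul_le_of_le_one_right' ?_
  exact ENNReal.rpow_le_one (dlog_layer_le_one _) (by linarith)

lemma volume_cube_rpow (k : ℤ) (κ : Fin n → ℤ) (θ : ℝ) :
    volume (cube ((k, κ) : Tile n)) ^ θ = ENNReal.ofReal (((2 : ℝ) ^ k) ^ ((n : ℝ) * θ)) := by
  rw [volume_cube, ENNReal.ofReal_rpow_of_pos (by positivity), ← Real.rpow_natCast,
    ← Real.rpow_mul (by positivity)]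

lemma tsum_tileEnergy_rpow_le (e : Tile n → ℝ≥0∞) (k : ℤ) {q : ℝ} (hq : 0 < q) :
    ∑' κ : Fin n → ℤ, e (k, κ) ^ (q / 2) ≤
      ENNReal.ofReal (((2 : ℝ) ^ k) ^ ((n : ℝ) * (q / 2 - 1))) * ∫⁻ x, dsf e x ^ q := by
  rw [lintegral_eq_tsum_cube k, ← ENNReal.tsum_mul_left]
  refine ENNReal.tsum_le_tsum fun κ => ?_
  have hV0 := volume_cube_ne_zero ((k, κ) : Tile n)
  have hVt := volume_cube_ne_top ((k, κ) : Tile n)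
  rw [← volume_cube_rpow k κ]
  set V := volume (cube ((k, κ) : Tile n)) with hV
  have h1 : (e (k, κ) / V) ^ (q / 2) * V ≤ ∫⁻ y in cube ((k, κ) : Tile n), dsf e y ^ q := by
    rw [hV, ← setLIntegral_const]
    refine setLIntegral_mono' (measurableSet_cube _) fun y hy => ?_
    rw [dsf_rpow]
    refine ENNReal.rpow_le_rpow ?_ (by positivity)
    refine le_trans ?_ (ENNReal.le_tsum ((k, κ) : Tile n))
    rw [indicator_of_mem hy]
  refine le_trans (le_of_eq ?_) (mul_le_mul_right h1 _)
  rw [ENNReal.div_rpow_of_nonneg _ _ (by positivity), ENNReal.rpow_sub _ _ hV0 hVt,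
    ENNReal.rpow_one, ENNReal.div_eq_inv_mul, ENNReal.div_eq_inv_mul]
  have hVq0 : V ^ (q / 2) ≠ 0 := by simp [hV0, hVt]
  have hVqt : V ^ (q / 2) ≠ ⊤ := ENNReal.rpow_ne_top_of_nonneg (by positivity) hVt
  calc e (k, κ) ^ (q / 2)
      = (V⁻¹ * V) * ((V ^ (q / 2))⁻¹ * V ^ (q / 2)) * e (k, κ) ^ (q / 2) := by
        rw [ENNReal.inv_mul_cancel hV0 hVt, ENNReal.inv_mul_cancel hVq0 hVqt, one_mul, one_mul]
    _ = _ := by ring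

/-- The `L^r` norms of the slices, integrated over a layer. On each Whitney box this is Hölder's
inequality; the boxes of the layer are summed by `ℓ^q ⊆ ℓ^r`, and the `ℓ^q` sum of the energies of one
layer is part of the dyadic square function. -/
lemma lintegral_layer_le {F : ℝ × Space n → Val N} (hF : StronglyMeasurable F) {q r : ℝ}
    (hq : 1 ≤ q) (hqr : q ≤ r) (hr : r ≤ 2) (k : ℤ) :
    ∫⁻ s in layer n k, eLpNorm (fun y => F (s, y)) (ENNReal.ofReal r) volume ∂dlog ≤
      ENNReal.ofReal (((2 : ℝ) ^ k) ^ ((n : ℝ) * (1 / r - 1 / q))) *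
        (∫⁻ x, dsf (tileEnergy F) x ^ q) ^ (1 / q) := by
  have hq0 : 0 < q := by linarith
  have hr0 : 0 < r := by linarith
  have hk0 : (0 : ℝ) < 2 ^ k := by positivity
  set X := ∫⁻ x, dsf (tileEnergy F) x ^ q with hX
  have hm : Measurable fun s => ∫⁻ y, ‖F (s, y)‖ₑ ^ r :=
    Measurable.lintegral_prod_right' (f := fun z : ℝ × Space n => ‖F z‖ₑ ^ r)
      (hF.enorm.pow_const r)
  have h1 : ∀ s, eLpNorm (fun y => F (s, y)) (ENNReal.ofReal r) volume =
      (∫⁻ y, ‖F (s, y)‖ₑ ^ r) ^ (1 / r) := by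
    intro s
    rw [eLpNorm_eq_lintegral_rpow_enorm_toReal (by simpa using hr0) (by simp),
      ENNReal.toReal_ofReal hr0.le]
  simp_rw [h1]
  refine (lintegral_rpow_le_of_le_one hm.aemeasurable (by positivity)
    ((div_le_one hr0).mpr (hq.trans hqr))).trans ?_
  rw [Measure.restrict_apply_univ]
  refine (mul_le_of_le_one_right' (ENNReal.rpow_le_one (dlog_layer_le_one _)
    (sub_nonneg.mpr ((div_le_one hr0).mpr (hq.trans hqr))))).trans ?_
  have h2 : ∫⁻ s in layer n k, (∫⁻ y, ‖F (s, y)‖ₑ ^ r) ∂dlog ≤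
      ENNReal.ofReal (((2 : ℝ) ^ k) ^ ((n : ℝ) * (1 - r / q))) * X ^ (r / q) := by
    calc ∫⁻ s in layer n k, (∫⁻ y, ‖F (s, y)‖ₑ ^ r) ∂dlog
        = ∑' κ : Fin n → ℤ, ∫⁻ s in layer n k, (∫⁻ y in cube (k, κ), ‖F (s, y)‖ₑ ^ r) ∂dlog := by
          rw [← lintegral_tsum fun κ => (Measurable.lintegral_prod_right'
            (f := fun z : ℝ × Space n => ‖F z‖ₑ ^ r) (hF.enorm.pow_const r)).aemeasurable]
          simp_rw [← lintegral_eq_tsum_cube k]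
      _ ≤ ∑' κ : Fin n → ℤ, tileEnergy F (k, κ) ^ (r / 2) *
            ENNReal.ofReal (((2 : ℝ) ^ k) ^ ((n : ℝ) * (1 - r / 2))) := by
          refine ENNReal.tsum_le_tsum fun κ => ?_
          rw [← volume_cube_rpow k κ]
          exact lintegral_box_rpow_le hF (k, κ) hr0 hr
      _ = (∑' κ : Fin n → ℤ, (tileEnergy F (k, κ) ^ (q / 2)) ^ (r / q)) *
            ENNReal.ofReal (((2 : ℝ) ^ k) ^ ((n : ℝ) * (1 - r / 2))) := by
          rw [ENNReal.tsum_mul_right]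
          congr 2
          funext κ
          rw [← ENNReal.rpow_mul]
          congr 1
          field_simp
      _ ≤ (ENNReal.ofReal (((2 : ℝ) ^ k) ^ ((n : ℝ) * (q / 2 - 1))) * X) ^ (r / q) *
            ENNReal.ofReal (((2 : ℝ) ^ k) ^ ((n : ℝ) * (1 - r / 2))) := by
          refine mul_le_mul_left ((ENNReal_tsum_rpow_le _ ((one_le_div hq0).mpr hqr)).trans ?_) _
          exact ENNReal.rpow_le_rpow (tsum_tileEnergy_rpow_le _ k hq0) (by positivity)
      _ = _ := by
          rw [ENNReal.mul_rpow_of_nonneg _ _ (by positivity),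
            ENNReal.ofReal_rpow_of_pos (by positivity), mul_right_comm,
            ← ENNReal.ofReal_mul (by positivity), ← Real.rpow_mul hk0.le, ← Real.rpow_add hk0]
          congr 4
          field_simp
          ring
  refine (ENNReal.rpow_le_rpow h2 (by positivity)).trans (le_of_eq ?_)
  rw [ENNReal.mul_rpow_of_nonneg _ _ (by positivity), ENNReal.ofReal_rpow_of_pos (by positivity),
    ← Real.rpow_mul hk0.le, ← ENNReal.rpow_mul]
  congr 1
  · congr 2
    field_simp
  · congr 1
    field_simp

lemma tsum_zpow_ne_top {θ : ℝ} (hθ : 0 < θ) (k₀ : ℤ) :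
    ∑' k : ℤ, (Iic k₀).indicator (fun k => ENNReal.ofReal (((2 : ℝ) ^ k) ^ θ)) k ≠ ⊤ := by
  have hinj : Function.Injective fun j : ℕ => k₀ - (j : ℤ) := fun i j h => by
    simpa using h
  rw [← hinj.tsum_eq]
  · have h1 : ∀ j : ℕ, (Iic k₀).indicator (fun k => ENNReal.ofReal (((2 : ℝ) ^ k) ^ θ)) (k₀ - j) =
        ENNReal.ofReal (((2 : ℝ) ^ k₀) ^ θ) * ENNReal.ofReal ((2 : ℝ) ^ (-θ)) ^ j := by
      intro j
      rw [indicator_of_mem (show k₀ - (j : ℤ) ∈ Iic k₀ by simp),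
        ← ENNReal.ofReal_pow (by positivity), ← ENNReal.ofReal_mul (by positivity)]
      congr 1
      rw [zpow_sub₀ (by norm_num), Real.div_rpow (by positivity) (by positivity),
        ← Real.rpow_natCast _ j, ← Real.rpow_mul (by norm_num), zpow_natCast,
        ← Real.rpow_natCast 2 j, ← Real.rpow_mul (by norm_num), div_eq_mul_inv,
        ← Real.rpow_neg (by norm_num)]
      congr 2
      ring
    simp_rw [h1]
    rw [ENNReal.tsum_mul_left, ENNReal.tsum_geometric]
    refine ENNReal.mul_ne_top (by simp) ?_
    rw [ENNReal.inv_ne_top]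
    have : (2 : ℝ) ^ (-θ) < 1 := Real.rpow_lt_one_of_one_lt_of_neg (by norm_num) (by linarith)
    exact (tsub_pos_iff_lt.mpr (ENNReal.ofReal_lt_one.mpr this)).ne'
  · intro k hk
    have hk' : k ∈ Iic k₀ := by
      by_contra h
      exact hk (indicator_of_notMem h _)
    exact ⟨(k₀ - k).toNat, by
      have : 0 ≤ k₀ - k := sub_nonneg.mpr hk'
      simp only
      omega⟩

lemma tsum_zpow_neg_ne_top {θ : ℝ} (hθ : θ < 0) (k₀ : ℤ) :
    ∑' k : ℤ, (Ici k₀).indicator (fun k => ENNReal.ofReal (((2 : ℝ) ^ k) ^ θ)) k ≠ ⊤ := by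
  have h := tsum_zpow_ne_top (neg_pos.mpr hθ) (-k₀)
  rw [← (Equiv.neg ℤ).tsum_eq] at h
  convert h using 3 with k
  by_cases hk : k ∈ Ici k₀
  · rw [indicator_of_mem hk, indicator_of_mem (show Equiv.neg ℤ k ∈ Iic (-k₀) by
      simpa using hk)]
    congr 1
    rw [Equiv.neg_apply, zpow_neg, Real.inv_rpow (by positivity), Real.rpow_neg (by positivity),
      inv_inv]
  · rw [indicator_of_notMem hk, indicator_of_notMem (show Equiv.neg ℤ k ∉ Iic (-k₀) by
      simpa using hk)]

section Layers

variable {F : ℝ × Space n → Val N} {q r : ℝ}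

lemma dsf_ne_top (hF : StronglyMeasurable F) (hq : 1 ≤ q) (hfin : tentNorm q F < ⊤) :
    (∫⁻ x, dsf (tileEnergy F) x ^ q) ^ (1 / q) ≠ ⊤ := by
  have hq0 : 0 < q := by linarith
  refine ENNReal.rpow_ne_top_of_nonneg (by positivity) ?_
  refine ((lintegral_dsf_rpow_le hF hq0).trans_lt (ENNReal.mul_lt_top ?_ ?_)).ne
  · exact ENNReal.rpow_lt_top_of_nonneg (by positivity) (by simp)
  · exact (tentNorm_lt_top_iff hq0).mp hfin

/-- Almost every slice of an element of the tent space is in `L²`. -/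
lemma ae_memLp_slice (hF : StronglyMeasurable F) (hq : q ∈ Icc (1 : ℝ) 2)
    (hfin : tentNorm q F < ⊤) : ∀ᵐ s ∂dlog, MemLp (fun y => F (s, y)) 2 volume := by
  have h1 : ∀ k : ℤ, ∀ᵐ s ∂dlog, s ∈ layer n k → MemLp (fun y => F (s, y)) 2 volume := by
    intro k
    rw [← ae_restrict_iff' (measurableSet_layer k)]
    have h2 := lintegral_layer_le hF hq.1 hq.2 le_rfl k
    have h3 := h2.trans_lt (ENNReal.mul_lt_top (by simp) (dsf_ne_top hF hq.1 hfin).lt_top)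
    rw [ENNReal.ofReal_ofNat] at h3
    filter_upwards [ae_lt_top (measurable_lintegral_slice hF 2 (by norm_num) (by norm_num))
      h3.ne] with s hs
    exact ⟨(hF.comp_measurable measurable_prodMk_left).aestronglyMeasurable, hs⟩
  filter_upwards [ae_all_iff.mpr h1, ae_dlog_pos] with s hs hs0
  exact hs (scale n s) ⟨hs0, rfl⟩

lemma rpow_le_of_mem_layer {s : ℝ} {k : ℤ} (hs : s ∈ layer n k) (η : ℝ) :
    s ^ η ≤ (2 * (n + 1)) ^ |η| * ((2 : ℝ) ^ k) ^ η := by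
  have hs0 : 0 < s := hs.1
  have hb := scale_bounds (n := n) hs0
  rw [show scale n s = k from hs.2] at hb
  have hk0 : (0 : ℝ) < 2 ^ k := by positivity
  have h1 : (1 : ℝ) ≤ s / 2 ^ k := by
    rw [le_div_iff₀ hk0]
    refine le_trans ?_ hb.1
    gcongr
    linarith [n.cast_nonneg (α := ℝ)]
  have h2 : s / 2 ^ k ≤ 2 * (n + 1) := by
    rw [div_le_iff₀ hk0]
    exact hb.2.le
  have h3 : s ^ η = (s / 2 ^ k) ^ η * ((2 : ℝ) ^ k) ^ η := by
    rw [← Real.mul_rpow (by positivity) hk0.le, div_mul_cancel₀ _ hk0.ne']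
  rw [h3]
  gcongr
  calc (s / 2 ^ k) ^ η ≤ (s / 2 ^ k) ^ |η| := Real.rpow_le_rpow_of_exponent_le h1 (le_abs_self η)
    _ ≤ _ := Real.rpow_le_rpow (by positivity) h2 (abs_nonneg η)

/-- A weighted integral of the `L^r` norms of the slices over a union of layers. -/
lemma lintegral_rpow_mul_eLpNorm_le (hF : StronglyMeasurable F) (hq : 1 ≤ q) (hqr : q ≤ r)
    (hr : r ≤ 2) (η : ℝ) (S : Set ℤ) :
    ∫⁻ s, (scale n ⁻¹' S).indicator (fun s => ENNReal.ofReal (s ^ η) *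
        eLpNorm (fun y => F (s, y)) (ENNReal.ofReal r) volume) s ∂dlog ≤
      ENNReal.ofReal ((2 * (n + 1)) ^ |η|) *
        (∫⁻ x, dsf (tileEnergy F) x ^ q) ^ (1 / q) *
        ∑' k : ℤ, S.indicator (fun k =>
          ENNReal.ofReal (((2 : ℝ) ^ k) ^ (η + n * (1 / r - 1 / q)))) k := by
  have hr0 : 0 < r := by linarith
  have hc : (dlog : Measure ℝ) = dlog.restrict (⋃ k, layer n k) := by
    rw [iUnion_layer]
    refine (Measure.restrict_eq_self_of_ae_mem ?_).symm
    filter_upwards [ae_dlog_pos] with s hs using hs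
  rw [hc]
  refine (lintegral_iUnion_le _ _).trans ?_
  rw [← ENNReal.tsum_mul_left]
  refine ENNReal.tsum_le_tsum fun k => ?_
  by_cases hk : k ∈ S
  · rw [indicator_of_mem hk]
    calc ∫⁻ s in layer n k, (scale n ⁻¹' S).indicator (fun s => ENNReal.ofReal (s ^ η) *
          eLpNorm (fun y => F (s, y)) (ENNReal.ofReal r) volume) s ∂dlog
        ≤ ∫⁻ s in layer n k, ENNReal.ofReal ((2 * (n + 1)) ^ |η| * ((2 : ℝ) ^ k) ^ η) *
          eLpNorm (fun y => F (s, y)) (ENNReal.ofReal r) volume ∂dlog := by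
          refine setLIntegral_mono' (measurableSet_layer k) fun s hs => ?_
          refine (indicator_le_self _ _ s).trans (mul_le_mul_left ?_ _)
          exact ENNReal.ofReal_le_ofReal (rpow_le_of_mem_layer hs η)
      _ ≤ ENNReal.ofReal ((2 * (n + 1)) ^ |η| * ((2 : ℝ) ^ k) ^ η) *
          (ENNReal.ofReal (((2 : ℝ) ^ k) ^ ((n : ℝ) * (1 / r - 1 / q))) *
            (∫⁻ x, dsf (tileEnergy F) x ^ q) ^ (1 / q)) := by
          rw [lintegral_const_mul' _ _ (by simp)]
          exact mul_le_mul_right (lintegral_layer_le hF hq hqr hr k) _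
      _ = _ := by
          rw [ENNReal.ofReal_mul (by positivity), Real.rpow_add (by positivity),
            ENNReal.ofReal_mul (p := ((2 : ℝ) ^ k) ^ η) (by positivity)]
          ring
  · rw [indicator_of_notMem hk, mul_zero]
    refine le_of_eq ?_
    rw [← lintegral_zero (μ := dlog.restrict (layer n k))]
    refine setLIntegral_congr_fun (measurableSet_layer k) fun s hs => ?_
    refine indicator_of_notMem (fun h => hk ?_) _
    rw [← show scale n s = k from hs.2]
    exact h

lemma scale_mono {s t : ℝ} (hs : 0 < s) (hst : s ≤ t) : scale n s ≤ scale n t := by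
  unfold scale
  refine Int.floor_le_floor ?_
  refine Real.logb_le_logb_of_le (by norm_num) (by positivity) ?_
  gcongr

/-- Convergence of the integrals over `s < t` with kernels that decay like `(s/t)^β`. -/
lemma admissible_of_lt {p σ β : ℝ} (hp : p ≤ 2) (hq : 1 ≤ q) (hqp : q ≤ p)
    (hβ : (n : ℝ) * (1 / q - 1 / p) < β) {w : ℝ → ℝ → ℝ≥0∞} {c : ℝ≥0}
    (hw : ∀ t s, 0 < t → 0 < s → s < t → w t s ≤ c * ENNReal.ofReal ((s / t) ^ β))
    (hw0 : ∀ t s, 0 < t → 0 < s → t ≤ s → w t s = 0)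
    (hF : StronglyMeasurable F) (hfin : tentNorm q F < ⊤) : Admissible p σ w F := by
  refine ⟨ae_memLp_slice hF ⟨hq, hqp.trans hp⟩ hfin, ?_⟩
  filter_upwards [ae_dlog_pos] with t ht
  set A : ℝ≥0∞ := c * ENNReal.ofReal (t ^ (-β)) * ENNReal.ofReal (t ^ (-σ)) with hA
  have hAt : A ≠ ⊤ := by finiteness
  calc ∫⁻ s, w t s * scaledNorm p σ t s (fun y => F (s, y)) ∂dlog
      ≤ ∫⁻ s, A * (scale n ⁻¹' Iic (scale n t)).indicator (fun s => ENNReal.ofReal (s ^ β) *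
        eLpNorm (fun y => F (s, y)) (ENNReal.ofReal p) volume) s ∂dlog := by
        refine lintegral_mono_ae ?_
        filter_upwards [ae_dlog_pos] with s hs
        by_cases hst : s < t
        · rw [indicator_of_mem (show s ∈ scale n ⁻¹' Iic (scale n t) from scale_mono hs hst.le)]
          calc w t s * scaledNorm p σ t s (fun y => F (s, y))
              ≤ (c * ENNReal.ofReal ((s / t) ^ β)) * (ENNReal.ofReal (max t s ^ (-σ)) *
                eLpNorm (fun y => F (s, y)) (ENNReal.ofReal p) volume) :=
                mul_le_mul' (hw t s ht hs hst) (min_le_right _ _)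
            _ = _ := by
                rw [max_eq_left hst.le, Real.div_rpow hs.le ht.le, div_eq_mul_inv,
                  ← Real.rpow_neg ht.le, ENNReal.ofReal_mul (by positivity), hA]
                ring
        · rw [hw0 t s ht hs (not_lt.mp hst), zero_mul]
          exact zero_le
    _ = A * ∫⁻ s, (scale n ⁻¹' Iic (scale n t)).indicator (fun s => ENNReal.ofReal (s ^ β) *
        eLpNorm (fun y => F (s, y)) (ENNReal.ofReal p) volume) s ∂dlog :=
        lintegral_const_mul' _ _ hAt
    _ < ⊤ := by
        refine ENNReal.mul_lt_top hAt.lt_top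
          ((lintegral_rpow_mul_eLpNorm_le hF hq hqp hp β _).trans_lt ?_)
        refine ENNReal.mul_lt_top (ENNReal.mul_lt_top (by simp) (dsf_ne_top hF hq hfin).lt_top) ?_
        refine (tsum_zpow_ne_top ?_ _).lt_top
        have h1 : (n : ℝ) * (1 / p - 1 / q) = -(n * (1 / q - 1 / p)) := by ring
        linarith

/-- Convergence of the integrals over `s > t` with kernels that decay like `(t/s)^α`. -/
lemma admissible_of_gt {p σ α : ℝ} (hq : q ∈ Icc (1 : ℝ) 2) (hα : 0 < α)
    {w : ℝ → ℝ → ℝ≥0∞} {c : ℝ≥0}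
    (hw : ∀ t s, 0 < t → 0 < s → t < s → w t s ≤ c * ENNReal.ofReal ((t / s) ^ α))
    (hw0 : ∀ t s, 0 < t → 0 < s → s ≤ t → w t s = 0)
    (hF : StronglyMeasurable F) (hfin : tentNorm q F < ⊤) : Admissible p σ w F := by
  refine ⟨ae_memLp_slice hF hq hfin, ?_⟩
  filter_upwards [ae_dlog_pos] with t ht
  set A : ℝ≥0∞ := c * ENNReal.ofReal (t ^ α) with hA
  have hAt : A ≠ ⊤ := by finiteness
  calc ∫⁻ s, w t s * scaledNorm p σ t s (fun y => F (s, y)) ∂dlog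
      ≤ ∫⁻ s, A * (scale n ⁻¹' Ici (scale n t)).indicator (fun s => ENNReal.ofReal (s ^ (-α)) *
        eLpNorm (fun y => F (s, y)) (ENNReal.ofReal 2) volume) s ∂dlog := by
        refine lintegral_mono_ae ?_
        filter_upwards [ae_dlog_pos] with s hs
        by_cases hst : t < s
        · rw [indicator_of_mem (show s ∈ scale n ⁻¹' Ici (scale n t) from scale_mono ht hst.le)]
          calc w t s * scaledNorm p σ t s (fun y => F (s, y))
              ≤ (c * ENNReal.ofReal ((t / s) ^ α)) * eLpNorm (fun y => F (s, y)) 2 volume :=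
                mul_le_mul' (hw t s ht hs hst) (min_le_left _ _)
            _ = _ := by
                rw [Real.div_rpow ht.le hs.le, div_eq_mul_inv, ← Real.rpow_neg hs.le,
                  ENNReal.ofReal_mul (by positivity), hA, ENNReal.ofReal_ofNat]
                ring
        · rw [hw0 t s ht hs (not_lt.mp hst), zero_mul]
          exact zero_le
    _ = A * ∫⁻ s, (scale n ⁻¹' Ici (scale n t)).indicator (fun s => ENNReal.ofReal (s ^ (-α)) *
        eLpNorm (fun y => F (s, y)) (ENNReal.ofReal 2) volume) s ∂dlog :=
        lintegral_const_mul' _ _ hAt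
    _ < ⊤ := by
        refine ENNReal.mul_lt_top hAt.lt_top
          ((lintegral_rpow_mul_eLpNorm_le hF hq.1 hq.2 le_rfl (-α) _).trans_lt ?_)
        refine ENNReal.mul_lt_top (ENNReal.mul_lt_top (by simp) (dsf_ne_top hF hq.1 hfin).lt_top) ?_
        refine (tsum_zpow_neg_ne_top ?_ _).lt_top
        have h1 : 1 / 2 ≤ 1 / q := one_div_le_one_div_of_le (by linarith [hq.1]) hq.2
        have h2 : (n : ℝ) * (1 / 2 - 1 / q) ≤ 0 :=
          mul_nonpos_of_nonneg_of_nonpos n.cast_nonneg (by linarith)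
        linarith

end Layers

/-! ### The kernels `K⁻` and `K⁺` on the tent spaces -/

/-- The scalar factor of `K⁺_z`. -/
def multPlus (z : ℂ) (t s : ℝ) : ℂ := if s < t then ((s / t : ℝ) : ℂ) ^ z else 0

/-- The scalar factor of `K⁻_z`. -/
def multMinus (z : ℂ) (t s : ℝ) : ℂ := if t < s then ((t / s : ℝ) : ℂ) ^ z else 0

lemma kPlus_eq_mulK (K : OpKernel n N) (z : ℂ) : kPlus K z = mulK (multPlus z) K := by
  funext t s
  simp only [kPlus, mulK, multPlus]
  split_ifs <;> simp

lemma kMinus_eq_mulK (K : OpKernel n N) (z : ℂ) : kMinus K z = mulK (multMinus z) K := by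
  funext t s
  simp only [kMinus, mulK, multMinus]
  split_ifs <;> simp

lemma measurable_multPlus (z : ℂ) : Measurable (Function.uncurry (multPlus z)) :=
  Measurable.ite (measurableSet_lt measurable_snd measurable_fst) (by fun_prop) (by fun_prop)

lemma measurable_multMinus (z : ℂ) : Measurable (Function.uncurry (multMinus z)) :=
  Measurable.ite (measurableSet_lt measurable_fst measurable_snd) (by fun_prop) (by fun_prop)

lemma norm_multPlus (z : ℂ) {t s : ℝ} (ht : 0 < t) (hs : 0 < s) :
    ‖multPlus z t s‖ = if s < t then (s / t) ^ z.re else 0 := by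
  unfold multPlus
  split_ifs
  · rw [Complex.norm_cpow_eq_rpow_re_of_pos (by positivity)]
  · simp

lemma norm_multMinus (z : ℂ) {t s : ℝ} (ht : 0 < t) (hs : 0 < s) :
    ‖multMinus z t s‖ = if t < s then (t / s) ^ z.re else 0 := by
  unfold multMinus
  split_ifs
  · rw [Complex.norm_cpow_eq_rpow_re_of_pos (by positivity)]
  · simp

lemma norm_multPlus_le_one {z : ℂ} (hz : 0 ≤ z.re) {t s : ℝ} (ht : 0 < t) (hs : 0 < s) :
    ‖multPlus z t s‖ ≤ (1 : ℝ≥0) := by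
  rw [norm_multPlus z ht hs]
  split_ifs with h
  · exact Real.rpow_le_one (by positivity) ((div_le_one ht).mpr h.le) hz
  · simp

lemma norm_multMinus_le_one {z : ℂ} (hz : 0 ≤ z.re) {t s : ℝ} (ht : 0 < t) (hs : 0 < s) :
    ‖multMinus z t s‖ ≤ (1 : ℝ≥0) := by
  rw [norm_multMinus z ht hs]
  split_ifs with h
  · exact Real.rpow_le_one (by positivity) ((div_le_one hs).mpr h.le) hz
  · simp

/-- Multipliers carried by `s < t` that decay like `(s/t)^β`, `β ≥ ε + M' - σ`. -/
lemma KernelBound.localBound_of_lt {p σ M : ℝ} {B : ℝ≥0} {K : OpKernel n N}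
    (hK : KernelBound p σ M B K) {D : ℝ≥0} {m : ℝ → ℝ → ℂ} {ε M' β : ℝ} (hσ : 0 ≤ σ)
    (hσM : σ ≤ M') (hM' : M' ≤ M) (hβ : ε + (M' - σ) ≤ β)
    (hm : ∀ t s, 0 < t → 0 < s → ‖m t s‖ ≤ D * if s < t then (s / t) ^ β else 0) :
    LocalBound ε M' (B * D * ENNReal.ofReal ((2 * (n + 1)) ^ (M' - σ))) (mulK m K) := by
  refine hK.localBound hσ hσM hM' fun t s ht hs => (hm t s ht hs).trans ?_
  split_ifs with h
  · have h1 : s / t ≤ 1 := (div_le_one ht).mpr h.le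
    have h2 : s / t ≤ t / s := h1.trans ((one_le_div hs).mpr h.le)
    rw [min_eq_right h2, max_eq_left h.le, mul_assoc, ← Real.rpow_add (by positivity)]
    exact mul_le_mul_of_nonneg_left
      (Real.rpow_le_rpow_of_exponent_ge (by positivity) h1 hβ) (NNReal.coe_nonneg D)
  · rw [mul_zero]
    positivity

/-- Multipliers carried by `t < s` that decay like `(t/s)^ε`. -/
lemma KernelBound.localBound_of_gt {p σ M : ℝ} {B : ℝ≥0} {K : OpKernel n N}
    (hK : KernelBound p σ M B K) {m : ℝ → ℝ → ℂ} {ε : ℝ} (hσ : 0 ≤ σ) (hσM : σ ≤ M)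
    (hm : ∀ t s, 0 < t → 0 < s → ‖m t s‖ ≤ if t < s then (t / s) ^ ε else 0) :
    LocalBound ε M (B * (1 : ℝ≥0) * ENNReal.ofReal ((2 * (n + 1)) ^ (M - σ))) (mulK m K) := by
  refine hK.localBound hσ hσM le_rfl fun t s ht hs => (hm t s ht hs).trans ?_
  split_ifs with h
  · have h1 : t / s ≤ 1 := (div_le_one hs).mpr h.le
    have h2 : t / s ≤ s / t := h1.trans ((one_le_div ht).mpr h.le)
    rw [min_eq_left h2, max_eq_right h.le, div_self hs.ne', Real.one_rpow]
    simp
  · positivity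

lemma admissible_multPlus {p σ q : ℝ} {B : ℝ≥0} (hp : p ≤ 2)
    (hq : 1 ≤ q) (hqp : q ≤ p) {z : ℂ} (hz : (n : ℝ) * (1 / q - 1 / p) < z.re)
    {F : ℝ × Space n → Val N} (hF : StronglyMeasurable F) (hfin : tentNorm q F < ⊤) :
    Admissible p σ (mulWeight B 1 (multPlus z)) F := by
  refine admissible_of_lt hp hq hqp hz (c := B) (fun t s ht hs hst => ?_)
    (fun t s ht hs hst => ?_) hF hfin
  · refine mul_le_mul_right ((min_le_left _ _).trans (le_of_eq ?_)) _
    rw [← ofReal_norm, norm_multPlus z ht hs, if_pos hst]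
  · simp [mulWeight, multPlus, not_lt.mpr hst]

lemma admissible_multMinus {p σ q : ℝ} {B : ℝ≥0} (hq : q ∈ Icc (1 : ℝ) 2) {z : ℂ}
    (hz : 0 < z.re) {F : ℝ × Space n → Val N} (hF : StronglyMeasurable F)
    (hfin : tentNorm q F < ⊤) : Admissible p σ (mulWeight B 1 (multMinus z)) F := by
  refine admissible_of_gt hq hz (c := B) (fun t s ht hs hst => ?_)
    (fun t s ht hs hst => ?_) hF hfin
  · refine mul_le_mul_right ((min_le_left _ _).trans (le_of_eq ?_)) _
    rw [← ofReal_norm, norm_multMinus z ht hs, if_pos hst]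
  · simp [mulWeight, multMinus, not_lt.mpr hst]

theorem KernelBound.exists_boundedOnTent_kMinus (hn : 0 < n) {p σ M : ℝ} {B : ℝ≥0}
    {K : OpKernel n N} (hK : KernelBound p σ M B K) (hp : 0 < p) (hσ : 0 ≤ σ) (hσM : σ ≤ M)
    (hM : (n : ℝ) / 2 < M) {q : ℝ} (hq : q ∈ Icc (1 : ℝ) 2) {α : ℝ} (hα : 0 < α) :
    ∃ C : ℝ≥0, BoundedOnTent q (kMinus K α) C := by
  have hdom : Dominated p σ (mulWeight B 1 (multMinus (α : ℂ))) (mulK (multMinus α) K) :=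
    hK.dominated (measurable_multMinus _) fun t s ht hs =>
      norm_multMinus_le_one (by simpa using hα.le) ht hs
  have hwm := measurable_mulWeight B 1 (measurable_multMinus (α : ℂ))
  have hw := mulWeight_le B 1 (multMinus (α : ℂ))
  have hloc := hK.localBound_of_gt hσ hσM (m := multMinus (α : ℂ)) (ε := α)
    fun t s ht hs => (norm_multMinus _ ht hs).le
  set W := (B : ℝ≥0∞) * (1 : ℝ≥0) * ENNReal.ofReal ((2 * ((n : ℝ) + 1)) ^ (M - σ)) with hW
  have hWt : W ≠ ⊤ := by finiteness
  obtain ⟨C₁, hC₁⟩ := exists_lintegral_coneSq_image_rpow_half_le hn N hα hM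
  have h1 := hC₁ W p σ _ _ _ hp hloc hdom hwm hw
  have h2 : ∀ F : ℝ × Space n → Val N, IsNice F →
      ∫⁻ x, coneSq (image (mulK (multMinus (α : ℂ)) K) F) x ^ (2 / 2 : ℝ) ≤
        (W * ENNReal.ofReal (2 / α)) ^ 2 * ∫⁻ x, coneSq F x ^ (2 / 2 : ℝ) := by
    intro F hF
    simpa using hloc.lintegral_coneSq_image_le hdom.meas hα hF.meas
  have key : ∃ C : ℝ≥0, ∀ F : ℝ × Space n → Val N, IsNice F →
      ∫⁻ x, coneSq (image (mulK (multMinus (α : ℂ)) K) F) x ^ (q / 2) ≤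
        C * ∫⁻ x, coneSq F x ^ (q / 2) := by
    rcases hq.1.eq_or_lt with rfl | hq1
    · refine ⟨(C₁ * W).toNNReal, fun F hF => ?_⟩
      rw [ENNReal.coe_toNNReal (by finiteness)]
      exact h1 F hF
    · rcases hq.2.eq_or_lt with rfl | hq2
      · refine ⟨((W * ENNReal.ofReal (2 / α)) ^ 2).toNNReal, fun F hF => ?_⟩
        rw [ENNReal.coe_toNNReal (by finiteness)]
        exact h2 F hF
      · obtain ⟨C₂, hC₂⟩ := exists_lintegral_coneSq_image_interpolation hn N hq1 hq2 le_rfl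
        have h3 := hC₂ p σ _ _ _ _ _ hdom hw h1 h2 1 one_pos
        simp only [ENNReal.ofReal_one, ENNReal.one_rpow, one_mul] at h3
        refine ⟨(C₂ * (C₁ * W + (W * ENNReal.ofReal (2 / α)) ^ 2)).toNNReal, fun F hF => ?_⟩
        rw [ENNReal.coe_toNNReal (by finiteness)]
        exact h3 F hF
  obtain ⟨C, hC⟩ := key
  refine ⟨C ^ (1 / q), ?_⟩
  rw [kMinus_eq_mulK]
  exact boundedOnTent_of_isNice hp hq hdom hwm hw
    (fun F hF hfin => admissible_multMinus hq (by simpa using hα) hF hfin) hC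

/-- On `T^{1,2}` the operators with kernel `K⁺_z` are bounded uniformly in `Im z`. -/
theorem KernelBound.exists_boundedOnTent_kPlus (hn : 0 < n) {p M : ℝ} {B : ℝ≥0}
    {K : OpKernel n N} (hK : KernelBound p ((n : ℝ) * (1 / p - 1 / 2)) M B K)
    (hp : p ∈ Icc (1 : ℝ) 2) (hM : (n : ℝ) / 2 < M) {β : ℝ} (hβ : (n : ℝ) * (1 - 1 / p) < β) :
    ∃ C : ℝ≥0, ∀ z : ℂ, z.re = β → BoundedOnTent 1 (kPlus K z) C := by
  have hp0 : 0 < p := by linarith [hp.1]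
  set σ := (n : ℝ) * (1 / p - 1 / 2) with hσdef
  have hip : 1 / 2 ≤ 1 / p := one_div_le_one_div_of_le hp0 hp.2
  have hip1 : 1 / p ≤ 1 := (div_le_one hp0).mpr hp.1
  have hn0 : (0 : ℝ) ≤ n := n.cast_nonneg
  have hσ : 0 ≤ σ := mul_nonneg hn0 (by linarith)
  have hσn : σ + n * (1 - 1 / p) = n / 2 := by rw [hσdef]; ring
  have h1p : 0 ≤ (n : ℝ) * (1 - 1 / p) := mul_nonneg hn0 (by linarith)
  set η := (β - n * (1 - 1 / p)) / 2 with hη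
  have hη0 : 0 < η := by rw [hη]; linarith
  set M' := min M (n / 2 + η) with hM'
  have hM'1 : (n : ℝ) / 2 < M' := lt_min hM (by linarith)
  have hM'2 : M' ≤ n / 2 + η := min_le_right _ _
  obtain ⟨C, hC⟩ := exists_lintegral_coneSq_image_rpow_half_le hn N hη0 hM'1
  set W := (B : ℝ≥0∞) * (1 : ℝ≥0) * ENNReal.ofReal ((2 * ((n : ℝ) + 1)) ^ (M' - σ)) with hW
  have hWt : C * W ≠ ⊤ := by finiteness
  refine ⟨((C * W).toNNReal) ^ (1 / (1 : ℝ)), fun z hz => ?_⟩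
  have hz0 : 0 ≤ z.re := by linarith
  have hdom : Dominated p σ (mulWeight B 1 (multPlus z)) (mulK (multPlus z) K) :=
    hK.dominated (measurable_multPlus _) fun t s ht hs => norm_multPlus_le_one hz0 ht hs
  have hwm := measurable_mulWeight B 1 (measurable_multPlus z)
  have hw := mulWeight_le B 1 (multPlus z)
  have hloc : LocalBound η M' W (mulK (multPlus z) K) :=
    hK.localBound_of_lt hσ (by linarith) (min_le_left _ _) (β := β) (by linarith)
      fun t s ht hs => by
        rw [norm_multPlus z ht hs, hz]
        simp
  rw [kPlus_eq_mulK]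
  refine boundedOnTent_of_isNice hp0 ⟨le_rfl, one_le_two⟩ hdom hwm hw
    (fun F hF hfin => admissible_multPlus hp.2 le_rfl hp.1 ?_ hF hfin) fun F hF => ?_
  · rw [hz, div_one]
    exact hβ
  · rw [ENNReal.coe_toNNReal hWt]
    exact hC W p σ _ _ _ hp0 hloc hdom hwm hw F hF

/-! ### A calculus of bounded multipliers -/

/-- Measurable scalar factors `m(t,s)`, bounded by `D` for `t, s > 0`. -/
structure IsMult (D : ℝ≥0) (m : ℝ → ℝ → ℂ) : Prop where
  meas : Measurable (Function.uncurry m)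
  le : ∀ t s, 0 < t → 0 < s → ‖m t s‖ ≤ D

/-- The operator with kernel `m K` has `T^{q,2}` norm at most `A` on bounded functions of compact
support. -/
def TentBound (q : ℝ) (K : OpKernel n N) (m : ℝ → ℝ → ℂ) (A : ℝ≥0∞) : Prop :=
  ∀ F : ℝ × Space n → Val N, IsNice F → tentNorm q (image (mulK m K) F) ≤ A * tentNorm q F

lemma TentBound.lintegral_le {q : ℝ} (hq : 0 < q) {K : OpKernel n N} {m : ℝ → ℝ → ℂ} {A : ℝ≥0∞}
    (h : TentBound q K m A) {F : ℝ × Space n → Val N} (hF : IsNice F) :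
    ∫⁻ x, coneSq (image (mulK m K) F) x ^ (q / 2) ≤ A ^ q * ∫⁻ x, coneSq F x ^ (q / 2) := by
  have h1 := ENNReal.rpow_le_rpow (h F hF) hq.le
  rw [ENNReal.mul_rpow_of_nonneg _ _ hq.le, tentNorm_eq, tentNorm_eq, ← ENNReal.rpow_mul,
    ← ENNReal.rpow_mul, one_div_mul_cancel hq.ne', ENNReal.rpow_one, ENNReal.rpow_one] at h1
  exact h1

lemma tentBound_of_lintegral_le {q : ℝ} (hq : 0 < q) {K : OpKernel n N} {m : ℝ → ℝ → ℂ} {A : ℝ≥0∞}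
    (h : ∀ F : ℝ × Space n → Val N, IsNice F →
      ∫⁻ x, coneSq (image (mulK m K) F) x ^ (q / 2) ≤ A * ∫⁻ x, coneSq F x ^ (q / 2)) :
    TentBound q K m (A ^ (1 / q)) := by
  intro F hF
  rw [tentNorm_eq, tentNorm_eq, ← ENNReal.mul_rpow_of_nonneg _ _ (by positivity)]
  exact ENNReal.rpow_le_rpow (h F hF) (by positivity)

lemma KernelBound.dominated_const {p σ M : ℝ} {B : ℝ≥0} {K : OpKernel n N}
    (hK : KernelBound p σ M B K) {D : ℝ≥0} {m : ℝ → ℝ → ℂ} (hm : IsMult D m) :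
    Dominated p σ (fun _ _ => ((B * D : ℝ≥0) : ℝ≥0∞)) (mulK m K) := by
  have h := hK.dominated hm.meas hm.le
  exact ⟨h.meas, fun t s ht hs u => (h.le t s ht hs u).trans
    (mul_le_mul_left (mulWeight_le B D m t s) _)⟩

section Calculus

variable {p σ M q : ℝ} {B : ℝ≥0} {K : OpKernel n N}

lemma tentNorm_image_add_le (hK : KernelBound p σ M B K) (hq : 1 ≤ q) {D D' : ℝ≥0}
    {m m' : ℝ → ℝ → ℂ} (hm : IsMult D m) (hm' : IsMult D' m') {F : ℝ × Space n → Val N}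
    (hF : IsNice F) :
    tentNorm q (image (mulK (m + m') K) F) ≤
      tentNorm q (image (mulK m K) F) + tentNorm q (image (mulK m' K) F) := by
  have h1 := (hK.dominated_const hm).isImage hF.meas (hF.admissible fun _ _ => le_rfl)
  have h2 := (hK.dominated_const hm').isImage hF.meas (hF.admissible fun _ _ => le_rfl)
  have hadd : mulK (m + m') K = mulK m K + mulK m' K := by
    funext t s
    simp [mulK, add_smul]
  have h0 : StronglyMeas (mulK (m + m') K) := hK.meas.mulK (hm.meas.add hm'.meas)
  rw [hadd] at h0 ⊢
  have h3 := (h1.add h2).ae_eq_image h0 hF.meas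
    ((stronglyMeasurable_image _ _).add (stronglyMeasurable_image _ _)).aestronglyMeasurable
  rw [← tentNorm_congr_ae q h3]
  exact tentNorm_add_le hq (stronglyMeasurable_image _ _) (stronglyMeasurable_image _ _)

lemma IsMult.sum {ι : Type*} {D : ι → ℝ≥0} {m : ι → ℝ → ℝ → ℂ} (h : ∀ i, IsMult (D i) (m i))
    (S : Finset ι) : IsMult (∑ i ∈ S, D i) (fun t s => ∑ i ∈ S, m i t s) := by
  refine ⟨Finset.measurable_fun_sum S fun i _ => (h i).meas, fun t s ht hs => ?_⟩
  push_cast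
  exact (norm_sum_le _ _).trans (Finset.sum_le_sum fun i _ => (h i).le t s ht hs)

lemma tentNorm_zero (hq : 0 < q) : tentNorm q (0 : ℝ × Space n → Val N) = 0 := by
  simp [tentNorm, hq]

lemma tentBound_sum (hK : KernelBound p σ M B K) (hq : 1 ≤ q) {ι : Type*} {D : ι → ℝ≥0}
    {m : ι → ℝ → ℝ → ℂ} (h : ∀ i, IsMult (D i) (m i)) {A : ι → ℝ≥0∞}
    (hA : ∀ i, TentBound q K (m i) (A i)) (S : Finset ι) :
    TentBound q K (fun t s => ∑ i ∈ S, m i t s) (∑ i ∈ S, A i) := by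
  classical
  intro F hF
  induction S using Finset.induction_on with
  | empty =>
    have h0 : op (mulK (fun t s => ∑ i ∈ (∅ : Finset ι), m i t s) K) F = 0 := by
      ext1 t
      simp [op, mulK]
    rw [image, h0, tentNorm_congr_ae q jointRep_zero, tentNorm_zero (by linarith)]
    exact zero_le
  | insert i S hi ih =>
    simp only [Finset.sum_insert hi, add_mul]
    exact (tentNorm_image_add_le hK hq (h i) (IsMult.sum h S) hF).trans (add_le_add (hA i F hF) ih)

open Filter Topology in
lemma tentNorm_image_le_of_tendsto (hp : 0 < p) (hq : 0 < q) (hK : KernelBound p σ M B K) {D : ℝ≥0}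
    {m : ℝ → ℝ → ℂ} {ms : ℕ → ℝ → ℝ → ℂ} (hm : IsMult D m) (hms : ∀ k, IsMult D (ms k))
    (hlim : ∀ t s, 0 < t → 0 < s → Tendsto (fun k => ms k t s) atTop (𝓝 (m t s)))
    {F : ℝ × Space n → Val N} (hF : IsNice F) {A : ℝ≥0∞}
    (hA : ∀ k, tentNorm q (image (mulK (ms k) K) F) ≤ A) :
    tentNorm q (image (mulK m K) F) ≤ A := by
  have h1 := tendsto_op hp (w := fun _ _ => ((B * D : ℝ≥0) : ℝ≥0∞)) (fun _ => measurable_const)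
    (fun _ _ => ENNReal.coe_ne_top) (κ := mulK m K) (fun k => hK.dominated_const (hms k)) hF.meas
    (Fs := fun _ => F) (fun _ => hF.meas) (fun _ _ => le_rfl) (fun _ _ => tendsto_const_nhds)
    (fun t s ht hs u => (hlim t s ht hs).smul_const (K t s u)) (hF.admissible fun _ _ => le_rfl)
  have h2 := lintegral_coneSq_image_le_of_tendsto (hK.meas.mulK hm.meas)
    (fun k => hK.meas.mulK (hms k).meas) hF.meas (fun _ => hF.meas) h1 (r := q / 2) (by positivity)
    (B := A ^ q) fun k => by
      have := ENNReal.rpow_le_rpow (hA k) hq.le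
      rwa [tentNorm_eq, ← ENNReal.rpow_mul, one_div_mul_cancel hq.ne', ENNReal.rpow_one] at this
  rw [tentNorm_eq]
  refine (ENNReal.rpow_le_rpow h2 (by positivity)).trans (le_of_eq ?_)
  rw [← ENNReal.rpow_mul, mul_one_div_cancel hq.ne', ENNReal.rpow_one]

lemma tentNorm_le_mul {F G : ℝ × Space n → Val N} {c : ℝ≥0} (hq : 0 < q)
    (h : ∀ᵐ z ∂(volume.restrict (halfSpace n)), ‖F z‖ ≤ c * ‖G z‖) :
    tentNorm q F ≤ c * tentNorm q G := by
  have h1 : ∀ x, coneSq F x ≤ (c : ℝ≥0∞) ^ 2 * coneSq G x := by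
    intro x
    rw [coneSq, coneSq, ← lintegral_const_mul' _ _ (by finiteness)]
    refine lintegral_mono_ae ?_
    filter_upwards [ae_restrict_of_ae_restrict_of_subset (cone_subset_halfSpace x) h] with z hz
    rw [← mul_div_assoc, ← mul_pow]
    gcongr
    rw [← ofReal_norm, ← ofReal_norm, ← ENNReal.ofReal_coe_nnreal,
      ← ENNReal.ofReal_mul (NNReal.coe_nonneg c)]
    exact ENNReal.ofReal_le_ofReal hz
  rw [tentNorm_eq, tentNorm_eq]
  calc (∫⁻ x, coneSq F x ^ (q / 2)) ^ (1 / q)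
      ≤ (∫⁻ x, (c : ℝ≥0∞) ^ q * coneSq G x ^ (q / 2)) ^ (1 / q) := by
        refine ENNReal.rpow_le_rpow (lintegral_mono fun x => ?_) (by positivity)
        refine (ENNReal.rpow_le_rpow (h1 x) (by positivity)).trans (le_of_eq ?_)
        rw [ENNReal.mul_rpow_of_nonneg _ _ (by positivity), ← ENNReal.rpow_natCast,
          ← ENNReal.rpow_mul]
        congr 2
        push_cast
        ring
    _ = c * (∫⁻ x, coneSq G x ^ (q / 2)) ^ (1 / q) := by
        rw [lintegral_const_mul' _ _ (by finiteness), ENNReal.mul_rpow_of_nonneg _ _ (by positivity),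
          ← ENNReal.rpow_mul, mul_one_div_cancel hq.ne', ENNReal.rpow_one]

/-- Multiplication by bounded functions of the heights, before and after the operator. -/
lemma TentBound.twist (hK : KernelBound p σ M B K) (hq : 0 < q) {D : ℝ≥0} {m : ℝ → ℝ → ℂ}
    (hm : IsMult D m) {A : ℝ≥0∞} (h : TentBound q K m A) {a b : ℝ → ℂ} {Ca Cb : ℝ≥0}
    (ha : Measurable a) (hb : Measurable b) (hCa : ∀ t, ‖a t‖ ≤ Ca) (hCb : ∀ s, ‖b s‖ ≤ Cb) :
    TentBound q K (fun t s => a t * b s * m t s) (Ca * Cb * A) := by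
  intro F hF
  set F' : ℝ × Space n → Val N := fun z => b z.1 • F z with hF'def
  have ham : StronglyMeasurable fun z : ℝ × Space n => a z.1 :=
    (ha.comp measurable_fst).stronglyMeasurable
  have hbm : StronglyMeasurable fun z : ℝ × Space n => b z.1 :=
    (hb.comp measurable_fst).stronglyMeasurable
  have hF'm : StronglyMeasurable F' := hbm.smul hF.meas
  have hF' : IsNice F' := hF.of_le hF'm (c := Cb) fun z => by
    show ‖b z.1 • F z‖ ≤ _
    rw [norm_smul]
    exact mul_le_mul_of_nonneg_right (hCb _) (norm_nonneg _)
  have hslice : ∀ s, slice F' s = b s • slice F s := fun s => by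
    rw [slice_of_memLp (hF'.memLp_slice s), slice_of_memLp (hF.memLp_slice s)]
    exact MemLp.toLp_const_smul (b s) (hF.memLp_slice s)
  have hop : ∀ t, op (mulK (fun t s => a t * b s * m t s) K) F t = a t • op (mulK m K) F' t := by
    intro t
    rw [op, op, ← integral_smul]
    refine integral_congr_ae (Filter.Eventually.of_forall fun s => ?_)
    simp only [mulK, hslice, smul_apply, map_smul]
    rw [smul_comm (a t) s⁻¹]
    congr 1
    simp only [smul_smul, mul_assoc]
  have hmeas : Measurable (Function.uncurry fun t s => a t * b s * m t s) :=
    ((ha.comp measurable_fst).mul (hb.comp measurable_snd)).mul hm.meas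
  have hae : image (mulK (fun t s => a t * b s * m t s) K) F =ᵐ[volume.restrict (halfSpace n)]
      fun z => a z.1 • image (mulK m K) F' z := by
    refine ae_halfSpace_of_ae_ae ((stronglyMeasurable_image _ _).measurableSet_eq_fun
      (ham.smul (stronglyMeasurable_image _ _))) ?_
    rw [← ae_dlog]
    filter_upwards [image_ae (hK.meas.mulK hmeas) hF.meas, image_ae (hK.meas.mulK hm.meas) hF'm]
      with t h1 h2
    filter_upwards [h1, h2, Lp.coeFn_smul (a t) (op (mulK m K) F' t)] with y h3 h4 h5
    rw [h3, hop, h5, Pi.smul_apply, h4]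
  rw [tentNorm_congr_ae q hae]
  calc tentNorm q (fun z => a z.1 • image (mulK m K) F' z)
      ≤ Ca * tentNorm q (image (mulK m K) F') :=
        tentNorm_le_mul hq (Filter.Eventually.of_forall fun z => by
          rw [norm_smul]
          exact mul_le_mul_of_nonneg_right (hCa _) (norm_nonneg _))
    _ ≤ Ca * (A * (Cb * tentNorm q F)) := by
        refine mul_le_mul_right ((h F' hF').trans (mul_le_mul_right ?_ _)) _
        exact tentNorm_le_mul hq (Filter.Eventually.of_forall fun z => by
          show ‖b z.1 • F z‖ ≤ _
          rw [norm_smul]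
          exact mul_le_mul_of_nonneg_right (hCb _) (norm_nonneg _))
    _ = Ca * Cb * A * tentNorm q F := by ring

open Filter Topology in
/-- A bound on test functions extends to bounded functions of compact support: approximate in `L²`
within a fixed compact box, where the `L²` norm controls the tent norm. -/
lemma tentBound_of_isTest (hK : KernelBound p σ M B K) (hq : q ∈ Icc (1 : ℝ) 2)
    {D : ℝ≥0} {m : ℝ → ℝ → ℂ} (hm : IsMult D m) {A : ℝ≥0}
    (h : ∀ φ : ℝ × Space n → Val N, IsTest φ →
      tentNorm q (image (mulK m K) φ) ≤ A * tentNorm q φ) : TentBound q K m A := by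
  intro F hF
  have hq0 : 0 < q := by linarith [hq.1]
  obtain ⟨a, b, R, ha, hab, hR, hFs, happ⟩ := hF.exists_isTest
  obtain ⟨C₀, hC₀⟩ := exists_lintegral_coneSq_rpow_le_of_box (n := n) (N := N) (b := b) (R := R) ha
    (r := q / 2) (by positivity) (by linarith [hq.2])
  have hκ := hK.dominated_const hm
  set κ := mulK m K with hκdef
  choose φ hφ hφs hφd using fun k : ℕ => happ ((1 / 2) ^ k) (by positivity)
  have hsub : ∀ k z, (F - φ k) z ≠ 0 → z ∈ box n a b R := by
    intro k z hz
    by_cases h0 : F z = 0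
    · exact hφs k z fun h' => hz (by simp [h0, h'])
    · exact hFs z h0
  have hnice : ∀ k, IsNice (F - φ k) := fun k => by
    have h1 : IsNice (-(φ k)) := (hφ k).isNice.of_le (hφ k).isNice.meas.neg (c := 1) fun z => by
      simp
    rw [sub_eq_add_neg]
    exact hF.add h1
  have hsmall : Tendsto (fun k : ℕ => ENNReal.ofReal ((1 / 2) ^ k)) atTop (𝓝 0) := by
    have := ENNReal.tendsto_ofReal (tendsto_pow_atTop_nhds_zero_of_lt_one
      (show (0 : ℝ) ≤ 1 / 2 by norm_num) (by norm_num))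
    simpa using this
  -- the images of the approximants converge at every height
  have hop : ∀ᵐ t ∂dlog, Tendsto (fun k => op κ (φ k) t) atTop (𝓝 (op κ F t)) := by
    have hadd : ∀ᵐ t ∂dlog, ∀ k, op κ F t = op κ (F - φ k) t + op κ (φ k) t := by
      refine ae_all_iff.mpr fun k => ?_
      have h1 := op_add hκ (hnice k).meas (hφ k).isNice.meas
        ((hnice k).admissible fun _ _ => le_rfl) ((hφ k).isNice.admissible fun _ _ => le_rfl)
      simpa using h1
    filter_upwards [hadd, ae_dlog_pos] with t ht ht0
    set X := dlog (Icc a b) ^ (1 / 2 : ℝ) * ENNReal.ofReal a⁻¹ ^ (1 / 2 : ℝ) with hX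
    have hXt : X ≠ ⊤ := ENNReal.mul_ne_top
      (ENNReal.rpow_ne_top_of_nonneg (by norm_num) (dlog_Icc_lt_top ha).ne)
      (ENNReal.rpow_ne_top_of_nonneg (by norm_num) (by simp))
    have hbound : ∀ k, ‖op κ (F - φ k) t‖ₑ ≤
        (B * D : ℝ≥0) * X * ENNReal.ofReal ((1 / 2) ^ k) := by
      intro k
      set f : ℝ → ℝ≥0∞ := fun s => ‖slice (F - φ k) s‖ₑ with hf
      have hfm : Measurable f := (stronglyMeasurable_slice (hnice k).meas).enorm
      have hfs : ∀ s, f s ^ 2 = ∫⁻ y, ‖(F - φ k) (s, y)‖ₑ ^ 2 := fun s => by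
        rw [hf, lintegral_enorm_sq_eq, ← enorm_slice ((hnice k).memLp_slice s)]
      have hf0 : ∀ s ∉ Icc a b, f s = 0 := fun s hs => by
        have h0 : ∀ y, (F - φ k) (s, y) = 0 := fun y => by
          by_contra h'
          exact hs (hsub k _ h').1
        have h1 := hfs s
        simp only [h0, enorm_zero, ne_eq, OfNat.ofNat_ne_zero, not_false_eq_true, zero_pow,
          lintegral_zero] at h1
        exact pow_eq_zero_iff (two_ne_zero) |>.mp h1
      have hcs : ∫⁻ s, f s ∂dlog ≤ (∫⁻ s, f s ^ 2 ∂dlog) ^ (1 / 2 : ℝ) *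
          dlog (Icc a b) ^ (1 / 2 : ℝ) := by
        have h1 : ∫⁻ s, f s ∂dlog = ∫⁻ s in Icc a b, (f s ^ 2) ^ (1 / 2 : ℝ) ∂dlog := by
          rw [← lintegral_indicator measurableSet_Icc]
          refine lintegral_congr fun s => ?_
          by_cases hs : s ∈ Icc a b
          · rw [indicator_of_mem hs, rpow_half_sq]
          · rw [indicator_of_notMem hs, hf0 s hs]
        rw [h1]
        refine (lintegral_rpow_le_of_le_one (hfm.pow_const 2).aemeasurable (by norm_num)
          (by norm_num)).trans ?_
        rw [Measure.restrict_apply_univ, show (1 : ℝ) - 1 / 2 = 1 / 2 by norm_num]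
        exact mul_le_mul_left (ENNReal.rpow_le_rpow (setLIntegral_le_lintegral _ _)
          (by norm_num)) _
      have hen : ∫⁻ s, f s ^ 2 ∂dlog ≤ ENNReal.ofReal a⁻¹ * ENNReal.ofReal ((1 / 2) ^ k) ^ 2 := by
        calc ∫⁻ s, f s ^ 2 ∂dlog ≤ ∫⁻ s in Ioi 0, ENNReal.ofReal a⁻¹ * f s ^ 2 := by
              rw [lintegral_dlog]
              refine lintegral_mono fun s => ?_
              by_cases hs : s ∈ Icc a b
              · exact mul_le_mul_left (ENNReal.ofReal_le_ofReal (inv_anti₀ ha hs.1)) _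
              · simp [hf0 s hs]
          _ ≤ ENNReal.ofReal a⁻¹ * ∫⁻ s, f s ^ 2 := by
              rw [lintegral_const_mul' _ _ (by simp)]
              exact mul_le_mul_right (setLIntegral_le_lintegral _ _) _
          _ = ENNReal.ofReal a⁻¹ * ∫⁻ z, ‖(F - φ k) z‖ₑ ^ 2 := by
              simp_rw [hfs]
              rw [Measure.volume_eq_prod, lintegral_prod _
                ((hnice k).meas.enorm.pow_const 2).aemeasurable]
          _ ≤ _ := mul_le_mul_right (hφd k) _
      calc ‖op κ (F - φ k) t‖ₑ ≤ ∫⁻ s, ‖κ t s (slice (F - φ k) s)‖ₑ ∂dlog := enorm_op_le _ _ _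
        _ ≤ ∫⁻ s, (B * D : ℝ≥0) * f s ∂dlog := by
            refine lintegral_mono_ae ?_
            filter_upwards [ae_dlog_pos] with s hs using hκ.le_two ht0 hs _
        _ = (B * D : ℝ≥0) * ∫⁻ s, f s ∂dlog := lintegral_const_mul' _ _ ENNReal.coe_ne_top
        _ ≤ (B * D : ℝ≥0) * ((ENNReal.ofReal a⁻¹ * ENNReal.ofReal ((1 / 2) ^ k) ^ 2) ^ (1 / 2 : ℝ) *
              dlog (Icc a b) ^ (1 / 2 : ℝ)) := by
            refine mul_le_mul_right (hcs.trans (mul_le_mul_left ?_ _)) _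
            exact ENNReal.rpow_le_rpow hen (by norm_num)
        _ = _ := by
            rw [ENNReal.mul_rpow_of_nonneg _ _ (by norm_num), rpow_half_sq, hX]
            ring
    rw [tendsto_iff_edist_tendsto_0]
    have h0 : Tendsto (fun k : ℕ => (B * D : ℝ≥0) * X * ENNReal.ofReal ((1 / 2) ^ k)) atTop
        (𝓝 0) := by
      have := ENNReal.Tendsto.const_mul (a := (B * D : ℝ≥0) * X) hsmall
        (Or.inr (ENNReal.mul_ne_top ENNReal.coe_ne_top hXt))
      simpa using this
    refine tendsto_of_tendsto_of_tendsto_of_le_of_le tendsto_const_nhds h0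
      (fun _ => zero_le) fun k => ?_
    simp only
    rw [edist_comm, edist_eq_enorm_sub, ht k, add_sub_cancel_right]
    exact hbound k
  -- the norms of the approximants are eventually at most `‖F‖ + η`
  have hnorm : ∀ η : ℝ≥0, 0 < η → tentNorm q (image κ F) ≤ A * (tentNorm q F + η) := by
    intro η hη
    have h1 : Tendsto (fun k : ℕ => (C₀ * (ENNReal.ofReal ((1 / 2) ^ k) ^ 2) ^ (q / 2)) ^ (1 / q))
        atTop (𝓝 0) := by
      have h2 := (ENNReal.continuous_pow 2).tendsto 0 |>.comp hsmall
      have h3 := (ENNReal.continuous_rpow_const (y := q / 2)).tendsto _ |>.comp h2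
      have h4 := ENNReal.Tendsto.const_mul (a := C₀) h3 (Or.inr (by simp))
      have h5 := (ENNReal.continuous_rpow_const (y := 1 / q)).tendsto _ |>.comp h4
      rw [zero_pow two_ne_zero, ENNReal.zero_rpow_of_pos (by positivity), mul_zero,
        ENNReal.zero_rpow_of_pos (by positivity)] at h5
      exact h5
    obtain ⟨k₀, hk₀⟩ := eventually_atTop.mp
      (h1.eventually (gt_mem_nhds (show (0 : ℝ≥0∞) < η by exact_mod_cast hη)))
    have h2 : ∀ k, tentNorm q (φ (k + k₀)) ≤ tentNorm q F + η := by
      intro k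
      set j := k + k₀
      have h3 : tentNorm q (φ j - F) ≤ η := by
        refine le_trans ?_ (hk₀ j (Nat.le_add_left _ _)).le
        rw [tentNorm_eq]
        refine ENNReal.rpow_le_rpow ?_ (by positivity)
        refine (hC₀ (φ j - F) ((hφ j).isNice.meas.sub hF.meas) fun z hz => hsub j z fun h' =>
          hz ?_).trans (mul_le_mul_right (ENNReal.rpow_le_rpow ?_ (by positivity)) _)
        · have : (φ j - F) z = -((F - φ j) z) := by simp
          rw [this, h', neg_zero]
        · refine le_trans (le_of_eq ?_) (hφd j)
          refine lintegral_congr fun z => ?_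
          have : (φ j - F) z = -((F - φ j) z) := by simp
          rw [this, enorm_neg]
      have h4 : φ j = F + (φ j - F) := by abel
      rw [h4]
      exact (tentNorm_add_le hq.1 hF.meas ((hφ j).isNice.meas.sub hF.meas)).trans
        (add_le_add le_rfl h3)
    have h3 := lintegral_coneSq_image_le_of_tendsto hκ.meas (fun _ => hκ.meas) hF.meas
      (Fs := fun k => φ (k + k₀)) (fun k => (hφ _).isNice.meas)
      (by filter_upwards [hop] with t ht using ht.comp (tendsto_add_atTop_nat k₀))
      (r := q / 2) (by positivity) (B := (A * (tentNorm q F + η)) ^ q) fun k => by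
        have h4 := ENNReal.rpow_le_rpow ((h _ (hφ (k + k₀))).trans (mul_le_mul_right (h2 k) _)) hq0.le
        rwa [tentNorm_eq, ← ENNReal.rpow_mul, one_div_mul_cancel hq0.ne', ENNReal.rpow_one] at h4
    rw [tentNorm_eq q (image κ F)]
    refine (ENNReal.rpow_le_rpow h3 (by positivity)).trans (le_of_eq ?_)
    rw [← ENNReal.rpow_mul, mul_one_div_cancel hq0.ne', ENNReal.rpow_one]
  refine ENNReal.le_of_forall_pos_le_add fun ε hε _ => ?_
  refine (hnorm (ε / (A + 1)) (by positivity)).trans ?_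
  rw [mul_add]
  refine add_le_add le_rfl ?_
  rw [← ENNReal.coe_mul, ENNReal.coe_le_coe, mul_div_assoc', div_le_iff₀ (by positivity), mul_comm]
  exact mul_le_mul_right (le_add_of_nonneg_right zero_le_one) _

end Calculus

/-! ### Logarithmic shells -/

/-- The part of the scalar factor of `K⁺_β` on which `⌊log t⌋ - ⌊log s⌋ = j`. -/
def multShell (β : ℝ) (j : ℕ) (t s : ℝ) : ℂ :=
  if ⌊Real.log t⌋ - ⌊Real.log s⌋ = j then multPlus β t s else 0

lemma isMult_multPlus {β : ℝ} (hβ : 0 ≤ β) : IsMult 1 (multPlus (β : ℂ)) :=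
  ⟨measurable_multPlus _, fun _ _ ht hs => norm_multPlus_le_one (by simpa using hβ) ht hs⟩

lemma isMult_multShell {β : ℝ} (hβ : 0 ≤ β) (j : ℕ) : IsMult 1 (multShell β j) := by
  refine ⟨Measurable.ite ?_ (measurable_multPlus _) measurable_const, fun t s ht hs => ?_⟩
  · have h : Measurable fun z : ℝ × ℝ => ⌊Real.log z.1⌋ - ⌊Real.log z.2⌋ := by fun_prop
    exact h (measurableSet_singleton _)
  · unfold multShell
    split_ifs
    · exact (isMult_multPlus hβ).le t s ht hs
    · simp

lemma sum_multShell (β : ℝ) (J : ℕ) {t s : ℝ} (hs : 0 < s) :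
    ∑ j ∈ Finset.range J, multShell β j t s =
      if ⌊Real.log t⌋ - ⌊Real.log s⌋ < J then multPlus β t s else 0 := by
  by_cases hst : s < t
  · have h0 : 0 ≤ ⌊Real.log t⌋ - ⌊Real.log s⌋ :=
      sub_nonneg.mpr (Int.floor_mono (Real.log_le_log hs hst.le))
    simp only [multShell]
    lift ⌊Real.log t⌋ - ⌊Real.log s⌋ to ℕ using h0 with d
    simp [Finset.sum_ite_eq]
  · simp [multShell, multPlus, hst]

/-- The exponent of `s/t` on the shell `⌊log t⌋ - ⌊log s⌋ = j`. -/
lemma log_div_of_floor_sub {t s : ℝ} (ht : 0 < t) (hs : 0 < s) {j : ℕ}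
    (h : ⌊Real.log t⌋ - ⌊Real.log s⌋ = j) :
    Real.log (s / t) = Int.fract (Real.log s) - Int.fract (Real.log t) - j := by
  have h1 : ((⌊Real.log t⌋ : ℤ) : ℝ) - ⌊Real.log s⌋ = j := by exact_mod_cast h
  rw [Real.log_div hs.ne' ht.ne', Int.fract, Int.fract]
  linarith

lemma norm_multShell_le (β β₀ : ℝ) (j : ℕ) {t s : ℝ} (ht : 0 < t) (hs : 0 < s) :
    ‖multShell β j t s‖ ≤
      Real.exp (|β₀ - β| + j * (β₀ - β)) * if s < t then (s / t) ^ β₀ else 0 := by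
  unfold multShell
  split_ifs with h hst hst
  · rw [norm_multPlus _ ht hs, if_pos hst, Complex.ofReal_re]
    have h1 := log_div_of_floor_sub ht hs h
    have h2 : 0 < s / t := by positivity
    rw [Real.rpow_def_of_pos h2, Real.rpow_def_of_pos h2, ← Real.exp_add, Real.exp_le_exp, h1]
    have ha := Int.fract_nonneg (Real.log s)
    have hb := Int.fract_nonneg (Real.log t)
    have hc := (Int.fract_lt_one (Real.log s)).le
    have hd := (Int.fract_lt_one (Real.log t)).le
    have h3 : -(|β₀ - β|) ≤ (β₀ - β) * (Int.fract (Real.log s) - Int.fract (Real.log t)) := by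
      refine neg_le_of_abs_le ?_
      rw [abs_mul]
      exact mul_le_of_le_one_right (abs_nonneg _) (abs_le.mpr ⟨by linarith, by linarith⟩)
    nlinarith
  · rw [norm_multPlus _ ht hs, if_neg hst]
    simp
  · rw [norm_zero]; positivity
  · simp

/-- Discrete Fourier inversion on `ℤ/L`. -/
lemma sum_pow_zpow_of_lt {L : ℕ} {ζ : ℂ} (hζ : IsPrimitiveRoot ζ L) (d : ℤ) (hd : |d| < L) :
    ∑ k ∈ Finset.range L, (ζ ^ d) ^ k = if d = 0 then (L : ℂ) else 0 := by
  split_ifs with h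
  · simp [h]
  · have h1 : ζ ^ d ≠ 1 := fun h1 =>
      h (Int.eq_zero_of_abs_lt_dvd ((hζ.zpow_eq_one_iff_dvd d).mp h1) hd)
    have h2 : (ζ ^ d) ^ L = 1 := by
      rw [← zpow_natCast, ← zpow_mul, mul_comm, zpow_mul, zpow_natCast, hζ.pow_eq_one, one_zpow]
    rw [geom_sum_eq h1, h2, sub_self, zero_div]

section Shell

variable {p σ M q : ℝ} {B : ℝ≥0} {K : OpKernel n N}

open Filter Topology in
/-- The norm on a shell decays like `e^{-βj}`. The indicator of `⌊log t⌋ - ⌊log s⌋ = j` is a limit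
of averages of characters in `⌊log t⌋` and `⌊log s⌋`, and on the shell `(s/t)^β` is `e^{-βj}` times a
function of `t` and a function of `s`. -/
lemma tentBound_multShell (hK : KernelBound p σ M B K) (hp : 0 < p) (hq : 1 ≤ q) {C : ℝ≥0}
    (h : TentBound q K (multPlus 0) C) {β : ℝ} (hβ : 0 ≤ β) (j : ℕ) :
    TentBound q K (multShell β j) (ENNReal.ofReal (Real.exp (β * (1 - j))) * C) := by
  have hq0 : 0 < q := by linarith
  have hm0 : IsMult 1 (multPlus 0) := by simpa using isMult_multPlus le_rfl
  set D : ℝ≥0 := (Real.exp (β * (1 - j))).toNNReal with hD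
  have hDr : (D : ℝ) = Real.exp (β * (1 - j)) := Real.coe_toNNReal _ (Real.exp_pos _).le
  set ζ : ℕ → ℂ := fun L => Complex.exp (2 * Real.pi * Complex.I / ((L + 1 : ℕ) : ℂ)) with hζdef
  have hζ : ∀ L, IsPrimitiveRoot (ζ L) (L + 1) := fun L =>
    Complex.isPrimitiveRoot_exp (L + 1) L.succ_ne_zero
  have hζ1 : ∀ L, ‖ζ L‖ = 1 := fun L => (hζ L).norm'_eq_one L.succ_ne_zero
  set a : ℕ → ℕ → ℝ → ℂ := fun L k t => ((D / (L + 1) * Real.exp (-β * Int.fract (Real.log t)) : ℝ) : ℂ)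
    * (ζ L ^ (⌊Real.log t⌋ - j)) ^ k with ha
  set b : ℕ → ℕ → ℝ → ℂ := fun L k s => ((Real.exp (β * (Int.fract (Real.log s) - 1)) : ℝ) : ℂ)
    * (ζ L ^ (-⌊Real.log s⌋)) ^ k with hb
  have ham : ∀ L k, Measurable (a L k) := fun L k => by
    have h1 : Measurable fun i : ℤ => (ζ L ^ (i - j)) ^ k := measurable_of_countable _
    have h2 := h1.comp (Int.measurable_floor.comp Real.measurable_log)
    exact Measurable.mul (by fun_prop) h2
  have hbm : ∀ L k, Measurable (b L k) := fun L k => by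
    have h1 : Measurable fun i : ℤ => (ζ L ^ (-i)) ^ k := measurable_of_countable _
    have h2 := h1.comp (Int.measurable_floor.comp Real.measurable_log)
    exact Measurable.mul (by fun_prop) h2
  have hal : ∀ L k t, ‖a L k t‖ ≤ (D / (L + 1) : ℝ≥0) := fun L k t => by
    rw [ha]
    simp only
    rw [norm_mul, norm_pow, norm_zpow, hζ1, one_zpow, one_pow, mul_one, Complex.norm_real,
      Real.norm_of_nonneg (by positivity)]
    push_cast
    refine mul_le_of_le_one_right (by positivity) (Real.exp_le_one_iff.mpr ?_)
    nlinarith [Int.fract_nonneg (Real.log t)]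
  have hbl : ∀ L k s, ‖b L k s‖ ≤ (1 : ℝ≥0) := fun L k s => by
    rw [hb]
    simp only
    rw [norm_mul, norm_pow, norm_zpow, hζ1, one_zpow, one_pow, mul_one, Complex.norm_real,
      Real.norm_of_nonneg (by positivity)]
    refine Real.exp_le_one_iff.mpr ?_
    nlinarith [(Int.fract_lt_one (Real.log s)).le]
  have hmult : ∀ L k : ℕ, IsMult (D / (L + 1)) fun t s => a L k t * b L k s * multPlus 0 t s :=
    fun L k => ⟨(((ham L k).comp measurable_fst).mul ((hbm L k).comp measurable_snd)).mul hm0.meas,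
      fun t s ht hs => by
        rw [norm_mul, norm_mul]
        have h1 := hm0.le t s ht hs
        have h2 := hbl L k s
        rw [NNReal.coe_one] at h1 h2
        calc ‖a L k t‖ * ‖b L k s‖ * ‖multPlus 0 t s‖ ≤ (D / (L + 1) : ℝ≥0) * 1 * 1 := by
              gcongr
              exact hal L k t
          _ = _ := by ring⟩
  have hsumD : ∀ L : ℕ, ∑ _k ∈ Finset.range (L + 1), D / ((L : ℝ≥0) + 1) = D := fun L => by
    rw [Finset.sum_const, Finset.card_range, nsmul_eq_mul]
    push_cast
    exact mul_div_cancel₀ _ (by positivity)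
  have hms : ∀ L : ℕ, IsMult D fun t s =>
      ∑ k ∈ Finset.range (L + 1), a L k t * b L k s * multPlus 0 t s := fun L => by
    have := IsMult.sum (hmult L) (Finset.range (L + 1))
    rwa [hsumD] at this
  have hlim : ∀ t s, 0 < t → 0 < s → Tendsto (fun L : ℕ =>
      ∑ k ∈ Finset.range (L + 1), a L k t * b L k s * multPlus 0 t s) atTop
      (𝓝 (multShell β j t s)) := by
    intro t s ht hs
    refine tendsto_const_nhds.congr' ?_
    set d : ℤ := ⌊Real.log t⌋ - ⌊Real.log s⌋ - j with hd
    filter_upwards [eventually_ge_atTop d.natAbs] with L hL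
    have hdL : |d| < ((L + 1 : ℕ) : ℤ) := by
      rw [Int.abs_eq_natAbs]
      exact_mod_cast Nat.lt_succ_of_le hL
    have h0 : ζ L ≠ 0 := (hζ L).ne_zero L.succ_ne_zero
    have h1 : ∀ k, a L k t * b L k s * multPlus 0 t s =
        ((D / (L + 1) * Real.exp (-β * Int.fract (Real.log t)) *
          Real.exp (β * (Int.fract (Real.log s) - 1)) : ℝ) : ℂ) * multPlus 0 t s *
          (ζ L ^ d) ^ k := fun k => by
      have h2 : ζ L ^ d = ζ L ^ (⌊Real.log t⌋ - j) * ζ L ^ (-⌊Real.log s⌋) := by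
        rw [← zpow_add₀ h0, hd]
        congr 1
        ring
      rw [h2, mul_pow, ha, hb]
      push_cast
      ring
    rw [Finset.sum_congr rfl fun k _ => h1 k, ← Finset.mul_sum, sum_pow_zpow_of_lt (hζ L) d hdL]
    by_cases hd0 : d = 0
    · have h2 : ⌊Real.log t⌋ - ⌊Real.log s⌋ = j := by linarith
      rw [if_pos hd0, multShell, if_pos h2, multPlus, multPlus]
      split_ifs with hst
      · have h3 : 0 < s / t := by positivity
        rw [Complex.cpow_zero, mul_one, ← Complex.ofReal_cpow h3.le, Real.rpow_def_of_pos h3,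
          log_div_of_floor_sub ht hs h2, hDr]
        have h4 : (0 : ℝ) < L + 1 := by positivity
        rw [show (((L + 1 : ℕ) : ℂ)) = (((L : ℝ) + 1 : ℝ) : ℂ) by push_cast; ring,
          ← Complex.ofReal_mul]
        congr 1
        rw [div_mul_eq_mul_div, div_mul_eq_mul_div, div_mul_cancel₀ _ h4.ne', ← Real.exp_add,
          ← Real.exp_add]
        congr 1
        ring
      · simp
    · have h2 : ¬ ⌊Real.log t⌋ - ⌊Real.log s⌋ = j := fun h2 => hd0 (by rw [hd, h2, sub_self])
      rw [if_neg hd0, multShell, if_neg h2, mul_zero]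
  have hshell : IsMult D (multShell β j) := ⟨(isMult_multShell hβ j).meas, fun t s ht hs =>
    le_of_tendsto (hlim t s ht hs).norm (Eventually.of_forall fun L => (hms L).le t s ht hs)⟩
  intro F hF
  refine tentNorm_image_le_of_tendsto hp hq0 hK hshell hms hlim hF fun L => ?_
  refine (tentBound_sum hK hq (hmult L) (fun k => TentBound.twist hK hq0 hm0 h (ham L k) (hbm L k)
    (hal L k) (hbl L k)) (Finset.range (L + 1)) F hF).trans (mul_le_mul_left (le_of_eq ?_) _)
  rw [← Finset.sum_mul, ← Finset.sum_mul, ← ENNReal.ofNNReal_finsetSum, hsumD, ENNReal.coe_one,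
    mul_one]
  rfl

open Filter Topology in
lemma tentBound_multPlus_of_multShell (hK : KernelBound p σ M B K) (hp : 0 < p) (hq : 1 ≤ q) {β : ℝ}
    (hβ : 0 ≤ β) {A ρ : ℝ≥0∞}
    (h : ∀ j, TentBound q K (multShell β j) (A * ρ ^ j)) :
    TentBound q K (multPlus β) (A * (1 - ρ)⁻¹) := by
  intro F hF
  refine tentNorm_image_le_of_tendsto hp (by linarith) hK (isMult_multPlus hβ)
    (ms := fun J t s => ∑ j ∈ Finset.range J, multShell β j t s) (fun J => ⟨?_, ?_⟩) ?_ hF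
    fun J => ?_
  · exact (IsMult.sum (isMult_multShell hβ) (Finset.range J)).meas
  · intro t s ht hs
    rw [sum_multShell β J hs]
    split_ifs
    · exact (isMult_multPlus hβ).le t s ht hs
    · simp
  · intro t s ht hs
    refine tendsto_const_nhds.congr' ?_
    filter_upwards [eventually_gt_atTop (⌊Real.log t⌋ - ⌊Real.log s⌋).natAbs] with J hJ
    rw [sum_multShell β J hs, if_pos]
    exact Int.le_natAbs.trans_lt (by exact_mod_cast hJ)
  · refine (tentBound_sum hK hq (isMult_multShell hβ) h (Finset.range J) F hF).trans
      (mul_le_mul_left ?_ _)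
    rw [← Finset.mul_sum, ← ENNReal.tsum_geometric]
    exact mul_le_mul_right (ENNReal.sum_le_tsum _) _

end Shell

/-! ### Extrapolation from `T^{p,2}` for `K⁺` -/

/-- Hypotheses on test functions in terms of the integral itself. -/
lemma tentBound_of_extendsBoundedOnTent {p σ M q : ℝ} {B : ℝ≥0} {K : OpKernel n N}
    (hK : KernelBound p σ M B K) (hq : q ∈ Icc (1 : ℝ) 2) {C : ℝ≥0}
    (h : ExtendsBoundedOnTent q (kPlus K 0) C) : TentBound q K (multPlus 0) C := by
  have hm0 : IsMult 1 (multPlus 0) := by simpa using isMult_multPlus le_rfl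
  refine tentBound_of_isTest hK hq hm0 fun φ hφ => ?_
  obtain ⟨G, hG, hφG, hle⟩ := h φ hφ
  rw [kPlus_eq_mulK] at hφG
  rwa [← tentNorm_congr_ae q (hφG.ae_eq_image (hK.meas.mulK hm0.meas) hφ.isNice.meas hG.1)]

/-- For `β > n(1/q - 1/p)` the norms on `T^{q,2}` of the shells are summable: the decay `e^{-βj}` on
`T^{p,2}` is interpolated with a growth at most `e^{(β₀ - β)j}` on `T^{1,2}`, for any
`β₀ > n(1 - 1/p)`. -/
lemma exists_tentBound_multShell (hn : 0 < n) {p M : ℝ} {B : ℝ≥0} {K : OpKernel n N}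
    (hK : KernelBound p ((n : ℝ) * (1 / p - 1 / 2)) M B K) (hp : p ∈ Icc (1 : ℝ) 2)
    (hM : (n : ℝ) / 2 < M) {C : ℝ≥0} (h : TentBound p K (multPlus 0) C) {q β : ℝ} (hq : 1 < q)
    (hqp : q ≤ p) (hβ : (n : ℝ) * (1 / q - 1 / p) < β) :
    ∃ A : ℝ≥0, ∃ k : ℝ, 0 < k ∧
      ∀ j : ℕ, TentBound q K (multShell β j) (A * ENNReal.ofReal (Real.exp (-k)) ^ j) := by
  have hp0 : 0 < p := by linarith [hp.1]
  have hq0 : 0 < q := by linarith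
  have hn0 : (0 : ℝ) ≤ n := n.cast_nonneg
  have hβ0 : 0 < β := lt_of_le_of_lt
    (mul_nonneg hn0 (sub_nonneg.mpr (one_div_le_one_div_of_le hq0 hqp))) hβ
  have hexp : ∀ (x : ℝ) (j : ℕ), ENNReal.ofReal (Real.exp (j * x)) =
      ENNReal.ofReal (Real.exp x) ^ j := fun x j => by
    rw [Real.exp_nat_mul, ENNReal.ofReal_pow (Real.exp_pos _).le]
  have hshell := tentBound_multShell hK hp0 (hq.le.trans hqp) h hβ0.le
  rcases hqp.eq_or_lt with rfl | hqp
  · refine ⟨(Real.exp β).toNNReal * C, β, hβ0, fun j => ?_⟩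
    convert hshell j using 1
    rw [show β * (1 - j) = β + j * (-β) by ring, Real.exp_add, ENNReal.ofReal_mul
      (Real.exp_pos _).le, hexp, ENNReal.coe_mul]
    show ENNReal.ofReal _ * _ * _ = _
    ring
  set σ := (n : ℝ) * (1 / p - 1 / 2) with hσdef
  have hip : 1 / 2 ≤ 1 / p := one_div_le_one_div_of_le hp0 hp.2
  have hσ : 0 ≤ σ := mul_nonneg hn0 (by linarith)
  have hσn : σ + n * (1 - 1 / p) = n / 2 := by rw [hσdef]; ring
  have h1p : 0 ≤ (n : ℝ) * (1 - 1 / p) :=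
    mul_nonneg hn0 (sub_nonneg.mpr ((div_le_one hp0).mpr hp.1))
  have hpq : 0 < p - q := by linarith
  -- `n (1 - 1/p)` is admissible because `β > n (1/q - 1/p)`, and there is room to enlarge it
  have hroom : (n : ℝ) * (1 - 1 / p) * (p - q) < β * q * (p - 1) := by
    have h1 : (n : ℝ) * (1 / q - 1 / p) * (q * (p - 1)) < β * (q * (p - 1)) :=
      mul_lt_mul_of_pos_right hβ (mul_pos hq0 (by linarith))
    have h2 : (n : ℝ) * (1 / q - 1 / p) * (q * (p - 1)) = n * (1 - 1 / p) * (p - q) := by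
      field_simp
    linarith
  set η := (β * q * (p - 1) / (p - q) - n * (1 - 1 / p)) / 4 with hη
  have hη0 : 0 < η := by
    have : (n : ℝ) * (1 - 1 / p) < β * q * (p - 1) / (p - q) := (lt_div_iff₀ hpq).mpr hroom
    rw [hη]; linarith
  set β₀ := n * (1 - 1 / p) + 2 * η with hβ₀
  have hβ₀room : (β₀ - β) * (p - q) < β * p * (q - 1) := by
    have h1 : β₀ < β * q * (p - 1) / (p - q) := by linarith
    have h2 := (lt_div_iff₀ hpq).mp h1
    nlinarith
  set M' := min M (n / 2 + η) with hM'
  have hM'1 : (n : ℝ) / 2 < M' := lt_min hM (by linarith)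
  have hM'2 : M' ≤ n / 2 + η := min_le_right _ _
  obtain ⟨C₁, hC₁⟩ := exists_lintegral_coneSq_image_rpow_half_le hn N hη0 hM'1
  obtain ⟨C₂, hC₂⟩ := exists_lintegral_coneSq_image_interpolation hn N hq hqp hp.2
  -- the parameter of the interpolation is `e^{jx}` on the `j`-th shell
  have hq1 : 0 < q - 1 := by linarith
  obtain ⟨x, hx1, hx2⟩ : ∃ x, (β₀ - β) / (q - 1) < x ∧ x < β * p / (p - q) := by
    refine exists_between ?_
    rw [div_lt_div_iff₀ hq1 hpq]
    exact hβ₀room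
  rw [div_lt_iff₀ hq1] at hx1
  rw [lt_div_iff₀ hpq] at hx2
  set k := min (x * (q - 1) - (β₀ - β)) (β * p - x * (p - q)) with hk
  have hk0 : 0 < k := lt_min (by linarith) (by linarith)
  set Z := ENNReal.ofReal ((2 * ((n : ℝ) + 1)) ^ (M' - σ)) with hZ
  set E₁ := C₁ * (B * ENNReal.ofReal (Real.exp |β₀ - β|) * Z) with hE₁
  set E₂ := (ENNReal.ofReal (Real.exp β) * C) ^ p with hE₂
  have hE₂t : E₂ ≠ ⊤ := by finiteness
  have hAt : C₂ * (E₁ + E₂) ≠ ⊤ := by finiteness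
  have key : ∀ (j : ℕ) (F : ℝ × Space n → Val N), IsNice F →
      ∫⁻ x, coneSq (image (mulK (multShell β j) K) F) x ^ (q / 2) ≤
        ((C₂ * (E₁ + E₂)).toNNReal * (Real.exp (j * -k)).toNNReal : ℝ≥0) *
          ∫⁻ x, coneSq F x ^ (q / 2) := by
    intro j F hF
    have hm := isMult_multShell hβ0.le j
    set D : ℝ≥0 := (Real.exp (|β₀ - β| + j * (β₀ - β))).toNNReal with hD
    have hloc : LocalBound η M' (B * D * Z) (mulK (multShell β j) K) :=
      hK.localBound_of_lt hσ (by linarith) (min_le_left _ _) (β := β₀) (by linarith)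
        fun t s ht hs => by
          rw [hD, Real.coe_toNNReal _ (Real.exp_pos _).le]
          exact norm_multShell_le β β₀ j ht hs
    have h1 := hC₁ _ p σ _ _ _ hp0 hloc (hK.dominated_const hm) (fun _ => measurable_const)
      (fun _ _ => le_rfl)
    have h2 := fun F hF => (hshell j).lintegral_le (F := F) hp0 hF
    have h3 := hC₂ p σ _ _ _ _ _ (hK.dominated_const hm) (fun _ _ => le_rfl) h1 h2
      (Real.exp (j * x)) (Real.exp_pos _) F hF
    set I := ∫⁻ x, coneSq (image (mulK (multShell β j) K) F) x ^ (q / 2)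
    set Y := ∫⁻ x, coneSq F x ^ (q / 2)
    have hD' : (D : ℝ≥0∞) = ENNReal.ofReal (Real.exp |β₀ - β|) *
        ENNReal.ofReal (Real.exp (j * (β₀ - β))) := by
      rw [← ENNReal.ofReal_mul (Real.exp_pos _).le, ← Real.exp_add]
      rfl
    have hpow : ∀ y r : ℝ, ENNReal.ofReal (Real.exp y) ^ r = ENNReal.ofReal (Real.exp (y * r)) :=
      fun y r => by rw [ENNReal.ofReal_rpow_of_pos (Real.exp_pos _), ← Real.exp_mul]
    have hmul : ∀ y r : ℝ, ENNReal.ofReal (Real.exp y) * ENNReal.ofReal (Real.exp r) =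
        ENNReal.ofReal (Real.exp (y + r)) :=
      fun y r => by rw [← ENNReal.ofReal_mul (Real.exp_pos _).le, ← Real.exp_add]
    have hone : ∀ y : ℝ, ENNReal.ofReal (Real.exp (-y)) * ENNReal.ofReal (Real.exp y) = 1 :=
      fun y => by rw [hmul]; simp
    have hj : (0 : ℝ) ≤ j := j.cast_nonneg
    have hk1 : k ≤ x * (q - 1) - (β₀ - β) := min_le_left _ _
    have hk2 : k ≤ β * p - x * (p - q) := min_le_right _ _
    calc I = ENNReal.ofReal (Real.exp (-(j * x * q))) *
          (ENNReal.ofReal (Real.exp (j * x)) ^ q * I) := by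
          rw [hpow, ← mul_assoc, hone, one_mul]
      _ ≤ _ := mul_le_mul_right h3 _
      _ = C₂ * (E₁ * (ENNReal.ofReal (Real.exp (-(j * x * q))) * (ENNReal.ofReal (Real.exp (j * x)) *
            ENNReal.ofReal (Real.exp (j * (β₀ - β))))) +
          E₂ * (ENNReal.ofReal (Real.exp (-(j * x * q))) * (ENNReal.ofReal (Real.exp (j * x * p)) *
            ENNReal.ofReal (Real.exp (-(j * β) * p))))) * Y := by
          have h4 : (ENNReal.ofReal (Real.exp (β * (1 - j))) * C) ^ p =
              E₂ * ENNReal.ofReal (Real.exp (-(j * β) * p)) := by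
            rw [show β * (1 - j) = β + -(j * β) by ring, ← hmul, hE₂, ← hpow,
              ← ENNReal.mul_rpow_of_nonneg _ _ hp0.le]
            congr 1
            ring
          rw [h4, hpow, hD', hE₁]
          ring
      _ ≤ C₂ * (E₁ * ENNReal.ofReal (Real.exp (j * -k)) +
            E₂ * ENNReal.ofReal (Real.exp (j * -k))) * Y := by
          simp only [hmul]
          gcongr
          · nlinarith [mul_le_mul_of_nonneg_left hk1 hj]
          · nlinarith [mul_le_mul_of_nonneg_left hk2 hj]
      _ = _ := by
          rw [ENNReal.coe_mul, ENNReal.coe_toNNReal hAt]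
          show _ = C₂ * (E₁ + E₂) * ENNReal.ofReal _ * Y
          ring
  refine ⟨(C₂ * (E₁ + E₂)).toNNReal ^ (1 / q), k / q, by positivity, fun j => ?_⟩
  convert tentBound_of_lintegral_le hq0 (key j) using 1
  rw [ENNReal.coe_mul, ENNReal.mul_rpow_of_nonneg _ _ (by positivity),
    ENNReal.coe_rpow_of_nonneg _ (by positivity)]
  congr 1
  show _ = ENNReal.ofReal _ ^ _
  rw [← hexp, ENNReal.ofReal_rpow_of_pos (Real.exp_pos _), ← Real.exp_mul]
  congr 2
  ring

theorem KernelBound.exists_boundedOnTent_kPlus_of_extends (hn : 0 < n) {p M : ℝ} {B : ℝ≥0}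
    {K : OpKernel n N} (hK : KernelBound p ((n : ℝ) * (1 / p - 1 / 2)) M B K)
    (hp : p ∈ Icc (1 : ℝ) 2) (hM : (n : ℝ) / 2 < M) {C : ℝ≥0}
    (h : ExtendsBoundedOnTent p (kPlus K 0) C) {q β : ℝ} (hq : q ∈ Icc 1 p)
    (hβ : (n : ℝ) * (1 / q - 1 / p) < β) : ∃ C : ℝ≥0, BoundedOnTent q (kPlus K β) C := by
  have hp0 : 0 < p := by linarith [hp.1]
  have hq0 : 0 < q := by linarith [hq.1]
  have hβ0 : 0 ≤ β := le_trans (mul_nonneg n.cast_nonneg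
    (sub_nonneg.mpr (one_div_le_one_div_of_le hq0 hq.2))) hβ.le
  rcases hq.1.eq_or_lt with rfl | hq1
  · rw [div_one] at hβ
    obtain ⟨C, hC⟩ := hK.exists_boundedOnTent_kPlus hn hp hM hβ
    exact ⟨C, hC β (Complex.ofReal_re β)⟩
  obtain ⟨A, k, hk, hA⟩ := exists_tentBound_multShell hn hK hp hM
    (tentBound_of_extendsBoundedOnTent hK hp h) hq1 hq.2 hβ
  have h1 := tentBound_multPlus_of_multShell hK hp0 hq.1 hβ0 hA
  set A' := (A : ℝ≥0∞) * (1 - ENNReal.ofReal (Real.exp (-k)))⁻¹ with hA'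
  have hlt : ENNReal.ofReal (Real.exp (-k)) < 1 := by
    rw [ENNReal.ofReal_lt_one, Real.exp_lt_one_iff]
    linarith
  have hA't : A' ^ q ≠ ⊤ := ENNReal.rpow_ne_top_of_nonneg hq0.le
    (ENNReal.mul_ne_top ENNReal.coe_ne_top (ENNReal.inv_ne_top.mpr (tsub_pos_of_lt hlt).ne'))
  refine ⟨(A' ^ q).toNNReal ^ (1 / q), ?_⟩
  rw [kPlus_eq_mulK]
  refine boundedOnTent_of_isNice hp0 ⟨hq.1, hq.2.trans hp.2⟩
    (hK.dominated (isMult_multPlus hβ0).meas (isMult_multPlus hβ0).le)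
    (measurable_mulWeight B 1 (measurable_multPlus _)) (mulWeight_le B 1 _)
    (fun F hF hfin => admissible_multPlus hp.2 hq.1 hq.2 (by simpa using hβ) hF hfin)
    fun F hF => ?_
  rw [ENNReal.coe_toNNReal hA't]
  exact h1.lintegral_le hq0 hF

end TentSIO

end

theorem proposition9p1 (n N : ℕ) (hn : 0 < n) (p M : ℝ) (hp : p ∈ Set.Icc (1 : ℝ) 2)
    (hM : (n : ℝ) / 2 < M) (K : TentSIO.OpKernel n N)
    (hKmeas : TentSIO.StronglyMeas K) (hKbdd : TentSIO.UniformlyBounded K)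
    (hKoff : TentSIO.OffDiagonal p M K) :
    (∀ α : ℝ, 0 < α → ∃ C : ℝ≥0, TentSIO.BoundedOnTent 1 (TentSIO.kMinus K α) C) ∧
    (∀ β : ℝ, (n : ℝ) * (1 - 1 / p) < β →
      ∃ C : ℝ≥0, ∀ γ : ℝ, TentSIO.BoundedOnTent 1 (TentSIO.kPlus K (β + γ * Complex.I)) C) ∧
    (∀ q α β : ℝ, q ∈ Set.Icc 1 p → 0 < α → (n : ℝ) * (1 / q - 1 / p) < β →
      (∃ C : ℝ≥0, ∀ γ : ℝ, TentSIO.ExtendsBoundedOnTent p (TentSIO.kPlus K (γ * Complex.I)) C) →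
      ∃ C : ℝ≥0, TentSIO.BoundedOnTent q (TentSIO.kMinus K α + TentSIO.kPlus K β) C) := by
  have hn0 : (0 : ℝ) ≤ n := n.cast_nonneg
  have hp0 : 0 < p := by linarith [hp.1]
  obtain ⟨B, hK⟩ := TentSIO.exists_kernelBound hp (by linarith) hKmeas hKbdd hKoff
  have hσ : 0 ≤ (n : ℝ) * (1 / p - 1 / 2) :=
    mul_nonneg hn0 (sub_nonneg.mpr (one_div_le_one_div_of_le hp0 hp.2))
  have hσM : (n : ℝ) * (1 / p - 1 / 2) ≤ M := by
    have : (n : ℝ) * (1 / p) ≤ n := mul_le_of_le_one_right hn0 ((div_le_one hp0).mpr hp.1)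
    linarith
  refine ⟨fun α hα => hK.exists_boundedOnTent_kMinus hn hp0 hσ hσM hM ⟨le_rfl, one_le_two⟩ hα,
    fun β hβ => ?_, fun q α β hq hα hβ ⟨C, hC⟩ => ?_⟩
  · obtain ⟨C, hC⟩ := hK.exists_boundedOnTent_kPlus hn hp hM hβ
    exact ⟨C, fun γ => hC _ (by simp)⟩
  · have hq2 : q ∈ Set.Icc (1 : ℝ) 2 := ⟨hq.1, hq.2.trans hp.2⟩
    obtain ⟨C₁, h₁⟩ := hK.exists_boundedOnTent_kMinus hn hp0 hσ hσM hM hq2 hα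
    obtain ⟨C₂, h₂⟩ := hK.exists_boundedOnTent_kPlus_of_extends hn hp hM
      (by simpa using hC 0) hq hβ
    exact ⟨C₁ + C₂, h₁.add hq2 h₂⟩
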